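/- **Setting.** Let $M$ be a smooth $n$-dimensional manifold without boundary, Hausdorff and second countable (in particular $M=\mathbb R^n$, or $M$ compact and connected), with smooth vector fields $X_1,\dots,X_m$ such that at every point $p$ the values at $p$ of the smallest Lie algebra of vector fields containing all $\sum_i a_iX_i$, $a_i\in C^\infty(M)$, fill $T_pM$, and with a nowhere vanishing smooth $n$-form $\omega$. Let $\Omega\subseteq M$ be a non-empty connected open set with compact closure (for instance a bounded domain with piecewise smooth boundary; no regularity of the boundary is needed). All functions are real-valued. For an open $U\subseteq\Omega$ write $L^2(U)=L^2(U,|\omega|)$; let $$S^1(U)=\{v\in L^2(U): X_iv\in L^2(U),\ i=1,\dots,m\},\qquad \|v\|_{S^1}^2=\|v\|^2+\|\nabla_Hv\|^2,\qquad \langle \nabla_H v,\nabla_H w\rangle=\sum_i\langle X_iv,X_iw\rangle ,$$ where $X_iv$ is taken in the sense of distributions with respect to $\omega$. For a form domain $V\subseteq S^1(U)$, the operator $-\Delta_V$ is defined by: $u\in D(-\Delta_V)$ and $-\Delta_Vu=w\in L^2(U)$ iff $u\in V$ and $\langle\nabla_Hv,\nabla_Hu\rangle=\langle v,w\rangle$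 for all $v\in V$. An eigenfunction with eigenvalue $\lambda$ is a $u\neq0$ with $-\Delta_Vu=\lambda u$. The number $\lambda$ is the $k$-th eigenvalue (in increasing order, counted with multiplicity) if the eigenfunctions with eigenvalue $<\lambda$ span a space of dimension $<k$ and those with eigenvalue $\le\lambda$ span a space of dimension $\ge k$. The choice $V=S^1(U)$ is the Neumann problem, with eigenvalues $\lambda_k^N(U)$. For the mixed problem with Dirichlet conditions on $\Gamma$, $V=S^1_{0,\Gamma}(U)$ is the $S^1$-closure of the set of $\varphi\in C^\infty(U)\cap S^1(U)$ with $\operatorname{supp}\varphi\cap\overline\Gamma=\varnothing$; its eigenvalues are $\lambda_k^Z(U,\Gamma)$. Here $\operatorname{supp}\varphi$ and $\overline{\Gamma}$ are closures in an ambient space which is either $\Omega$ or $M$, as specified below. **Statement.** Let $u$ be an eigenfunction of the Neumann problem on $\Omega$ with eigenvalue $\lambda=\lambda_2^N(\Omega)$, represented by a function that is continuous on $\Omega$. Let $Z_u=\{x\in\Omega:u(x)=0\}$ and $\Omega_+=\{x\in\Omega:u(x)>0\}$. (Replacing $u$ by $-u$ one may take $\Omega_+$ to be the one of $\{u>0\}$,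 $\{u<0\}$ with the smaller volume; this is not needed.) Then $u|_{\Omega_+}$ is an eigenfunction, with eigenvalue $\lambda$, of the mixed problem on $\Omega_+$ with Dirichlet conditions on $Z_u$, and $\lambda=\lambda_1^Z(\Omega_+,Z_u)$. Moreover $\lambda$ is the minimum of the Rayleigh quotient $\|\nabla_Hv\|^2/\|v\|^2$ over $v\in S^1_{0,Z_u}(\Omega_+)\setminus\{0\}$. Here the closures in the definition of $S^1_{0,Z_u}(\Omega_+)$ are taken in $\Omega$, so that test functions vanish near each point of the (relatively closed) set $Z_u$. If $u(x)\to0$ as $x\to y$, $x\in\Omega$, for every $y$ in the closure of $Z_u$ in $M$ (for instance if $u$ is continuous up to $\partial\Omega$), then all the conclusions also hold when these closures are taken in $M$. -/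

import Mathlib

open MeasureTheory Set Filter Topology
open scoped Manifold ContDiff

noncomputable section

namespace CC

section VectorFields

variable {n m : ℕ} {M : Type*} [TopologicalSpace M] [ChartedSpace (EuclideanSpace ℝ (Fin n)) M]

/-- The smallest Lie subalgebra of the vector fields on `M` that contains all horizontal vector
fields, i.e. all combinations `∑ aᵢ Xᵢ` with smooth coefficients `aᵢ`. -/
inductive LieHull (X : Fin m → (x : M) → TangentSpace (𝓡 n) x) :
    ((x : M) → TangentSpace (𝓡 n) x) → Prop
  | horizontal (a : Fin m → M → ℝ) (ha : ∀ i, ContMDiff (𝓡 n) 𝓘(ℝ, ℝ) ∞ (a i)) :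
      LieHull X (fun x => ∑ i, a i x • X i x)
  | add {Y Z : (x : M) → TangentSpace (𝓡 n) x} :
      LieHull X Y → LieHull X Z → LieHull X (fun x => Y x + Z x)
  | smul (c : ℝ) {Y : (x : M) → TangentSpace (𝓡 n) x} :
      LieHull X Y → LieHull X (fun x => c • Y x)
  | bracket {Y Z : (x : M) → TangentSpace (𝓡 n) x} :
      LieHull X Y → LieHull X Z → LieHull X (VectorField.mlieBracket (𝓡 n) Y Z)

/-- The coefficient `ρ` of the `n`-form `v = ρ dy¹ ∧ … ∧ dyⁿ` in the preferred chart at `x`. -/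
def formCoeff (v : (x : M) → (TangentSpace (𝓡 n) x) [⋀^Fin n]→ₗ[ℝ] ℝ) (x : M)
    (y : EuclideanSpace ℝ (Fin n)) : ℝ :=
  v ((extChartAt (𝓡 n) x).symm y) fun i =>
    mfderiv (𝓡 n) (𝓡 n) (extChartAt (𝓡 n) x).symm y
      (EuclideanSpace.single i (1 : ℝ) : EuclideanSpace ℝ (Fin n))

/-- The components of a vector field in the preferred chart at `x`. -/
def fieldCoeff (Y : (x : M) → TangentSpace (𝓡 n) x) (x : M)
    (y : EuclideanSpace ℝ (Fin n)) : EuclideanSpace ℝ (Fin n) :=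
  mfderiv (𝓡 n) (𝓡 n) (extChartAt (𝓡 n) x) ((extChartAt (𝓡 n) x).symm y)
    (Y ((extChartAt (𝓡 n) x).symm y))

/-- The derivative `Y φ` of a function along a vector field. -/
def dirDeriv (Y : (x : M) → TangentSpace (𝓡 n) x) (φ : M → ℝ) (x : M) : ℝ :=
  mfderiv (𝓡 n) 𝓘(ℝ, ℝ) φ x (Y x)

/-- Smooth functions on `M` with compact support contained in `U`. -/
def IsTestFunction (U : Set M) (φ : M → ℝ) : Prop :=
  ContMDiff (𝓡 n) 𝓘(ℝ, ℝ) ∞ φ ∧ HasCompactSupport φ ∧ tsupport φ ⊆ U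

end VectorFields

/-- A Carnot–Carathéodory structure on the `n`-manifold `M`: a generating family of smooth
vector fields `X₁, …, Xₘ` that is bracket-generating, and a smooth volume form. -/
structure CCStructure (n m : ℕ) (M : Type*) [TopologicalSpace M]
    [ChartedSpace (EuclideanSpace ℝ (Fin n)) M] [IsManifold (𝓡 n) ∞ M] where
  /-- the generating family -/
  X : Fin m → (x : M) → TangentSpace (𝓡 n) x
  smooth_X : ∀ i, ContMDiff (𝓡 n) (𝓡 n).tangent ∞
    (fun x => (⟨x, X i x⟩ : TangentBundle (𝓡 n) M))
  bracket_generating : ∀ (p : M) (w : TangentSpace (𝓡 n) p), ∃ Y, LieHull X Y ∧ Y p = w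
  /-- the volume form -/
  volForm : (x : M) → (TangentSpace (𝓡 n) x) [⋀^Fin n]→ₗ[ℝ] ℝ
  smooth_volForm : ∀ x, ContDiffOn ℝ ∞ (formCoeff volForm x) (extChartAt (𝓡 n) x).target
  volForm_ne_zero : ∀ x, volForm x ≠ 0

namespace CCStructure

variable {n m : ℕ} {M : Type*} [TopologicalSpace M]
  [ChartedSpace (EuclideanSpace ℝ (Fin n)) M] [IsManifold (𝓡 n) ∞ M] (S : CCStructure n m M)

/-- The divergence of `Y` with respect to the volume form `ω`, `L_Y ω = div(Y) ω`. Where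
`ω = ρ dy¹ ∧ … ∧ dyⁿ` this is `ρ⁻¹ ∑ ∂ᵢ(ρ Yⁱ)`; at `p` we use the preferred chart at `p`. -/
def divergence (Y : (x : M) → TangentSpace (𝓡 n) x) (p : M) : ℝ :=
  (formCoeff S.volForm p (extChartAt (𝓡 n) p p))⁻¹ *
    ∑ i, fderiv ℝ (fun y => formCoeff S.volForm p y * fieldCoeff Y p y i)
      (extChartAt (𝓡 n) p p) (EuclideanSpace.single i 1)

/-- The formal adjoint `Xᵢ* φ = - Xᵢ φ - div(Xᵢ) φ`. -/
def adj (i : Fin m) (φ : M → ℝ) (x : M) : ℝ :=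
  - dirDeriv (S.X i) φ x - S.divergence (S.X i) x * φ x

variable [MeasurableSpace M]

/-- The measure `|ρ| dy` on the domain of the preferred chart at `x`. -/
def chartMeasure (x : M) : Measure M :=
  (((volume : Measure (EuclideanSpace ℝ (Fin n))).restrict
      (extChartAt (𝓡 n) x).target).withDensity
    fun y => ENNReal.ofReal |formCoeff S.volForm x y|).map (extChartAt (𝓡 n) x).symm

/-- The measure on `M` given by integration against the volume form. The chart measures are its
restrictions to the chart domains, and it is their least upper bound. -/
def vol : Measure M := ⨆ x : M, S.chartMeasure x

/-- The real Hilbert space `L²(U)`. -/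
abbrev L2 (U : Set M) := Lp ℝ 2 (S.vol.restrict U)

/-- `g` is the derivative `Xᵢ u` on `U` in the sense of distributions. -/
def HasWeakDeriv (U : Set M) (i : Fin m) (u g : S.L2 U) : Prop :=
  ∀ φ : M → ℝ, IsTestFunction (n := n) U φ →
    ∫ x in U, u x * S.adj i φ x ∂S.vol = ∫ x in U, g x * φ x ∂S.vol

/-- The space `S¹(U)` of all `u ∈ L²(U)` with `∇_H u ∈ L²(U)`. An element `u` is recorded as the
pair of `u` and `(X₁ u, …, Xₘ u)`; the topology of `L²(U) × L²(U)ᵐ` induces the topology of the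
norm `‖u‖² + ‖∇_H u‖² = ‖u‖² + ∑ ‖Xᵢ u‖²`. -/
def sobolev (U : Set M) : Set (S.L2 U × (Fin m → S.L2 U)) :=
  {p | ∀ i, S.HasWeakDeriv U i p.1 (p.2 i)}

/-- The smooth functions on `U` with finite `S¹`-norm whose support does not meet the closure of
`Γ`, both closures being taken in the ambient space `A ⊆ M`. For `A = univ` these are the
closures in `M`. -/
def mixedSmooth (A U Γ : Set M) : Set (S.L2 U × (Fin m → S.L2 U)) :=
  {p | ∃ φ : M → ℝ, ContMDiffOn (𝓡 n) 𝓘(ℝ, ℝ) ∞ φ U ∧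
    closure {x ∈ U | φ x ≠ 0} ∩ closure Γ ∩ A = ∅ ∧
    p.1 =ᵐ[S.vol.restrict U] φ ∧
    ∀ i, p.2 i =ᵐ[S.vol.restrict U] dirDeriv (S.X i) φ}

/-- The space `S¹_{0,Γ}(U)`: the closure of `mixedSmooth` in the `S¹`-norm. -/
def mixedSobolev (A U Γ : Set M) : Set (S.L2 U × (Fin m → S.L2 U)) :=
  closure (S.mixedSmooth A U Γ)

variable {S}

/-- For a form domain `V`, `u` is in the domain of the self-adjoint operator `-Δ` of the form
`q(v, u) = ⟨∇_H v, ∇_H u⟩ = ∑ ⟨Xᵢ v, Xᵢ u⟩` on `V`, and `-Δ u = w`. -/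
def IsNegLaplacian {U : Set M} (V : Set (S.L2 U × (Fin m → S.L2 U))) (u w : S.L2 U) : Prop :=
  ∃ g, (u, g) ∈ V ∧ ∀ p ∈ V, ∑ i, inner ℝ (p.2 i) (g i) = inner ℝ p.1 w

/-- `u ≠ 0` and `-Δ u = lam u`. -/
def IsEigenvector {U : Set M} (V : Set (S.L2 U × (Fin m → S.L2 U))) (lam : ℝ) (u : S.L2 U) :
    Prop :=
  u ≠ 0 ∧ IsNegLaplacian V u (lam • u)

/-- The class of the function `u` in `L²(U)` is an eigenfunction with eigenvalue `lam`. -/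
def IsEigenfunction {U : Set M} (V : Set (S.L2 U × (Fin m → S.L2 U))) (lam : ℝ) (u : M → ℝ) :
    Prop :=
  ∃ hu : MemLp u 2 (S.vol.restrict U), IsEigenvector V lam (hu.toLp u)

/-- `lam` is the `k`-th eigenvalue (`k ≥ 1`) of `-Δ` in increasing order, counted with
multiplicity: the eigenfunctions with eigenvalue below `lam` span a space of dimension less than
`k`, and those with eigenvalue at most `lam` span a space of dimension at least `k`. -/
def IsKthEigenvalue {U : Set M} (V : Set (S.L2 U × (Fin m → S.L2 U))) (k : ℕ) (lam : ℝ) : Prop :=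
  Module.rank ℝ (Submodule.span ℝ {u | ∃ μ < lam, IsEigenvector V μ u}) < (k : Cardinal) ∧
    (k : Cardinal) ≤ Module.rank ℝ (Submodule.span ℝ {u | ∃ μ ≤ lam, IsEigenvector V μ u})

/-- `lam` is the minimum of the Rayleigh quotient `‖∇_H v‖² / ‖v‖²` over `V ∖ {0}`. -/
def IsRayleighMin {U : Set M} (V : Set (S.L2 U × (Fin m → S.L2 U))) (lam : ℝ) : Prop :=
  IsLeast {r | ∃ p ∈ V, p.1 ≠ 0 ∧ r = (∑ i, ‖p.2 i‖ ^ 2) / ‖p.1‖ ^ 2} lam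

end CCStructure

end CC

end

/-! Suppose first that the second Neumann eigenvalue were `≤ 0`. Every eigenfunction counted up to
it then has zero horizontal energy, so it is annihilated in the sense of distributions by the `Xᵢ`,
hence by their smooth combinations and by all iterated brackets (`WeaklyInvariant.lieBracket`),
hence near each point by a full frame. On a connected set it is constant
(`ae_const_of_hasWeakDeriv_zero`), so these functions span at most a line, and two dimensions are
impossible. Thus `lam > 0`, and testing the Neumann equation with the constant `1` gives `∫ u = 0`;
since `u ≠ 0`, the set `{u > 0}` is non-empty.

A test function on `{u > 0}` that vanishes near the nodal set extends by zero to a smooth function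
on `Ω`, so the Neumann equation on `Ω` contains the weak equation on `{u > 0}` (`nodal_equation`).
That `u` itself belongs to the mixed form domain is shown by truncation. Friedrichs' commutator
lemma and a Meyers–Serrin patching give smooth `φ k` close to `u` both uniformly and in `S¹`
(`exists_smooth_approx`). Cutting `φ k` off smoothly at height about `1 / (k + 1)` leaves functions
supported where `u ≥ 1 / (k + 1)`, and these converge to `u` in `S¹` (`restr_mem_mixedSobolev`).
Only continuity of `u` enters, and no regularity of the nodal set.

The lower bound is Picone's argument. Inserting `φ² / (u + δ)` into the equation and using `∇u ·
∇(φ² / (u + δ)) ≤ |∇φ|²` yields `lam ∫ φ² u / (u + δ) ≤ ‖∇φ‖²`, and `δ → 0` gives `lam ‖φ‖² ≤ ‖∇φ‖²`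
(`nodal_poincare`). The inequality passes to the closure, and `u` attains equality. Hence `lam` is
the lowest eigenvalue and the minimum of the Rayleigh quotient (`first_eigenvalue_of_le`), without
compact embeddings, the spectral theorem or a Harnack inequality. -/

namespace CC

set_option linter.unusedSectionVars false

/-! ### Divergence and integration by parts on Euclidean space. -/

section Flat

variable {n : ℕ}

local notation "𝔼" => EuclideanSpace ℝ (Fin n)

/-- The Euclidean divergence of a vector field on `ℝⁿ`. -/
noncomputable def flatDiv (F : 𝔼 → 𝔼) (y : 𝔼) : ℝ :=
  ∑ i, fderiv ℝ (fun y => F y i) y (EuclideanSpace.single i 1)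

lemma differentiableAt_coord {F : 𝔼 → 𝔼} {y : 𝔼} (hF : DifferentiableAt ℝ F y) (i : Fin n) :
    DifferentiableAt ℝ (fun y => F y i) y :=
  (EuclideanSpace.proj (𝕜 := ℝ) i).differentiableAt.comp y hF

lemma sum_coord_single (L : 𝔼 →L[ℝ] ℝ) (v : 𝔼) :
    ∑ i, v i * L (EuclideanSpace.single i 1) = L v := by
  conv_rhs => rw [← (EuclideanSpace.basisFun (Fin n) ℝ).sum_repr v]
  simp

lemma flatDiv_congr {F G : 𝔼 → 𝔼} {y : 𝔼} (h : F =ᶠ[𝓝 y] G) : flatDiv F y = flatDiv G y := by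
  unfold flatDiv
  refine Finset.sum_congr rfl fun i _ => ?_
  have h' : (fun y => F y i) =ᶠ[𝓝 y] fun y => G y i := h.mono fun z hz => by simp only [hz]
  rw [h'.fderiv_eq]

lemma flatDiv_add {F G : 𝔼 → 𝔼} {y : 𝔼} (hF : DifferentiableAt ℝ F y)
    (hG : DifferentiableAt ℝ G y) : flatDiv (fun y => F y + G y) y = flatDiv F y + flatDiv G y := by
  unfold flatDiv
  rw [← Finset.sum_add_distrib]
  refine Finset.sum_congr rfl fun i _ => ?_
  have := fderiv_add (differentiableAt_coord hF i) (differentiableAt_coord hG i)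
  have h2 : (fun y => (F y + G y) i) = (fun y => F y i) + fun y => G y i := rfl
  rw [h2, this]; rfl

lemma flatDiv_smul {ψ : 𝔼 → ℝ} {F : 𝔼 → 𝔼} {y : 𝔼} (hψ : DifferentiableAt ℝ ψ y)
    (hF : DifferentiableAt ℝ F y) :
    flatDiv (fun y => ψ y • F y) y = fderiv ℝ ψ y (F y) + ψ y * flatDiv F y := by
  unfold flatDiv
  rw [← sum_coord_single (fderiv ℝ ψ y) (F y), Finset.mul_sum, ← Finset.sum_add_distrib]
  refine Finset.sum_congr rfl fun i _ => ?_
  have := fderiv_mul hψ (differentiableAt_coord hF i)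
  have h2 : (fun y => (ψ y • F y) i) = ψ * fun y => F y i := rfl
  rw [h2, this]
  simp; ring

lemma flatDiv_const (c : 𝔼) (y : 𝔼) : flatDiv (fun _ => c) y = 0 := by
  simp [flatDiv]

lemma flatDiv_eq_zero_of_notMem_tsupport {F : 𝔼 → 𝔼} {y : 𝔼} (h : y ∉ tsupport F) :
    flatDiv F y = 0 := by
  rw [flatDiv_congr (notMem_tsupport_iff_eventuallyEq.1 h)]
  exact flatDiv_const 0 y

lemma hasCompactSupport_flatDiv {F : 𝔼 → 𝔼} (h : HasCompactSupport F) :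
    HasCompactSupport (flatDiv F) :=
  h.mono' fun _ hy => by_contra fun h' => hy (flatDiv_eq_zero_of_notMem_tsupport h')

lemma continuousOn_flatDiv {F : 𝔼 → 𝔼} {W : Set 𝔼} (hW : IsOpen W) (hF : ContDiffOn ℝ 1 F W) :
    ContinuousOn (flatDiv F) W := by
  refine continuousOn_finsetSum _ fun i _ => ?_
  have h1 : ContDiffOn ℝ 1 (fun y => F y i) W :=
    (EuclideanSpace.proj (𝕜 := ℝ) i).contDiff.comp_contDiffOn hF
  exact (h1.continuousOn_fderiv_of_isOpen hW le_rfl).clm_apply continuousOn_const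

lemma contDiffOn_flatDiv {F : 𝔼 → 𝔼} {W : Set 𝔼} (hW : IsOpen W) (hF : ContDiffOn ℝ ∞ F W) :
    ContDiffOn ℝ ∞ (flatDiv F) W := by
  refine ContDiffOn.sum fun i _ => ?_
  have h1 : ContDiffOn ℝ ∞ (fun y => F y i) W :=
    (EuclideanSpace.proj (𝕜 := ℝ) i).contDiff.comp_contDiffOn hF
  exact (h1.fderiv_of_isOpen hW (by simp)).clm_apply contDiffOn_const

lemma continuous_flatDiv {F : 𝔼 → 𝔼} (hF : ContDiff ℝ 1 F) : Continuous (flatDiv F) :=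
  continuousOn_univ.1 (continuousOn_flatDiv isOpen_univ hF.contDiffOn)

lemma integral_fderiv_apply_eq_zero {f : 𝔼 → ℝ} (hf : ContDiff ℝ 1 f) (hc : HasCompactSupport f)
    (v : 𝔼) : ∫ y, fderiv ℝ f y v = 0 := by
  have h1 : Continuous fun y => fderiv ℝ f y v :=
    (hf.continuous_fderiv one_ne_zero).clm_apply continuous_const
  have h2 : HasCompactSupport fun y => fderiv ℝ f y v :=
    (hc.fderiv ℝ).comp_left (g := fun L : 𝔼 →L[ℝ] ℝ => L v) rfl
  -- Integration by parts against the constant function `1`.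
  have := integral_mul_fderiv_eq_neg_fderiv_mul_of_integrable (μ := (volume : Measure 𝔼))
    (f := fun _ => (1 : ℝ)) (g := f) (v := v) (by simp)
    (by simpa using h1.integrable_of_hasCompactSupport h2)
    (by simpa using hf.continuous.integrable_of_hasCompactSupport hc)
    (fun _ _ => differentiableAt_const _) (fun y _ => hf.differentiable one_ne_zero y)
  simpa using this

lemma integral_flatDiv_eq_zero {F : 𝔼 → 𝔼} (hF : ContDiff ℝ 1 F) (hc : HasCompactSupport F) :
    ∫ y, flatDiv F y = 0 := by
  have h1 : ∀ i, ContDiff ℝ 1 (fun y => F y i) := fun i =>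
    (EuclideanSpace.proj (𝕜 := ℝ) i).contDiff.comp hF
  have h2 : ∀ i, HasCompactSupport (fun y => F y i) := fun i =>
    hc.comp_left (g := fun v : 𝔼 => v i) rfl
  unfold flatDiv
  rw [integral_finsetSum]
  · exact Finset.sum_eq_zero fun i _ => integral_fderiv_apply_eq_zero (h1 i) (h2 i) _
  · intro i _
    exact (((h1 i).continuous_fderiv one_ne_zero).clm_apply
      continuous_const).integrable_of_hasCompactSupport
      (((h2 i).fderiv ℝ).comp_left (g := fun L : 𝔼 →L[ℝ] ℝ => L _) rfl)

/-- A product with a function supported in `W` is as smooth as the factor on `W`. -/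
lemma contDiff_smul_of_tsupport_subset {G : Type*} [NormedAddCommGroup G] [NormedSpace ℝ G]
    {k : ℕ∞} {W : Set 𝔼} (hW : IsOpen W)
    {ψ : 𝔼 → ℝ} {F : 𝔼 → G} (hψ : ContDiff ℝ k ψ) (hs : tsupport ψ ⊆ W)
    (hF : ContDiffOn ℝ k F W) : ContDiff ℝ k (fun y => ψ y • F y) := by
  rw [contDiff_iff_contDiffAt]
  intro y
  by_cases hy : y ∈ tsupport ψ
  · exact hψ.contDiffAt.smul (hF.contDiffAt (hW.mem_nhds (hs hy)))
  · have : (fun y => ψ y • F y) =ᶠ[𝓝 y] fun _ => 0 := by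
      filter_upwards [notMem_tsupport_iff_eventuallyEq.1 hy] with z hz
      simp [hz]
    exact contDiffAt_const.congr_of_eventuallyEq this

lemma hasCompactSupport_smul {G : Type*} [NormedAddCommGroup G] [NormedSpace ℝ G]
    {ψ : 𝔼 → ℝ} (F : 𝔼 → G) (hc : HasCompactSupport ψ) :
    HasCompactSupport (fun y => ψ y • F y) :=
  hc.smul_right

/-- Integration by parts on an open set. -/
lemma integral_mul_flatDiv {W : Set 𝔼} (hW : IsOpen W) {f ψ : 𝔼 → ℝ} {F : 𝔼 → 𝔼}
    (hf : ContDiffOn ℝ 1 f W) (hF : ContDiffOn ℝ 1 F W) (hψ : ContDiff ℝ 1 ψ)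
    (hc : HasCompactSupport ψ) (hs : tsupport ψ ⊆ W) :
    ∫ y, f y * flatDiv (fun y => ψ y • F y) y = - ∫ y, fderiv ℝ f y (F y) * ψ y := by
  have hψF := contDiff_smul_of_tsupport_subset (k := 1) hW hψ hs hF
  have hsupp : tsupport (fun y => ψ y • F y) ⊆ W :=
    (closure_mono (Function.support_smul_subset_left ψ F)).trans hs
  have hcs := hasCompactSupport_smul F hc
  -- The factors are regrouped as `f • (ψ • F)` before the product rule is applied. Since `f` and
  -- `F` are differentiable only on `W`, points off `W` are treated separately; there `ψ` kills
  -- everything.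
  have key : ∀ y, flatDiv (fun y => ψ y • (f y • F y)) y
      = f y * flatDiv (fun y => ψ y • F y) y + fderiv ℝ f y (F y) * ψ y := by
    intro y
    by_cases hy : y ∈ W
    · have e1 : flatDiv (fun y => ψ y • (f y • F y)) y = flatDiv (fun y => f y • (ψ y • F y)) y := by
        congr 1; ext1 z; rw [smul_comm]
      rw [e1, flatDiv_smul ((hf.contDiffAt (hW.mem_nhds hy)).differentiableAt one_ne_zero)
        (hψF.differentiable one_ne_zero y), map_smul, smul_eq_mul]
      ring
    · have hy' : y ∉ tsupport ψ := fun h => hy (hs h)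
      have h3 : y ∉ tsupport (fun y => ψ y • (f y • F y)) := fun h =>
        hy' (closure_mono (Function.support_smul_subset_left ψ _) h)
      rw [flatDiv_eq_zero_of_notMem_tsupport h3,
        flatDiv_eq_zero_of_notMem_tsupport (fun h => hy (hsupp h)),
        image_eq_zero_of_notMem_tsupport hy']
      simp
  have hfF : ContDiffOn ℝ 1 (fun y => f y • F y) W := hf.smul hF
  have h0 := integral_flatDiv_eq_zero (contDiff_smul_of_tsupport_subset (k := 1) hW hψ hs hfF)
    (hasCompactSupport_smul _ hc)
  simp_rw [key] at h0
  -- Each summand needs its own integrability. Continuity at points off `W` holds because the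
  -- summand vanishes near them.
  have hd1 : Continuous fun y => f y * flatDiv (fun y => ψ y • F y) y := by
    rw [continuous_iff_continuousAt]
    intro y
    by_cases hy : y ∈ W
    · exact (hf.continuousOn.continuousAt (hW.mem_nhds hy)).mul (continuous_flatDiv hψF).continuousAt
    · have hz : (fun y => f y * flatDiv (fun y => ψ y • F y) y) =ᶠ[𝓝 y] fun _ => 0 := by
        filter_upwards [(isClosed_tsupport (fun y => ψ y • F y)).isOpen_compl.mem_nhds
          (fun h => hy (hsupp h))] with z hz
        rw [flatDiv_eq_zero_of_notMem_tsupport hz, mul_zero]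
      exact continuousAt_const.congr hz.symm
  have hd2 : Continuous fun y => fderiv ℝ f y (F y) * ψ y := by
    rw [continuous_iff_continuousAt]
    intro y
    by_cases hy : y ∈ W
    · exact (((hf.continuousOn_fderiv_of_isOpen hW le_rfl).clm_apply
        hF.continuousOn).continuousAt (hW.mem_nhds hy)).mul hψ.continuous.continuousAt
    · have hz : (fun y => fderiv ℝ f y (F y) * ψ y) =ᶠ[𝓝 y] fun _ => 0 := by
        filter_upwards [(isClosed_tsupport ψ).isOpen_compl.mem_nhds
          (fun h => hy (hs h))] with z hz
        rw [image_eq_zero_of_notMem_tsupport hz, mul_zero]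
      exact continuousAt_const.congr hz.symm
  rw [integral_add (hd1.integrable_of_hasCompactSupport (hasCompactSupport_flatDiv hcs).mul_left)
    (hd2.integrable_of_hasCompactSupport hc.mul_left)] at h0
  linarith

end Flat

/-! ### Mollification in `L²`. -/

section Mollify

variable {n : ℕ}

local notation "𝔼" => EuclideanSpace ℝ (Fin n)

/-- A fixed smooth bump function in the unit ball. -/
noncomputable def unitBump (n : ℕ) : ContDiffBump (0 : EuclideanSpace ℝ (Fin n)) :=
  ⟨1 / 2, 1, by norm_num, by norm_num⟩

/-- The standard mollifier at scale `ε`. -/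
noncomputable def moll (ε : ℝ) (x : 𝔼) : ℝ :=
  (ε⁻¹) ^ n * (unitBump n).normed volume (ε⁻¹ • x)

lemma contDiff_moll (ε : ℝ) {k : ℕ∞} : ContDiff ℝ k (moll ε : 𝔼 → ℝ) :=
  contDiff_const.mul ((unitBump n).contDiff_normed.comp (contDiff_const_smul _))

lemma moll_nonneg {ε : ℝ} (hε : 0 < ε) (x : 𝔼) : 0 ≤ moll ε x :=
  mul_nonneg (by positivity) ((unitBump n).nonneg_normed _)

lemma moll_eq_zero {ε : ℝ} (hε : 0 < ε) {x : 𝔼} (hx : ε ≤ ‖x‖) : moll ε x = 0 := by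
  have : (ε⁻¹ • x) ∉ Function.support ((unitBump n).normed volume) := by
    rw [ContDiffBump.support_normed_eq]
    simp only [unitBump, Metric.mem_ball, dist_zero_right, norm_smul, norm_inv, Real.norm_eq_abs,
      abs_of_pos hε, not_lt]
    rw [← div_eq_inv_mul]
    exact (one_le_div hε).2 hx
  simp only [Function.mem_support, not_not] at this
  simp [moll, this]

lemma support_moll_subset {ε : ℝ} (hε : 0 < ε) :
    Function.support (moll ε : 𝔼 → ℝ) ⊆ Metric.ball 0 ε := fun x hx => by
  rw [mem_ball_zero_iff]
  by_contra h
  exact hx (moll_eq_zero hε (not_lt.1 h))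

lemma tsupport_moll_subset {ε : ℝ} (hε : 0 < ε) :
    tsupport (moll ε : 𝔼 → ℝ) ⊆ Metric.closedBall 0 ε :=
  (closure_mono (support_moll_subset hε)).trans Metric.closure_ball_subset_closedBall

lemma hasCompactSupport_moll {ε : ℝ} (hε : 0 < ε) : HasCompactSupport (moll ε : 𝔼 → ℝ) :=
  (isCompact_closedBall 0 ε).of_isClosed_subset (isClosed_tsupport _) (tsupport_moll_subset hε)

lemma integral_moll {ε : ℝ} (hε : 0 < ε) : ∫ x : 𝔼, moll ε x = 1 := by
  unfold moll
  rw [integral_const_mul, Measure.integral_comp_inv_smul, ContDiffBump.integral_normed,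
    finrank_euclideanSpace_fin, abs_of_pos (by positivity), smul_eq_mul, mul_one, inv_pow,
    inv_mul_cancel₀ (by positivity)]

lemma integrable_moll {ε : ℝ} (hε : 0 < ε) : Integrable (moll ε : 𝔼 → ℝ) :=
  (contDiff_moll ε (k := 0)).continuous.integrable_of_hasCompactSupport (hasCompactSupport_moll hε)

lemma fderiv_moll (ε : ℝ) (x : 𝔼) : fderiv ℝ (moll ε : 𝔼 → ℝ) x =
    ((ε⁻¹) ^ n * ε⁻¹) • fderiv ℝ ((unitBump n).normed volume) (ε⁻¹ • x) := by
  have h1 : HasFDerivAt (fun x : 𝔼 => ε⁻¹ • x) (ε⁻¹ • ContinuousLinearMap.id ℝ 𝔼) x :=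
    (hasFDerivAt_id x).const_smul ε⁻¹
  have h2 : HasFDerivAt ((unitBump n).normed volume) (fderiv ℝ ((unitBump n).normed volume)
      (ε⁻¹ • x)) (ε⁻¹ • x) :=
    (((unitBump n).contDiff_normed (n := 1)).differentiable one_ne_zero _).hasFDerivAt
  have h3 := ((h2.comp x h1).const_mul ((ε⁻¹) ^ n)).fderiv
  have h4 : (fun y => ε⁻¹ ^ n * ((unitBump n).normed volume ∘ fun x : 𝔼 => ε⁻¹ • x) y)
    = moll ε := rfl
  rw [h4] at h3
  rw [h3]
  ext v
  simp
  ring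

/-- Scaling gives one constant for all `ε`; the gradient costs one extra factor `ε⁻¹`, which the
Lipschitz bound on the field compensates in the commutator estimate. -/
lemma exists_moll_bound (n : ℕ) : ∃ C, 0 ≤ C ∧ ∀ ε > 0, ∀ x : EuclideanSpace ℝ (Fin n),
    |moll ε x| ≤ C * (ε⁻¹) ^ n ∧ ‖fderiv ℝ (moll ε) x‖ ≤ C * ((ε⁻¹) ^ n * ε⁻¹) := by
  obtain ⟨C1, h1⟩ := ((unitBump n).continuous_normed (μ := volume)).bounded_above_of_compact_support
    (unitBump n).hasCompactSupport_normed
  obtain ⟨C2, h2⟩ := (((unitBump n).contDiff_normed (n := 1) (μ := volume)).continuous_fderiv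
    one_ne_zero).bounded_above_of_compact_support
    ((unitBump n).hasCompactSupport_normed.fderiv ℝ)
  refine ⟨max (max C1 C2) 0, le_max_right _ _, fun ε hε x => ⟨?_, ?_⟩⟩
  · rw [moll, abs_mul, abs_of_pos (by positivity : 0 < ε⁻¹ ^ n), mul_comm]
    gcongr
    exact (h1 _).trans ((le_max_left _ _).trans (le_max_left _ _))
  · rw [fderiv_moll, norm_smul, Real.norm_eq_abs, abs_of_pos (by positivity), mul_comm]
    gcongr
    exact (h2 _).trans ((le_max_right _ _).trans (le_max_left _ _))

/-- The mollification of `v` at scale `ε`. -/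
noncomputable def mollify (ε : ℝ) (v : 𝔼 → ℝ) : 𝔼 → ℝ :=
  convolution (moll ε) v (ContinuousLinearMap.lsmul ℝ ℝ) volume

lemma mollify_apply (ε : ℝ) (v : 𝔼 → ℝ) (x : 𝔼) :
    mollify ε v x = ∫ y, moll ε (x - y) * v y := by
  rw [mollify, convolution_eq_swap]; rfl

lemma mollify_apply' (ε : ℝ) (v : 𝔼 → ℝ) (x : 𝔼) :
    mollify ε v x = ∫ t, moll ε t * v (x - t) := by
  rw [mollify, convolution_def]; rfl

lemma contDiff_mollify {ε : ℝ} (hε : 0 < ε) {v : 𝔼 → ℝ} (hv : LocallyIntegrable v) {k : ℕ∞} :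
    ContDiff ℝ k (mollify ε v) :=
  (hasCompactSupport_moll hε).contDiff_convolution_left _ (contDiff_moll ε) hv

lemma fderiv_mollify {ε : ℝ} (hε : 0 < ε) {v : 𝔼 → ℝ} (hv : LocallyIntegrable v) (x w : 𝔼) :
    fderiv ℝ (mollify ε v) x w = ∫ y, fderiv ℝ (moll ε) (x - y) w * v y := by
  have := ((hasCompactSupport_moll hε).hasFDerivAt_convolution_left (ContinuousLinearMap.lsmul ℝ ℝ)
    (contDiff_moll ε (k := 1)) hv x).fderiv
  rw [mollify, this, convolution_eq_swap, ContinuousLinearMap.integral_apply]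
  · rfl
  · exact (((hasCompactSupport_moll hε).fderiv ℝ).convolutionExists_left _
      ((contDiff_moll ε (k := 1)).continuous_fderiv one_ne_zero) hv x).integrable_swap

lemma mollify_eq_zero {ε : ℝ} (hε : 0 < ε) {v : 𝔼 → ℝ} {x : 𝔼}
    (hx : x ∉ Metric.cthickening ε (tsupport v)) : mollify ε v x = 0 := by
  rw [mollify_apply]
  refine integral_eq_zero_of_ae (.of_forall fun y => ?_)
  by_cases hy : y ∈ tsupport v
  · have : ε ≤ ‖x - y‖ := by
      rw [← dist_eq_norm]
      by_contra h
      exact hx (Metric.mem_cthickening_of_dist_le x y ε _ hy (not_le.1 h).le)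
    simp [moll_eq_zero hε this]
  · simp [image_eq_zero_of_notMem_tsupport hy]

lemma tsupport_mollify_subset {ε : ℝ} (hε : 0 < ε) {v : 𝔼 → ℝ} :
    tsupport (mollify ε v) ⊆ Metric.cthickening ε (tsupport v) :=
  closure_minimal (fun _ hx => by_contra fun h => hx (mollify_eq_zero hε h))
    Metric.isClosed_cthickening

/-- Mollifications of a uniformly continuous function converge uniformly. -/
lemma eventually_mollify_sub_le {v : 𝔼 → ℝ} (hv : UniformContinuous v) {δ : ℝ} (hδ : 0 < δ) :
    ∀ᶠ ε in 𝓝[>] (0 : ℝ), ∀ x, |mollify ε v x - v x| ≤ δ := by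
  obtain ⟨r, hr, h⟩ := Metric.uniformContinuous_iff.1 hv δ hδ
  filter_upwards [Ioo_mem_nhdsGT hr] with ε hε x
  rw [← Real.dist_eq]
  refine dist_convolution_le hδ.le (support_moll_subset hε.1) (moll_nonneg hε.1)
    (integral_moll hε.1) hv.continuous.aestronglyMeasurable fun y hy => ?_
  exact (h (lt_trans (Metric.mem_ball.1 hy) hε.2)).le

lemma eLpNorm_two_le_of_bound {D : 𝔼 → ℝ} {K : Set 𝔼} (hK : MeasurableSet K) {c : ℝ}
    (hb : ∀ x, |D x| ≤ c) (h0 : ∀ x ∉ K, D x = 0) :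
    eLpNorm D 2 volume ≤ volume K ^ (2⁻¹ : ℝ) * ENNReal.ofReal c := by
  have h1 : K.indicator D = D := by
    ext x
    by_cases hx : x ∈ K
    · simp [hx]
    · simp [hx, h0 x hx]
  rw [← h1, eLpNorm_indicator_eq_eLpNorm_restrict hK]
  have := eLpNorm_le_of_ae_bound (p := 2) (μ := volume.restrict K) (f := D) (C := c)
    (.of_forall hb)
  simpa using this

/-- Uniform convergence becomes `L²` convergence because all the functions eventually live on one
set of finite volume. -/
lemma tendsto_eLpNorm_two_of_bound {D : ℝ → 𝔼 → ℝ} {K : Set 𝔼} (hK : IsCompact K)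
    (hb : ∀ δ > 0, ∀ᶠ ε in 𝓝[>] (0 : ℝ), ∀ x, |D ε x| ≤ δ)
    (h0 : ∀ᶠ ε in 𝓝[>] (0 : ℝ), ∀ x ∉ K, D ε x = 0) :
    Tendsto (fun ε => eLpNorm (D ε) 2 volume) (𝓝[>] 0) (𝓝 0) := by
  rw [ENNReal.tendsto_nhds_zero]
  intro η hη
  have hKfin : volume K ^ (2⁻¹ : ℝ) ≠ ⊤ :=
    ENNReal.rpow_ne_top_of_nonneg (by norm_num) hK.measure_lt_top.ne
  have ht : Tendsto (fun c : ℝ => volume K ^ (2⁻¹ : ℝ) * ENNReal.ofReal c) (𝓝[>] 0) (𝓝 0) := by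
    have h1 : Tendsto (fun c : ℝ => ENNReal.ofReal c) (𝓝[>] 0) (𝓝 0) := by
      have := (ENNReal.continuous_ofReal.tendsto 0).mono_left (nhdsWithin_le_nhds (s := Ioi 0))
      simpa using this
    simpa using ENNReal.Tendsto.const_mul h1 (Or.inr hKfin)
  obtain ⟨c, hc, hc0⟩ := ((ENNReal.tendsto_nhds_zero.1 ht η hη).and self_mem_nhdsWithin).exists
  filter_upwards [hb c hc0, h0] with ε h1 h2
  exact (eLpNorm_two_le_of_bound hK.measurableSet h1 h2).trans hc

/-- Mollification is a contraction of `L²`. -/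
lemma eLpNorm_mollify_le {ε : ℝ} (hε : 0 < ε) {f : 𝔼 → ℝ} (hf : AEStronglyMeasurable f volume) :
    eLpNorm (mollify ε f) 2 volume ≤ eLpNorm f 2 volume := by
  -- Tonelli below needs `(x, t) ↦ f (x - t)` to be jointly measurable, so `f` is replaced by a
  -- strongly measurable representative.
  wlog hfm : StronglyMeasurable f generalizing f
  · have h1 : mollify ε f = mollify ε (hf.mk f) := by
      ext x
      rw [mollify_apply, mollify_apply]
      exact integral_congr_ae (hf.ae_eq_mk.mono fun y hy => by simp only [hy])
    rw [h1, eLpNorm_congr_ae hf.ae_eq_mk]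
    exact this hf.stronglyMeasurable_mk.aestronglyMeasurable hf.stronglyMeasurable_mk
  have hm : Measurable (moll ε : 𝔼 → ℝ) := (contDiff_moll ε (k := 0)).continuous.measurable
  -- Mollification is an average of translates over a probability measure. Comparing `L¹` and `L²`
  -- norms on that space bounds its square by the average of squares; Tonelli and translation
  -- invariance finish.
  set ν : Measure 𝔼 := volume.withDensity fun t => ENNReal.ofReal (moll ε t) with hν
  have hprob : IsProbabilityMeasure ν := ⟨by
    rw [hν, withDensity_apply _ MeasurableSet.univ, Measure.restrict_univ,
      ← ofReal_integral_eq_lintegral_ofReal (integrable_moll hε) (.of_forall (moll_nonneg hε)),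
      integral_moll hε, ENNReal.ofReal_one]⟩
  have h1 : ∀ x, mollify ε f x = ∫ t, f (x - t) ∂ν := by
    intro x
    rw [mollify_apply', hν, integral_withDensity_eq_integral_toReal_smul
      hm.ennreal_ofReal (.of_forall fun _ => ENNReal.ofReal_lt_top)]
    simp [ENNReal.toReal_ofReal (moll_nonneg hε _)]
  have h2 : ∀ x, ‖mollify ε f x‖ₑ ^ (2 : ℝ) ≤ ∫⁻ t, ‖f (x - t)‖ₑ ^ (2 : ℝ) ∂ν := by
    intro x
    have hfx : AEStronglyMeasurable (fun t => f (x - t)) ν :=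
      (hfm.comp_measurable (measurable_const.sub measurable_id)).aestronglyMeasurable
    have h3 : ‖mollify ε f x‖ₑ ≤ eLpNorm (fun t => f (x - t)) 1 ν := by
      rw [h1, eLpNorm_one_eq_lintegral_enorm]
      exact enorm_integral_le_lintegral_enorm _
    have h4 := h3.trans (eLpNorm_le_eLpNorm_of_exponent_le (q := 2) (by norm_num) hfx)
    rw [eLpNorm_eq_lintegral_rpow_enorm_toReal (by norm_num) (by norm_num)] at h4
    have h5 := ENNReal.rpow_le_rpow h4 (by norm_num : (0 : ℝ) ≤ 2)
    rw [← ENNReal.rpow_mul] at h5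
    simpa using h5
  rw [eLpNorm_eq_lintegral_rpow_enorm_toReal (by norm_num) (by norm_num),
    eLpNorm_eq_lintegral_rpow_enorm_toReal (by norm_num) (by norm_num)]
  refine ENNReal.rpow_le_rpow ?_ (by norm_num)
  simp only [ENNReal.toReal_ofNat]
  calc ∫⁻ x, ‖mollify ε f x‖ₑ ^ (2 : ℝ) ≤ ∫⁻ x, ∫⁻ t, ‖f (x - t)‖ₑ ^ (2 : ℝ) ∂ν := by
        exact lintegral_mono h2
    _ = ∫⁻ t, (∫⁻ x, ‖f (x - t)‖ₑ ^ (2 : ℝ)) ∂ν := by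
        refine lintegral_lintegral_swap (Measurable.aemeasurable ?_)
        exact ((hfm.measurable.comp measurable_sub).enorm.pow_const _)
    _ = ∫⁻ t, (∫⁻ x, ‖f x‖ₑ ^ (2 : ℝ)) ∂ν := by
        refine lintegral_congr fun t => ?_
        exact lintegral_sub_right_eq_self (μ := (volume : Measure 𝔼))
          (fun x => ‖f x‖ₑ ^ (2 : ℝ)) t
    _ = _ := by simp

lemma mollify_sub {ε : ℝ} (hε : 0 < ε) {f g : 𝔼 → ℝ} (hf : LocallyIntegrable f)
    (hg : LocallyIntegrable g) : mollify ε (f - g) = mollify ε f - mollify ε g := by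
  have hc := (contDiff_moll (n := n) ε (k := 0)).continuous
  ext x
  rw [Pi.sub_apply, mollify_apply, mollify_apply, mollify_apply, ← integral_sub]
  · simp [mul_sub]
  · exact ((hasCompactSupport_moll hε).convolutionExists_left (ContinuousLinearMap.lsmul ℝ ℝ)
      hc hf x).integrable_swap
  · exact ((hasCompactSupport_moll hε).convolutionExists_left (ContinuousLinearMap.lsmul ℝ ℝ)
      hc hg x).integrable_swap

lemma tendsto_mollify_of_continuous {g : 𝔼 → ℝ} (hg : Continuous g) (hgc : HasCompactSupport g) :
    Tendsto (fun ε => eLpNorm (mollify ε g - g) 2 volume) (𝓝[>] 0) (𝓝 0) := by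
  refine tendsto_eLpNorm_two_of_bound (hgc.isCompact.cthickening (r := 1))
    (fun δ hδ => eventually_mollify_sub_le (hgc.uniformContinuous_of_continuous hg) hδ) ?_
  filter_upwards [Ioo_mem_nhdsGT one_pos] with ε hε x hx
  have h1 : x ∉ Metric.cthickening ε (tsupport g) := fun h =>
    hx (Metric.cthickening_mono hε.2.le _ h)
  have h2 : x ∉ tsupport g := fun h => h1 (Metric.self_subset_cthickening _ h)
  simp [mollify_eq_zero hε.1 h1, image_eq_zero_of_notMem_tsupport h2]

/-- Density argument: `f` is replaced by a continuous compactly supported `g`, and the contraction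
property controls the mollification of `f - g` uniformly in `ε`. -/
lemma tendsto_mollify {f : 𝔼 → ℝ} (hf : MemLp f 2 volume) :
    Tendsto (fun ε => eLpNorm (mollify ε f - f) 2 volume) (𝓝[>] 0) (𝓝 0) := by
  rw [ENNReal.tendsto_nhds_zero]
  intro η hη
  have hη3 : η / 3 ≠ 0 := by simpa using hη.ne'
  obtain ⟨g, hgc, hfg, hg, hgL⟩ := hf.exists_hasCompactSupport_eLpNorm_sub_le (by norm_num) hη3
  filter_upwards [self_mem_nhdsWithin, ENNReal.tendsto_nhds_zero.1
    (tendsto_mollify_of_continuous hg hgc) _ (pos_iff_ne_zero.2 hη3)] with ε hε hε2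
  have hfl : LocallyIntegrable f := hf.locallyIntegrable (by norm_num)
  have hgl : LocallyIntegrable g := hg.locallyIntegrable
  have e1 : mollify ε f - f = mollify ε (f - g) + ((mollify ε g - g) + (g - f)) := by
    rw [mollify_sub hε hfl hgl]; abel
  have m1 : AEStronglyMeasurable (mollify ε (f - g)) volume :=
    (contDiff_mollify hε (hfl.sub hgl) (k := 0)).continuous.aestronglyMeasurable
  have m2 : AEStronglyMeasurable (mollify ε g - g) volume :=
    ((contDiff_mollify hε hgl (k := 0)).continuous.sub hg).aestronglyMeasurable
  have m3 : AEStronglyMeasurable (g - f) volume := hgL.1.sub hf.1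
  rw [e1]
  refine (eLpNorm_add_le m1 (m2.add m3) (by norm_num)).trans ?_
  refine (add_le_add ((eLpNorm_mollify_le hε (hf.1.sub hgL.1)).trans hfg)
    ((eLpNorm_add_le m2 m3 (by norm_num)).trans (add_le_add hε2 ((eLpNorm_sub_comm _ _ _ _).trans_le
      hfg)))).trans ?_
  rw [← add_assoc, ENNReal.add_thirds]

end Mollify

/-! ### Friedrichs' commutator lemma. -/

section Friedrichs

variable {n : ℕ}

local notation "𝔼" => EuclideanSpace ℝ (Fin n)

lemma contDiff_moll_sub (ε : ℝ) (x : 𝔼) {k : ℕ∞} : ContDiff ℝ k fun y : 𝔼 => moll ε (x - y) :=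
  (contDiff_moll ε).comp (contDiff_const.sub contDiff_id)

lemma hasCompactSupport_moll_sub {ε : ℝ} (hε : 0 < ε) (x : 𝔼) :
    HasCompactSupport fun y : 𝔼 => moll ε (x - y) :=
  (hasCompactSupport_moll hε).comp_homeomorph (Homeomorph.subLeft x)

lemma fderiv_moll_sub (ε : ℝ) (x y v : 𝔼) :
    fderiv ℝ (fun y : 𝔼 => moll ε (x - y)) y v = - fderiv ℝ (moll ε) (x - y) v := by
  have h1 : HasFDerivAt (fun y : 𝔼 => x - y) (-ContinuousLinearMap.id ℝ 𝔼) y :=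
    (hasFDerivAt_id y).const_sub x
  have h2 := (((contDiff_moll ε (k := 1)).differentiable one_ne_zero (x - y)).hasFDerivAt.comp y
    h1).fderiv
  have h3 : moll ε ∘ (fun y => x - y) = fun y : 𝔼 => moll ε (x - y) := rfl
  rw [h3] at h2
  rw [h2]; simp

lemma exists_flatDiv_bound {b : 𝔼 → 𝔼} (hb : ContDiff ℝ 1 b) (hc : HasCompactSupport b) :
    ∃ C, 0 ≤ C ∧ (∀ x y, ‖b x - b y‖ ≤ C * ‖x - y‖) ∧ ∀ y, |flatDiv b y| ≤ C := by
  obtain ⟨C1, h1⟩ := ContDiff.lipschitzWith_of_hasCompactSupport hc hb one_ne_zero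
  obtain ⟨C2, h2⟩ := (continuous_flatDiv hb).bounded_above_of_compact_support
    (hasCompactSupport_flatDiv hc)
  refine ⟨max C1 C2, le_max_of_le_left C1.2, fun x y => ?_, fun y => (h2 y).trans (le_max_right _ _)⟩
  refine (h1.norm_sub_le x y).trans ?_
  gcongr
  exact le_max_left _ _

/-- **Friedrichs' commutator estimate**: the kernel of the commutator of `b · ∇` with mollification
is of size `ε⁻ⁿ` and is supported at distance `ε` from the diagonal. -/
lemma exists_commutator_bound {b : 𝔼 → 𝔼} (hb : ContDiff ℝ 1 b) (hc : HasCompactSupport b) :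
    ∃ C, 0 ≤ C ∧ ∀ ε > 0, ∀ x y,
      |flatDiv (fun y => moll ε (x - y) • (b y - b x)) y| ≤ C * (ε⁻¹) ^ n ∧
      (ε < ‖x - y‖ → flatDiv (fun y => moll ε (x - y) • (b y - b x)) y = 0) := by
  obtain ⟨C1, hC1, h1⟩ := exists_moll_bound n
  obtain ⟨C2, hC2, h2, h3⟩ := exists_flatDiv_bound hb hc
  refine ⟨C1 * C2 + C1 * C2, by positivity, fun ε hε x y => ?_⟩
  -- The product rule separates a term with the derivative of the mollifier, which meets the
  -- increment `b y - b x`, from a term with the bounded divergence of `b`; the constant `b x`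
  -- contributes no divergence.
  have key : flatDiv (fun y => moll ε (x - y) • (b y - b x)) y =
      - fderiv ℝ (moll ε) (x - y) (b y - b x) + moll ε (x - y) * flatDiv b y := by
    have hd : DifferentiableAt ℝ (fun y => b y - b x) y :=
      (hb.differentiable one_ne_zero y).sub_const _
    rw [flatDiv_smul ((contDiff_moll_sub ε x (k := 1)).differentiable one_ne_zero y) hd,
      fderiv_moll_sub]
    congr 2
    have := flatDiv_add (hb.differentiable one_ne_zero y) (differentiableAt_const (-b x))
    simpa [sub_eq_add_neg, flatDiv_const] using this
  have hzero : ε < ‖x - y‖ → flatDiv (fun y => moll ε (x - y) • (b y - b x)) y = 0 := by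
    intro h
    rw [key]
    have h4 : x - y ∉ tsupport (moll ε : 𝔼 → ℝ) := fun h5 => by
      have := tsupport_moll_subset hε h5
      rw [mem_closedBall_zero_iff] at this
      linarith
    have h5 : fderiv ℝ (moll ε : 𝔼 → ℝ) (x - y) = 0 := by
      by_contra h6
      exact h4 (support_fderiv_subset ℝ h6)
    rw [h5, image_eq_zero_of_notMem_tsupport h4]
    simp
  refine ⟨?_, hzero⟩
  by_cases hxy : ε < ‖x - y‖
  · rw [hzero hxy, abs_zero]; positivity
  · rw [key]
    have hb1 : |fderiv ℝ (moll ε) (x - y) (b y - b x)| ≤ C1 * C2 * ε⁻¹ ^ n := by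
      refine ((fderiv ℝ (moll ε) (x - y)).le_opNorm _).trans ?_
      -- Within distance `ε` of the diagonal the increment is at most `C2 * ε`, which cancels the
      -- extra `ε⁻¹` of the gradient.
      calc _ ≤ (C1 * (ε⁻¹ ^ n * ε⁻¹)) * (C2 * ε) := by
            gcongr
            · exact (h1 ε hε _).2
            · refine (h2 y x).trans ?_
              gcongr
              rw [norm_sub_rev]
              exact not_lt.1 hxy
        _ = _ := by field_simp
    have hb2 : |moll ε (x - y) * flatDiv b y| ≤ C1 * C2 * ε⁻¹ ^ n := by
      rw [abs_mul]
      calc _ ≤ (C1 * ε⁻¹ ^ n) * C2 := by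
            gcongr
            · exact (h1 ε hε _).1
            · exact h3 y
        _ = _ := by ring
    calc _ ≤ |-(fderiv ℝ (moll ε) (x - y) (b y - b x))| + |moll ε (x - y) * flatDiv b y| :=
          abs_add_le _ _
      _ ≤ _ := by rw [abs_neg]; linarith

/-- The commutator of `b · ∇` with mollification, applied to `v`; `h` is the weak derivative. -/
lemma commutator_eq {b : 𝔼 → 𝔼} (hb : ContDiff ℝ ∞ b) {v h : 𝔼 → ℝ} (hv : Continuous v)
    (hweak : ∀ ψ : 𝔼 → ℝ, ContDiff ℝ ∞ ψ → HasCompactSupport ψ →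
      ∫ y, v y * flatDiv (fun y => ψ y • b y) y = - ∫ y, h y * ψ y) {ε : ℝ} (hε : 0 < ε) (x : 𝔼) :
    fderiv ℝ (mollify ε v) x (b x) - mollify ε h x =
      ∫ y, (v y - v x) * flatDiv (fun y => moll ε (x - y) • (b y - b x)) y := by
  have hb1 : ContDiff ℝ 1 b := hb.of_le (by exact_mod_cast le_top)
  have hs := hasCompactSupport_moll_sub hε x
  have hF : ContDiff ℝ 1 fun y => moll ε (x - y) • (b y - b x) :=
    (contDiff_moll_sub ε x (k := 1)).smul (hb1.sub contDiff_const)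
  have hFc : HasCompactSupport fun y => moll ε (x - y) • (b y - b x) :=
    hasCompactSupport_smul _ hs
  have hG : ContDiff ℝ 1 fun y => moll ε (x - y) • b y :=
    (contDiff_moll_sub ε x (k := 1)).smul hb1
  have hGc : HasCompactSupport fun y => moll ε (x - y) • b y := hasCompactSupport_smul _ hs
  -- The weak equation is applied to the test function `y ↦ moll ε (x - y)`.
  have e1 : mollify ε h x = - ∫ y, v y * flatDiv (fun y => moll ε (x - y) • b y) y := by
    rw [hweak _ (contDiff_moll_sub ε x) hs, neg_neg, mollify_apply]
    exact integral_congr_ae (.of_forall fun y => mul_comm _ _)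
  have e2 : ∀ y, flatDiv (fun y => moll ε (x - y) • (b y - b x)) y =
      flatDiv (fun y => moll ε (x - y) • b y) y + fderiv ℝ (moll ε) (x - y) (b x) := by
    intro y
    have hm := (contDiff_moll_sub ε x (k := 1)).differentiable one_ne_zero y
    have h1 : (fun y => moll ε (x - y) • (b y - b x)) =
        fun y => moll ε (x - y) • b y + moll ε (x - y) • (-b x) := by
      ext1 z; rw [← smul_add, sub_eq_add_neg (b z)]
    rw [h1, flatDiv_add (F := fun y => moll ε (x - y) • b y)
      (G := fun y => moll ε (x - y) • -b x) (hm.smul (hb1.differentiable one_ne_zero y))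
      (hm.smul_const _),
      flatDiv_smul hm (differentiableAt_const (-b x)), fderiv_moll_sub, flatDiv_const]
    simp
  have i1 : Integrable fun y => v y * flatDiv (fun y => moll ε (x - y) • b y) y :=
    (hv.mul (continuous_flatDiv hG)).integrable_of_hasCompactSupport
      (hasCompactSupport_flatDiv hGc).mul_left
  have i3 : Integrable fun y => v y * flatDiv (fun y => moll ε (x - y) • (b y - b x)) y :=
    (hv.mul (continuous_flatDiv hF)).integrable_of_hasCompactSupport
      (hasCompactSupport_flatDiv hFc).mul_left
  have i4 : Integrable fun y => v x * flatDiv (fun y => moll ε (x - y) • (b y - b x)) y :=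
    (continuous_const.mul (continuous_flatDiv hF)).integrable_of_hasCompactSupport
      (hasCompactSupport_flatDiv hFc).mul_left
  have i2 : Integrable fun y => fderiv ℝ (moll ε) (x - y) (b x) * v y := by
    have : (fun y => fderiv ℝ (moll ε) (x - y) (b x) * v y) = fun y =>
        v y * flatDiv (fun y => moll ε (x - y) • (b y - b x)) y -
        v y * flatDiv (fun y => moll ε (x - y) • b y) y := by
      ext1 y; rw [e2]; ring
    rw [this]
    exact i3.sub i1
  -- Subtracting `v x` is free, since the kernel is the divergence of a compactly supported field
  -- and integrates to zero. It is what lets the continuity of `v` make the commutator small.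
  simp_rw [sub_mul]
  rw [integral_sub i3 i4, integral_const_mul, integral_flatDiv_eq_zero hF hFc, mul_zero, sub_zero,
    fderiv_mollify hε hv.locallyIntegrable, e1, sub_neg_eq_add, ← integral_add i2 i1]
  refine integral_congr_ae (.of_forall fun y => ?_)
  simp only [e2]
  ring

/-- Balances the size `ε⁻ⁿ` of the commutator kernel against the volume of the ball on which it
lives. -/
lemma exists_volume_closedBall_mul_le (n : ℕ) : ∃ C, 0 ≤ C ∧
    ∀ ε > 0, ∀ x : EuclideanSpace ℝ (Fin n),
    volume.real (Metric.closedBall x ε) * (ε⁻¹) ^ n ≤ C := by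
  refine ⟨volume.real (Metric.closedBall (0 : EuclideanSpace ℝ (Fin n)) 1), measureReal_nonneg,
    fun ε hε x => ?_⟩
  have h1 := Measure.addHaar_closedBall' (volume : Measure (EuclideanSpace ℝ (Fin n))) x hε.le
  rw [measureReal_def, h1, ENNReal.toReal_mul, finrank_euclideanSpace_fin,
    ENNReal.toReal_ofReal (by positivity), measureReal_def, mul_right_comm, ← mul_pow,
    mul_inv_cancel₀ hε.ne', one_pow, one_mul]

/-- **Friedrichs' lemma** for continuous functions of compact support. -/
theorem tendsto_fderiv_mollify {b : 𝔼 → 𝔼} (hb : ContDiff ℝ ∞ b) (hbc : HasCompactSupport b)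
    {v h : 𝔼 → ℝ} (hv : Continuous v) (hvc : HasCompactSupport v) (hh : MemLp h 2 volume)
    (hweak : ∀ ψ : 𝔼 → ℝ, ContDiff ℝ ∞ ψ → HasCompactSupport ψ →
      ∫ y, v y * flatDiv (fun y => ψ y • b y) y = - ∫ y, h y * ψ y) :
    Tendsto (fun ε => eLpNorm (fun x => fderiv ℝ (mollify ε v) x (b x) - h x) 2 volume)
      (𝓝[>] 0) (𝓝 0) := by
  have hb1 : ContDiff ℝ 1 b := hb.of_le (by exact_mod_cast le_top)
  obtain ⟨C, hC, hk⟩ := exists_commutator_bound hb1 hbc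
  obtain ⟨V, hV, hvol⟩ := exists_volume_closedBall_mul_le n
  -- `D ε` is the commutator itself. The other part of the error, `mollify ε h - h`, tends to zero
  -- for every `h` in `L²`.
  set D : ℝ → 𝔼 → ℝ := fun ε x => fderiv ℝ (mollify ε v) x (b x) - mollify ε h x with hD
  have hvu := hvc.uniformContinuous_of_continuous hv
  have hDlim : Tendsto (fun ε => eLpNorm (D ε) 2 volume) (𝓝[>] 0) (𝓝 0) := by
    refine tendsto_eLpNorm_two_of_bound (hvc.isCompact.cthickening (r := 1)) ?_ ?_
    · intro δ hδ
      -- `C * V` bounds the integral of the kernel in `y`, so this oscillation of `v` makes the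
      -- commutator at most `δ`; the `+ 1` avoids division by zero.
      obtain ⟨r, hr, hvr⟩ := Metric.uniformContinuous_iff.1 hvu (δ / (C * V + 1)) (by positivity)
      filter_upwards [Ioo_mem_nhdsGT hr] with ε hε x
      simp only [hD]
      rw [commutator_eq hb hv hweak hε.1]
      have hsub : ∀ y ∉ Metric.closedBall x ε,
          (v y - v x) * flatDiv (fun y => moll ε (x - y) • (b y - b x)) y = 0 := by
        intro y hy
        rw [Metric.mem_closedBall, not_le, dist_comm, dist_eq_norm] at hy
        rw [(hk ε hε.1 x y).2 hy, mul_zero]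
      rw [← setIntegral_eq_integral_of_forall_compl_eq_zero hsub]
      have := norm_setIntegral_le_of_norm_le_const (μ := volume)
        (f := fun y => (v y - v x) * flatDiv (fun y => moll ε (x - y) • (b y - b x)) y)
        (C := δ / (C * V + 1) * (C * ε⁻¹ ^ n)) (isCompact_closedBall x ε).measure_lt_top
        (fun y hy => by
          rw [norm_mul]
          gcongr
          · have := hvr ((Metric.mem_closedBall.1 hy).trans_lt hε.2)
            rw [Real.dist_eq] at this
            exact this.le
          · exact (hk ε hε.1 x y).1)
      refine this.trans ?_
      have h5 := hvol ε hε.1 x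
      calc δ / (C * V + 1) * (C * ε⁻¹ ^ n) * volume.real (Metric.closedBall x ε)
          = δ / (C * V + 1) * C * (volume.real (Metric.closedBall x ε) * ε⁻¹ ^ n) := by ring
        _ ≤ δ / (C * V + 1) * C * V := by gcongr
        _ = δ * (C * V / (C * V + 1)) := by ring
        _ ≤ δ * 1 := by
            gcongr
            rw [div_le_one (by positivity)]
            linarith
        _ = δ := mul_one δ
    · filter_upwards [Ioo_mem_nhdsGT one_pos] with ε hε x hx
      simp only [hD]
      rw [commutator_eq hb hv hweak hε.1]
      refine integral_eq_zero_of_ae (.of_forall fun y => ?_)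
      by_cases hxy : ε < ‖x - y‖
      · simp [(hk ε hε.1 x y).2 hxy]
      · have h1 : y ∉ tsupport v := fun hy => hx (Metric.cthickening_mono hε.2.le _
          (Metric.mem_cthickening_of_dist_le x y ε _ hy (by rw [dist_eq_norm]; exact not_lt.1 hxy)))
        have h2 : x ∉ tsupport v := fun h => hx (Metric.self_subset_cthickening _ h)
        simp [image_eq_zero_of_notMem_tsupport h1, image_eq_zero_of_notMem_tsupport h2]
  have hhl : LocallyIntegrable h := hh.locallyIntegrable (by norm_num)
  have hsum := hDlim.add (tendsto_mollify hh)
  rw [add_zero] at hsum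
  refine tendsto_of_tendsto_of_tendsto_of_le_of_le' tendsto_const_nhds hsum
    (.of_forall fun _ => zero_le) ?_
  filter_upwards [self_mem_nhdsWithin] with ε hε
  have e1 : (fun x => fderiv ℝ (mollify ε v) x (b x) - h x) = D ε + (mollify ε h - h) := by
    ext x; simp [hD]
  have m1 : AEStronglyMeasurable (mollify ε h) volume :=
    (contDiff_mollify hε hhl (k := 0)).continuous.aestronglyMeasurable
  have m2 : AEStronglyMeasurable (D ε) volume :=
    ((((contDiff_mollify hε hv.locallyIntegrable (k := 1)).continuous_fderiv one_ne_zero).clm_apply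
      hb.continuous).sub (contDiff_mollify hε hhl (k := 0)).continuous).aestronglyMeasurable
  rw [e1]
  exact eLpNorm_add_le m2 (m1.sub hh.1) (by norm_num)

end Friedrichs

/-! ### Distributional invariance along vector fields, and brackets. -/

section WeakInvariance

variable {n : ℕ}

local notation "𝔼" => EuclideanSpace ℝ (Fin n)

lemma integrable_mul_of_locallyIntegrableOn {W : Set 𝔼} {u φ : 𝔼 → ℝ}
    (hu : LocallyIntegrableOn u W) (hφ : Continuous φ) (hc : HasCompactSupport φ)
    (hs : tsupport φ ⊆ W) : Integrable fun y => u y * φ y := by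
  have h1 : IntegrableOn u (tsupport φ) := hu.integrableOn_compact_subset hs hc
  have h2 : IntegrableOn (fun y => u y * φ y) (tsupport φ) :=
    h1.mul_continuousOn hφ.continuousOn hc
  refine (integrableOn_iff_integrable_of_support_subset ?_).1 h2
  intro y hy
  by_contra h
  exact hy (by simp [image_eq_zero_of_notMem_tsupport h])

/-- `b · ∇u = 0` on `W` in the sense of distributions. -/
def WeaklyInvariant (W : Set 𝔼) (u : 𝔼 → ℝ) (b : 𝔼 → 𝔼) : Prop :=
  ∀ ψ : 𝔼 → ℝ, ContDiff ℝ ∞ ψ → HasCompactSupport ψ → tsupport ψ ⊆ W →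
    ∫ y, u y * flatDiv (fun y => ψ y • b y) y = 0

lemma tsupport_smul_subset {G : Type*} [NormedAddCommGroup G] [NormedSpace ℝ G] {W : Set 𝔼}
    {ψ : 𝔼 → ℝ} (F : 𝔼 → G) (hs : tsupport ψ ⊆ W) : tsupport (fun y => ψ y • F y) ⊆ W :=
  (closure_mono (Function.support_smul_subset_left ψ F)).trans hs

lemma tsupport_flatDiv_subset {F : 𝔼 → 𝔼} : tsupport (flatDiv F) ⊆ tsupport F :=
  closure_minimal (fun _ hy => by_contra fun h' => hy (flatDiv_eq_zero_of_notMem_tsupport h'))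
    (isClosed_tsupport F)

lemma ofNat_le_infty (k : ℕ) [k.AtLeastTwo] : (OfNat.ofNat k : WithTop ℕ∞) ≤ ∞ :=
  (WithTop.coe_le_coe.2 le_top : ((OfNat.ofNat k : ℕ∞) : WithTop ℕ∞) ≤ ((⊤ : ℕ∞) : WithTop ℕ∞))

lemma one_le_infty : (1 : WithTop ℕ∞) ≤ ∞ := by exact_mod_cast le_top

section

variable {W : Set (EuclideanSpace ℝ (Fin n))} {u : EuclideanSpace ℝ (Fin n) → ℝ}
  {b c : EuclideanSpace ℝ (Fin n) → EuclideanSpace ℝ (Fin n)}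

lemma contDiff_flatDiv_smul (hW : IsOpen W) (hb : ContDiffOn ℝ ∞ b W) {ψ : 𝔼 → ℝ}
    (hψ : ContDiff ℝ ∞ ψ) (hs : tsupport ψ ⊆ W) :
    ContDiff ℝ ∞ (flatDiv fun y => ψ y • b y) :=
  contDiffOn_univ.1 (contDiffOn_flatDiv isOpen_univ
    (contDiff_smul_of_tsupport_subset (k := ⊤) hW hψ hs hb).contDiffOn)

lemma integrable_mul_flatDiv (hW : IsOpen W) (hu : LocallyIntegrableOn u W)
    (hb : ContDiffOn ℝ ∞ b W) {ψ : 𝔼 → ℝ} (hψ : ContDiff ℝ ∞ ψ) (hc : HasCompactSupport ψ)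
    (hs : tsupport ψ ⊆ W) : Integrable fun y => u y * flatDiv (fun y => ψ y • b y) y :=
  integrable_mul_of_locallyIntegrableOn hu (contDiff_flatDiv_smul hW hb hψ hs).continuous
    (hasCompactSupport_flatDiv (hasCompactSupport_smul b hc))
    (tsupport_flatDiv_subset.trans (tsupport_smul_subset b hs))

lemma WeaklyInvariant.add (hW : IsOpen W) (hu : LocallyIntegrableOn u W)
    (hb : ContDiffOn ℝ ∞ b W) (hc : ContDiffOn ℝ ∞ c W) (h1 : WeaklyInvariant W u b)
    (h2 : WeaklyInvariant W u c) : WeaklyInvariant W u fun y => b y + c y := by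
  intro ψ hψ hψc hs
  have e : ∀ y, flatDiv (fun y => ψ y • (b y + c y)) y =
      flatDiv (fun y => ψ y • b y) y + flatDiv (fun y => ψ y • c y) y := by
    intro y
    rw [← flatDiv_add]
    · congr 1; ext1 z; rw [smul_add]
    · exact (contDiff_smul_of_tsupport_subset (k := ⊤) hW hψ hs hb).differentiable (by simp) y
    · exact (contDiff_smul_of_tsupport_subset (k := ⊤) hW hψ hs hc).differentiable (by simp) y
  simp_rw [e, mul_add]
  rw [integral_add (integrable_mul_flatDiv hW hu hb hψ hψc hs)
    (integrable_mul_flatDiv hW hu hc hψ hψc hs), h1 ψ hψ hψc hs, h2 ψ hψ hψc hs, add_zero]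

/-- The coefficient is absorbed into the test function. -/
lemma WeaklyInvariant.smul (hW : IsOpen W) {a : 𝔼 → ℝ} (ha : ContDiffOn ℝ ∞ a W)
    (h : WeaklyInvariant W u b) : WeaklyInvariant W u fun y => a y • b y := by
  intro ψ hψ hψc hs
  have := h (fun y => ψ y • a y) (contDiff_smul_of_tsupport_subset (k := ⊤) hW hψ hs ha)
    (hasCompactSupport_smul a hψc) (tsupport_smul_subset a hs)
  simpa [mul_smul] using this

lemma WeaklyInvariant.congr (h : WeaklyInvariant W u b) (hbc : EqOn b c W) :
    WeaklyInvariant W u c := by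
  intro ψ hψ hψc hs
  rw [← h ψ hψ hψc hs]
  have : (fun y => ψ y • c y) = fun y => ψ y • b y := by
    ext1 y
    by_cases hy : y ∈ tsupport ψ
    · rw [hbc (hs hy)]
    · simp [image_eq_zero_of_notMem_tsupport hy]
  rw [this]

lemma WeaklyInvariant.mono (h : WeaklyInvariant W u b) {W' : Set 𝔼} (hW : W' ⊆ W) :
    WeaklyInvariant W' u b := fun ψ h1 h2 h3 => h ψ h1 h2 (h3.trans hW)

lemma WeaklyInvariant.zero : WeaklyInvariant W u fun _ => 0 := by
  intro ψ _ _ _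
  simp [flatDiv_const]

lemma WeaklyInvariant.sum (hW : IsOpen W) (hu : LocallyIntegrableOn u W) {ι : Type*}
    (s : Finset ι) {b : ι → 𝔼 → 𝔼} (hb : ∀ i ∈ s, ContDiffOn ℝ ∞ (b i) W)
    (h : ∀ i ∈ s, WeaklyInvariant W u (b i)) : WeaklyInvariant W u fun y => ∑ i ∈ s, b i y := by
  classical
  induction s using Finset.induction_on with
  | empty => simpa using WeaklyInvariant.zero
  | insert i s hi ih =>
    simp_rw [Finset.sum_insert hi]
    exact WeaklyInvariant.add hW hu (hb i (by simp))
      (ContDiffOn.sum fun j hj => hb j (by simp [hj])) (h i (by simp))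
      (ih (fun j hj => hb j (by simp [hj])) fun j hj => h j (by simp [hj]))

/-- The derivatives along `b` and `c` commute up to the derivative along the Lie bracket. -/
lemma fderiv_lieBracket (hW : IsOpen W) (hb : ContDiffOn ℝ ∞ b W) (hc : ContDiffOn ℝ ∞ c W)
    {f : 𝔼 → ℝ} (hf : ContDiff ℝ ∞ f) {y : 𝔼} (hy : y ∈ W) :
    fderiv ℝ f y (VectorField.lieBracket ℝ b c y) =
      fderiv ℝ (fun y => fderiv ℝ f y (c y)) y (b y) -
        fderiv ℝ (fun y => fderiv ℝ f y (b y)) y (c y) := by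
  have h2 : DifferentiableAt ℝ (fderiv ℝ f) y :=
    ((hf.fderiv_right (m := ∞) (by simp)).differentiable (by simp)) y
  have hbd : DifferentiableAt ℝ b y := (hb.contDiffAt (hW.mem_nhds hy)).differentiableAt (by simp)
  have hcd : DifferentiableAt ℝ c y := (hc.contDiffAt (hW.mem_nhds hy)).differentiableAt (by simp)
  have hsymm : IsSymmSndFDerivAt ℝ f y :=
    hf.contDiffAt.isSymmSndFDerivAt (by
      rw [minSmoothness_of_isRCLikeNormedField]; exact ofNat_le_infty 2)
  rw [fderiv_clm_apply h2 hcd, fderiv_clm_apply h2 hbd, VectorField.lieBracket_eq]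
  simp only [map_sub, _root_.add_apply, ContinuousLinearMap.comp_apply,
    ContinuousLinearMap.flip_apply]
  rw [hsymm.eq (b y) (c y)]
  ring

lemma contDiffOn_lieBracket (hW : IsOpen W) (hb : ContDiffOn ℝ ∞ b W)
    (hc : ContDiffOn ℝ ∞ c W) : ContDiffOn ℝ ∞ (VectorField.lieBracket ℝ b c) W := by
  rw [VectorField.lieBracket_eq]
  exact ((hc.fderiv_of_isOpen hW (by simp)).clm_apply hb).sub
    ((hb.fderiv_of_isOpen hW (by simp)).clm_apply hc)

lemma contDiffOn_fderiv_apply (hb : ContDiffOn ℝ ∞ b W) {f : 𝔼 → ℝ}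
    (hf : ContDiff ℝ ∞ f) : ContDiffOn ℝ ∞ (fun y => fderiv ℝ f y (b y)) W :=
  ((hf.fderiv_right (m := ∞) (by simp)).contDiffOn).clm_apply hb

/-- The formal adjoints `ψ ↦ div (ψ b)` commute up to the formal adjoint of the Lie bracket. -/
lemma flatDiv_lieBracket_ae (hW : IsOpen W) (hb : ContDiffOn ℝ ∞ b W) (hc : ContDiffOn ℝ ∞ c W)
    {ψ : 𝔼 → ℝ} (hψ : ContDiff ℝ ∞ ψ) (hψc : HasCompactSupport ψ) (hs : tsupport ψ ⊆ W) :
    ∀ᵐ y : 𝔼, flatDiv (fun y => flatDiv (fun y => ψ y • c y) y • b y) y -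
      flatDiv (fun y => flatDiv (fun y => ψ y • b y) y • c y) y =
      flatDiv (fun y => ψ y • VectorField.lieBracket ℝ b c y) y := by
  have smooth : ∀ {b : 𝔼 → 𝔼}, ContDiffOn ℝ ∞ b W → ContDiff ℝ ∞ (flatDiv fun y => ψ y • b y) :=
    fun hb => contDiff_flatDiv_smul hW hb hψ hs
  have cpt : ∀ (b : 𝔼 → 𝔼), HasCompactSupport (flatDiv fun y => ψ y • b y) :=
    fun b => hasCompactSupport_flatDiv (hasCompactSupport_smul b hψc)
  have sub : ∀ (b : 𝔼 → 𝔼), tsupport (flatDiv fun y => ψ y • b y) ⊆ W :=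
    fun b => tsupport_flatDiv_subset.trans (tsupport_smul_subset b hs)
  have hbc := contDiff_flatDiv_smul hW hb (smooth hc) (sub c)
  have hcb := contDiff_flatDiv_smul hW hc (smooth hb) (sub b)
  have hl := contDiffOn_lieBracket hW hb hc
  -- Second derivatives of the coefficients are never expanded. Both sides are paired with a smooth
  -- `f`, two integrations by parts move all derivatives onto `f`, and the identity becomes
  -- `fderiv_lieBracket`. Almost everywhere equality suffices, as the result is only used under an
  -- integral.
  refine ae_eq_of_integral_contDiff_smul_eq (hbc.sub hcb).continuous.locallyIntegrable
    (smooth hl).continuous.locallyIntegrable fun f hf hfc => ?_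
  have hf1 : ContDiffOn ℝ 1 f W := (hf.of_le one_le_infty).contDiffOn
  have second : ∀ {b c : 𝔼 → 𝔼}, ContDiffOn ℝ ∞ b W → ContDiffOn ℝ ∞ c W →
      ∫ y, f y * flatDiv (fun y => flatDiv (fun y => ψ y • c y) y • b y) y =
        ∫ y, fderiv ℝ (fun y => fderiv ℝ f y (b y)) y (c y) * ψ y := by
    intro b c hb hc
    rw [integral_mul_flatDiv hW hf1 (hb.of_le one_le_infty) ((smooth hc).of_le one_le_infty)
      (cpt c) (sub c), integral_mul_flatDiv hW
      ((contDiffOn_fderiv_apply hb hf).of_le one_le_infty)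
      (hc.of_le one_le_infty) (hψ.of_le one_le_infty) hψc hs, neg_neg]
  have i : ∀ {b c : 𝔼 → 𝔼}, ContDiffOn ℝ ∞ b W → ContDiffOn ℝ ∞ c W →
      Integrable fun y => fderiv ℝ (fun y => fderiv ℝ f y (b y)) y (c y) * ψ y := by
    intro b c hb hc
    have h1 : ContDiffOn ℝ ∞ (fun y => fderiv ℝ (fun y => fderiv ℝ f y (b y)) y (c y)) W :=
      ((contDiffOn_fderiv_apply hb hf).fderiv_of_isOpen hW (by simp)).clm_apply hc
    have h2 := contDiff_smul_of_tsupport_subset (k := ⊤) hW hψ hs h1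
    simp_rw [mul_comm _ (ψ _)]
    exact h2.continuous.integrable_of_hasCompactSupport (hasCompactSupport_smul _ hψc)
  simp_rw [smul_eq_mul, mul_sub]
  rw [integral_sub, second hb hc, second hc hb, integral_mul_flatDiv hW hf1
    (hl.of_le one_le_infty) (hψ.of_le one_le_infty) hψc hs, ← integral_sub (i hb hc) (i hc hb),
    ← integral_neg]
  · refine integral_congr_ae (.of_forall fun y => ?_)
    by_cases hy : y ∈ W
    · simp only [fderiv_lieBracket hW hb hc hf hy]; ring
    · have : y ∉ tsupport ψ := fun h => hy (hs h)
      simp [image_eq_zero_of_notMem_tsupport this]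
  · exact (hf.continuous.mul hbc.continuous).integrable_of_hasCompactSupport hfc.mul_right
  · exact (hf.continuous.mul hcb.continuous).integrable_of_hasCompactSupport hfc.mul_right

/-- The functions `div (ψ c)` and `div (ψ b)` are themselves admissible test functions, so both
iterated adjoints integrate to zero against `u`; their difference is the adjoint of the bracket. -/
lemma WeaklyInvariant.lieBracket (hW : IsOpen W) (hu : LocallyIntegrableOn u W)
    (hb : ContDiffOn ℝ ∞ b W) (hc : ContDiffOn ℝ ∞ c W) (h1 : WeaklyInvariant W u b)
    (h2 : WeaklyInvariant W u c) : WeaklyInvariant W u (VectorField.lieBracket ℝ b c) := by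
  intro ψ hψ hψc hs
  have sub : ∀ (b : 𝔼 → 𝔼), tsupport (flatDiv fun y => ψ y • b y) ⊆ W :=
    fun b => tsupport_flatDiv_subset.trans (tsupport_smul_subset b hs)
  have cpt : ∀ (b : 𝔼 → 𝔼), HasCompactSupport (flatDiv fun y => ψ y • b y) :=
    fun b => hasCompactSupport_flatDiv (hasCompactSupport_smul b hψc)
  have sb := contDiff_flatDiv_smul hW hb hψ hs
  have sc := contDiff_flatDiv_smul hW hc hψ hs
  have e : ∫ y, u y * flatDiv (fun y => ψ y • VectorField.lieBracket ℝ b c y) y =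
      ∫ y, (u y * flatDiv (fun y => flatDiv (fun y => ψ y • c y) y • b y) y -
      u y * flatDiv (fun y => flatDiv (fun y => ψ y • b y) y • c y) y) :=
    integral_congr_ae ((flatDiv_lieBracket_ae hW hb hc hψ hψc hs).mono fun y hy => by
      simp only [← hy, mul_sub])
  rw [e, integral_sub (integrable_mul_flatDiv hW hu hb sc (cpt c) (sub c))
    (integrable_mul_flatDiv hW hu hc sb (cpt b) (sub b)), h1 _ sc (cpt c) (sub c),
    h2 _ sb (cpt b) (sub b), sub_zero]

end

/-- A function with vanishing weak derivatives is locally constant. -/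
lemma ae_const_of_weaklyInvariant_const {W : Set 𝔼} (hW : IsOpen W) {u : 𝔼 → ℝ}
    (hu : LocallyIntegrableOn u W) (h : ∀ w : 𝔼, WeaklyInvariant W u fun _ => w) {y : 𝔼}
    (hy : y ∈ W) : ∃ r > 0, ∃ a : ℝ, ∀ᵐ x : 𝔼, x ∈ Metric.ball y r → u x = a := by
  obtain ⟨R, hR, hRW⟩ := Metric.isOpen_iff.1 hW y hy
  -- For centres in `ball y r`, kernels of radius at most `r` only see `closedBall y (2 * r) ⊆ W`,
  -- where `v = u`.
  set r := R / 3 with hr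
  have hr0 : 0 < r := by positivity
  have hsub : Metric.closedBall y (2 * r) ⊆ W :=
    (Metric.closedBall_subset_ball (by linarith)).trans hRW
  set v : 𝔼 → ℝ := (Metric.closedBall y (2 * r)).indicator u with hv
  have hvi : Integrable v := (integrable_indicator_iff Metric.isClosed_closedBall.measurableSet).2
    (hu.integrableOn_compact_subset hsub (isCompact_closedBall y _))
  -- The outer radius is exactly twice the inner one: a bounded ratio is what almost everywhere
  -- convergence of the convolutions requires.
  let φ : ℕ → ContDiffBump (0 : 𝔼) := fun k =>
    ⟨r / (k + 1) / 2, r / (k + 1), by positivity, half_lt_self (by positivity)⟩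
  have hφ : Tendsto (fun k => (φ k).rOut) atTop (𝓝 0) := by
    have := (tendsto_one_div_add_atTop_nhds_zero_nat (𝕜 := ℝ)).const_mul r
    simpa [φ, div_eq_mul_inv] using this
  have hlim := ContDiffBump.ae_convolution_tendsto_right_of_locallyIntegrable (K := 2) hφ
    (.of_forall fun k => by simp only [φ]; linarith) hvi.locallyIntegrable (μ := volume)
  have hder : ∀ k, ∀ x ∈ Metric.ball y r, fderiv ℝ (convolution ((φ k).normed volume) v
      (ContinuousLinearMap.lsmul ℝ ℝ) volume) x = 0 := by
    intro k x hx
    have hφr : (φ k).rOut ≤ r := by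
      simp only [φ]
      exact div_le_self hr0.le (by linarith [(Nat.cast_nonneg k : (0 : ℝ) ≤ k)])
    have hsm : ContDiff ℝ ∞ ((φ k).normed volume) := (φ k).contDiff_normed (n := ⊤)
    have hsm1 : ContDiff ℝ 1 ((φ k).normed volume) := hsm.of_le one_le_infty
    have hcs := (φ k).hasCompactSupport_normed (μ := volume)
    have h1 := (hcs.hasFDerivAt_convolution_left (ContinuousLinearMap.lsmul ℝ ℝ)
      hsm1 hvi.locallyIntegrable x).fderiv
    rw [h1, convolution_eq_swap]
    ext w
    rw [ContinuousLinearMap.integral_apply]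
    · set ψ : 𝔼 → ℝ := fun z => (φ k).normed volume (x - z) with hψ
      have hψs : ContDiff ℝ ∞ ψ := hsm.comp (contDiff_const.sub contDiff_id)
      have hψc : HasCompactSupport ψ := hcs.comp_homeomorph (Homeomorph.subLeft x)
      have hψt : tsupport ψ ⊆ Metric.closedBall y (2 * r) := by
        refine closure_minimal (fun z hz => ?_) Metric.isClosed_closedBall
        have h2 : x - z ∈ Function.support ((φ k).normed volume) := hz
        rw [ContDiffBump.support_normed_eq, mem_ball_zero_iff, ← dist_eq_norm] at h2
        rw [Metric.mem_closedBall]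
        have h3 := dist_triangle_left z y x
        have h4 := Metric.mem_ball.1 hx
        linarith
      -- Differentiating the kernel in direction `w` is, up to sign, taking the divergence of a test
      -- function times the constant field `w`; invariance along `w` then makes the derivative of
      -- the convolution vanish.
      have hd : ∀ z, fderiv ℝ ((φ k).normed volume) (x - z) w = - flatDiv (fun z => ψ z • w) z := by
        intro z
        rw [flatDiv_smul (hψs.differentiable (by simp) z) (differentiableAt_const _), flatDiv_const]
        have h5 : HasFDerivAt (fun z : 𝔼 => x - z) (-ContinuousLinearMap.id ℝ 𝔼) z :=
          (hasFDerivAt_id z).const_sub x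
        have h6 := ((hsm1.differentiable one_ne_zero (x - z)).hasFDerivAt.comp z h5).fderiv
        have h7 : (φ k).normed volume ∘ (fun z => x - z) = ψ := rfl
        rw [h7] at h6
        rw [h6]; simp
      have h8 := h w ψ hψs hψc (hψt.trans hsub)
      have h9 : ∀ z, ((ContinuousLinearMap.precompL 𝔼 (ContinuousLinearMap.lsmul ℝ ℝ))
          (fderiv ℝ ((φ k).normed volume) (x - z)) (v z)) w =
          - (u z * flatDiv (fun z => ψ z • w) z) := by
        intro z
        have h10 : ((ContinuousLinearMap.precompL 𝔼 (ContinuousLinearMap.lsmul ℝ ℝ))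
          (fderiv ℝ ((φ k).normed volume) (x - z)) (v z)) w =
          fderiv ℝ ((φ k).normed volume) (x - z) w * v z := rfl
        rw [h10, hd]
        by_cases hz : z ∈ Metric.closedBall y (2 * r)
        · simp [hv, hz]; ring
        · have h11 : z ∉ tsupport fun z => ψ z • w := fun h => hz
            (tsupport_smul_subset (fun _ => w) hψt h)
          simp [flatDiv_eq_zero_of_notMem_tsupport h11]
      simp_rw [h9]
      rw [integral_neg, h8]
      simp
    · exact ((hcs.fderiv ℝ).convolutionExists_left _
        (hsm1.continuous_fderiv one_ne_zero) hvi.locallyIntegrable x).integrable_swap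
  have hconst : ∀ k, ∀ x ∈ Metric.ball y r, ∀ z ∈ Metric.ball y r,
      convolution ((φ k).normed volume) v (ContinuousLinearMap.lsmul ℝ ℝ) volume x =
      convolution ((φ k).normed volume) v (ContinuousLinearMap.lsmul ℝ ℝ) volume z := by
    intro k x hx z hz
    refine Metric.isOpen_ball.is_const_of_fderiv_eq_zero (𝕜 := ℝ)
      (convex_ball y r).isPreconnected ?_ (hder k) hx hz
    exact (((φ k).hasCompactSupport_normed (μ := volume)).contDiff_convolution_left _
      ((φ k).contDiff_normed (n := 1)) hvi.locallyIntegrable).differentiable one_ne_zero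
      |>.differentiableOn
  have hpos : 0 < volume (Metric.ball y r) := Metric.measure_ball_pos _ _ hr0
  -- The ball has positive measure, so it contains a point at which the convolutions converge; by
  -- constancy in `x` they have the same limit almost everywhere in the ball.
  obtain ⟨x0, hx0, hl0⟩ := (((frequently_ae_mem_iff.2 hpos.ne').and_eventually hlim)).exists
  refine ⟨r, hr0, v x0, hlim.mono fun x hx hxb => ?_⟩
  have h12 : v x = u x := by
    rw [hv, indicator_of_mem]
    exact Metric.ball_subset_closedBall.trans (Metric.closedBall_subset_closedBall (by linarith)) hxb
  rw [← h12]
  refine tendsto_nhds_unique hx (hl0.congr fun k => ?_)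
  exact hconst k x0 hx0 x hxb

/-- If `u` is weakly invariant under fields that span at `y`, it is locally constant at `y`. -/
theorem ae_const_of_weaklyInvariant {W : Set 𝔼} (hW : IsOpen W) {u : 𝔼 → ℝ}
    (hu : LocallyIntegrableOn u W) {y : 𝔼} (hy : y ∈ W)
    (h : ∀ w : 𝔼, ∃ b : 𝔼 → 𝔼, ContDiffOn ℝ ∞ b W ∧ WeaklyInvariant W u b ∧ b y = w) :
    ∃ r > 0, ∃ a : ℝ, ∀ᵐ x : 𝔼, x ∈ Metric.ball y r → u x = a := by
  choose! B hBs hBi hB using h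
  set b : Fin n → 𝔼 → 𝔼 := fun i => B (EuclideanSpace.single i 1) with hb
  -- `L z` maps `w` to the combination of the fields `b i z` with coefficients `w i`. It is the
  -- identity at `y`, so it stays invertible nearby, and its smooth inverse writes every constant
  -- field as a smooth combination of the `b i`.
  let L : 𝔼 → 𝔼 →L[ℝ] 𝔼 := fun z =>
    ∑ i, (EuclideanSpace.proj (𝕜 := ℝ) i : 𝔼 →L[ℝ] ℝ).smulRight (b i z)
  have hLs : ContDiffOn ℝ ∞ L W := by
    refine ContDiffOn.sum fun i _ => ?_
    exact contDiffOn_const.smulRight (hBs _)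
  have hLy : L y = ContinuousLinearMap.id ℝ 𝔼 := by
    ext w j
    simp [L, hb, hB, Finset.sum_apply, Pi.single_apply]
  set I : Set (𝔼 →L[ℝ] 𝔼) := range ((↑) : (𝔼 ≃L[ℝ] 𝔼) → 𝔼 →L[ℝ] 𝔼) with hI
  set W' := W ∩ L ⁻¹' I with hW'
  have hW'o : IsOpen W' := hLs.continuousOn.isOpen_inter_preimage hW (ContinuousLinearEquiv.isOpen)
  have hyW' : y ∈ W' := ⟨hy, ContinuousLinearEquiv.refl ℝ 𝔼, by rw [hLy]; rfl⟩
  refine ae_const_of_weaklyInvariant_const hW'o (hu.mono_set inter_subset_left) (fun w => ?_) hyW'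
  have hinv : ContDiffOn ℝ ∞ (fun z => (L z).inverse w) W' := by
    intro z hz
    obtain ⟨e, he⟩ := hz.2
    have h1 : ContDiffAt ℝ ∞ L z := hLs.contDiffAt (hW.mem_nhds hz.1)
    have h2 : ContDiffAt ℝ ∞ ContinuousLinearMap.inverse (L z) := by
      rw [← he]; exact contDiffAt_map_inverse e
    exact ((h2.comp z h1).clm_apply contDiffAt_const).contDiffWithinAt
  have hsum : EqOn (fun z => ∑ i, ((L z).inverse w) i • b i z) (fun _ => w) W' := by
    intro z hz
    obtain ⟨e, he⟩ := hz.2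
    have h1 : L z ((L z).inverse w) = w := by rw [← he]; simp
    have h2 : ∀ v, L z v = ∑ i, v i • b i z := by
      intro v; simp [L]
    rw [h2] at h1
    exact h1
  have hcoef : ∀ i : Fin n, ContDiffOn ℝ ∞ (fun z => ((L z).inverse w) i) W' := fun i =>
    (EuclideanSpace.proj (𝕜 := ℝ) i).contDiff.comp_contDiffOn hinv
  refine WeaklyInvariant.congr (WeaklyInvariant.sum hW'o (hu.mono_set inter_subset_left)
    Finset.univ (fun i _ => ?_) fun i _ => ?_) hsum
  · exact (hcoef i).smul ((hBs _).mono inter_subset_left)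
  · exact ((hBi _).mono inter_subset_left).smul hW'o (hcoef i)

end WeakInvariance

/-! ### Vector fields and volume forms in charts. -/

section Charts

variable {n m : ℕ} {M : Type*} [TopologicalSpace M] [ChartedSpace (EuclideanSpace ℝ (Fin n)) M]
  [IsManifold (𝓡 n) ∞ M]

local notation "𝔼" => EuclideanSpace ℝ (Fin n)

lemma one_le_infty_isManifold : IsManifold (𝓡 n) 1 M :=
  IsManifold.of_le (n := ∞) one_le_infty

lemma isOpen_target (x : M) : IsOpen (extChartAt (𝓡 n) x).target :=
  isOpen_extChartAt_target x

lemma contMDiffAt_extChartAt_symm' (x : M) {y : 𝔼} (hy : y ∈ (extChartAt (𝓡 n) x).target) :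
    ContMDiffAt 𝓘(ℝ, 𝔼) (𝓡 n) ∞ (extChartAt (𝓡 n) x).symm y :=
  (contMDiffOn_extChartAt_symm x).contMDiffAt ((isOpen_target x).mem_nhds hy)

lemma mfderiv_symm_comp (x : M) {y : 𝔼} (hy : y ∈ (extChartAt (𝓡 n) x).target) :
    (mfderiv (𝓡 n) (𝓡 n) (extChartAt (𝓡 n) x).symm y) ∘L
      (mfderiv (𝓡 n) (𝓡 n) (extChartAt (𝓡 n) x) ((extChartAt (𝓡 n) x).symm y)) =
      ContinuousLinearMap.id ℝ _ := by
  have := one_le_infty_isManifold (n := n) (M := M)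
  have h := mfderivWithin_extChartAt_symm_comp_mfderiv_extChartAt (I := 𝓡 n) hy
  simpa using h

lemma mfderiv_comp_symm (x : M) {y : 𝔼} (hy : y ∈ (extChartAt (𝓡 n) x).target) :
    (mfderiv (𝓡 n) (𝓡 n) (extChartAt (𝓡 n) x) ((extChartAt (𝓡 n) x).symm y)) ∘L
      (mfderiv (𝓡 n) (𝓡 n) (extChartAt (𝓡 n) x).symm y) =
      ContinuousLinearMap.id ℝ _ := by
  have := one_le_infty_isManifold (n := n) (M := M)
  have h := mfderiv_extChartAt_comp_mfderivWithin_extChartAt_symm (I := 𝓡 n) hy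
  simpa using h

lemma isInvertible_mfderiv_symm (x : M) {y : 𝔼} (hy : y ∈ (extChartAt (𝓡 n) x).target) :
    (mfderiv (𝓡 n) (𝓡 n) (extChartAt (𝓡 n) x).symm y).IsInvertible :=
  ContinuousLinearMap.IsInvertible.of_inverse (mfderiv_symm_comp x hy) (mfderiv_comp_symm x hy)

/-- Pushing forward by the chart is pulling back by its inverse. This makes the general results on
pullbacks, on smoothness and on brackets, available for coordinate expressions. -/
lemma fieldCoeff_eq_mpullback (Y : (x : M) → TangentSpace (𝓡 n) x) (x : M) {y : 𝔼}
    (hy : y ∈ (extChartAt (𝓡 n) x).target) :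
    fieldCoeff Y x y = VectorField.mpullback (𝓡 n) (𝓡 n) (extChartAt (𝓡 n) x).symm Y y := by
  rw [VectorField.mpullback_apply, fieldCoeff]
  rw [ContinuousLinearMap.inverse_eq (mfderiv_symm_comp x hy) (mfderiv_comp_symm x hy)]
  rfl

/-- A section of the tangent bundle is smooth. -/
abbrev SmoothField (Y : (x : M) → TangentSpace (𝓡 n) x) : Prop :=
  ContMDiff (𝓡 n) (𝓡 n).tangent ∞ (fun x => (⟨x, Y x⟩ : TangentBundle (𝓡 n) M))

lemma contMDiffAt_mpullback {Y : (x : M) → TangentSpace (𝓡 n) x} (hY : SmoothField Y) (x : M)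
    {y : 𝔼} (hy : y ∈ (extChartAt (𝓡 n) x).target) :
    ContMDiffAt (𝓡 n) (𝓡 n).tangent ∞ (fun y => (⟨y,
      VectorField.mpullback (𝓡 n) (𝓡 n) (extChartAt (𝓡 n) x).symm Y y⟩ :
        TangentBundle (𝓡 n) 𝔼)) y :=
  ContMDiffAt.mpullback_vectorField_preimage (hY _) (contMDiffAt_extChartAt_symm' x hy)
    (isInvertible_mfderiv_symm x hy) (by simp)

lemma contDiffOn_fieldCoeff {Y : (x : M) → TangentSpace (𝓡 n) x} (hY : SmoothField Y) (x : M) :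
    ContDiffOn ℝ ∞ (fieldCoeff Y x) (extChartAt (𝓡 n) x).target := by
  intro y hy
  have h1 := contMDiffAt_vectorSpace_iff_contDiffAt.1 (contMDiffAt_mpullback hY x hy)
  refine ContDiffAt.contDiffWithinAt (h1.congr_of_eventuallyEq ?_)
  filter_upwards [(isOpen_target x).mem_nhds hy] with z hz
  exact fieldCoeff_eq_mpullback Y x hz

lemma mlieBracket_eq_lieBracket (V W : 𝔼 → 𝔼) (y : 𝔼) :
    VectorField.mlieBracket (𝓡 n) V W y = VectorField.lieBracket ℝ V W y := by
  have h1 : VectorField.mlieBracketWithin (𝓡 n) V W univ = VectorField.mlieBracket (𝓡 n) V W :=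
    VectorField.mlieBracketWithin_univ
  have h2 : VectorField.mlieBracketWithin (𝓡 n) V W univ =
    VectorField.lieBracketWithin ℝ V W univ := VectorField.mlieBracketWithin_eq_lieBracketWithin
  exact ((congrFun h1 y).symm.trans (congrFun h2 y)).trans
    (congrFun (VectorField.lieBracketWithin_univ (V := V) (W := W)) y)

lemma fieldCoeff_mlieBracket {Y Z : (x : M) → TangentSpace (𝓡 n) x} (hY : SmoothField Y)
    (hZ : SmoothField Z) (x : M) {y : 𝔼} (hy : y ∈ (extChartAt (𝓡 n) x).target) :
    fieldCoeff (VectorField.mlieBracket (𝓡 n) Y Z) x y =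
      VectorField.lieBracket ℝ (fieldCoeff Y x) (fieldCoeff Z x) y := by
  rw [fieldCoeff_eq_mpullback _ x hy]
  have := IsManifold.of_le (I := 𝓡 n) (M := M) (n := ∞) (m := minSmoothness ℝ 3) (by
    rw [minSmoothness_of_isRCLikeNormedField]; exact ofNat_le_infty 3)
  rw [VectorField.mpullback_mlieBracket (n := ∞) ((hY _).mdifferentiableAt (by simp))
    ((hZ _).mdifferentiableAt (by simp)) (contMDiffAt_extChartAt_symm' x hy) (by
    rw [minSmoothness_of_isRCLikeNormedField]; exact ofNat_le_infty 2)]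
  have hev : ∀ Y : (x : M) → TangentSpace (𝓡 n) x,
      (VectorField.mpullback (𝓡 n) (𝓡 n) (extChartAt (𝓡 n) x).symm Y : 𝔼 → 𝔼) =ᶠ[𝓝 y]
        fieldCoeff Y x := fun Y => by
    filter_upwards [(isOpen_target x).mem_nhds hy] with z hz
    exact (fieldCoeff_eq_mpullback Y x hz).symm
  exact (mlieBracket_eq_lieBracket _ _ y).trans
    (Filter.EventuallyEq.lieBracket_vectorField_eq (𝕜 := ℝ) (E := 𝔼) (hev Y) (hev Z))

lemma dirDeriv_symm (Y : (x : M) → TangentSpace (𝓡 n) x) {φ : M → ℝ} (x : M) {y : 𝔼}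
    (hy : y ∈ (extChartAt (𝓡 n) x).target)
    (hφ : MDifferentiableAt (𝓡 n) 𝓘(ℝ, ℝ) φ ((extChartAt (𝓡 n) x).symm y)) :
    dirDeriv Y φ ((extChartAt (𝓡 n) x).symm y) =
      fderiv ℝ (φ ∘ (extChartAt (𝓡 n) x).symm) y (fieldCoeff Y x y) := by
  have h1 := mfderiv_comp y hφ ((contMDiffAt_extChartAt_symm' x hy).mdifferentiableAt (by simp))
  have h2 := congrArg (fun L => L (Y ((extChartAt (𝓡 n) x).symm y))) (mfderiv_symm_comp x hy)
  have h3 : (mfderiv (𝓡 n) (𝓡 n) (extChartAt (𝓡 n) x).symm y) (fieldCoeff Y x y) =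
    Y ((extChartAt (𝓡 n) x).symm y) := h2
  have h4 : fderiv ℝ (φ ∘ (extChartAt (𝓡 n) x).symm) y (fieldCoeff Y x y) =
      (mfderiv (𝓡 n) 𝓘(ℝ, ℝ) φ ((extChartAt (𝓡 n) x).symm y))
        ((mfderiv (𝓡 n) (𝓡 n) (extChartAt (𝓡 n) x).symm y) (fieldCoeff Y x y)) := by
    rw [← mfderiv_eq_fderiv, h1]; rfl
  rw [h4]
  exact congrArg (mfderiv (𝓡 n) 𝓘(ℝ, ℝ) φ ((extChartAt (𝓡 n) x).symm y)) h3.symm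

/-- The transition map from the chart at `x` to the chart at `x'`. -/
noncomputable def transition (x x' : M) (y : 𝔼) : 𝔼 :=
  extChartAt (𝓡 n) x' ((extChartAt (𝓡 n) x).symm y)

lemma contDiffAt_transition (x x' : M) {y : 𝔼} (hy : y ∈ (extChartAt (𝓡 n) x).target)
    (hy' : (extChartAt (𝓡 n) x).symm y ∈ (extChartAt (𝓡 n) x').source) :
    ContDiffAt ℝ ∞ (transition (n := n) x x') y := by
  rw [← contMDiffAt_iff_contDiffAt]
  rw [extChartAt_source] at hy'
  exact (contMDiffAt_extChartAt' hy').comp y (contMDiffAt_extChartAt_symm' x hy)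

/-- Forms of top degree are multiples of the determinant. -/
lemma alternating_comp_eq_det (w : 𝔼 [⋀^Fin n]→ₗ[ℝ] ℝ) (D : 𝔼 →L[ℝ] 𝔼) :
    (w fun i => D (EuclideanSpace.single i 1)) =
      D.det * w fun i => EuclideanSpace.single i 1 := by
  have hb : ((EuclideanSpace.basisFun (Fin n) ℝ).toBasis : Fin n → 𝔼) =
      fun i => EuclideanSpace.single i 1 := by ext1 i; simp
  have h1 := AlternatingMap.eq_smul_basis_det (EuclideanSpace.basisFun (Fin n) ℝ).toBasis w
  have h2 : (fun i => D (EuclideanSpace.single i 1)) =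
      (D : 𝔼 →ₗ[ℝ] 𝔼) ∘ (EuclideanSpace.basisFun (Fin n) ℝ).toBasis := by
    rw [hb]; rfl
  rw [h2, h1, AlternatingMap.smul_apply, AlternatingMap.smul_apply, Module.Basis.det_comp, ← hb,
    Module.Basis.det_self]
  simp only [smul_eq_mul, mul_one, ContinuousLinearMap.det]
  ring

/-- The chain rule for the inverse charts, combined with `alternating_comp_eq_det`. This Jacobian
factor is what makes the chart measures agree on overlaps. -/
lemma formCoeff_transition (v : (x : M) → (TangentSpace (𝓡 n) x) [⋀^Fin n]→ₗ[ℝ] ℝ) (x x' : M)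
    {y : 𝔼} (hy : y ∈ (extChartAt (𝓡 n) x).target)
    (hy' : (extChartAt (𝓡 n) x).symm y ∈ (extChartAt (𝓡 n) x').source) :
    formCoeff v x y = (fderiv ℝ (transition x x') y).det * formCoeff v x' (transition x x' y) := by
  have hτ : transition x x' y ∈ (extChartAt (𝓡 n) x').target :=
    (extChartAt (𝓡 n) x').map_source hy'
  have hp : (extChartAt (𝓡 n) x').symm (transition x x' y) = (extChartAt (𝓡 n) x).symm y :=
    (extChartAt (𝓡 n) x').left_inv hy'
  have hev : (extChartAt (𝓡 n) x).symm =ᶠ[𝓝 y] (extChartAt (𝓡 n) x').symm ∘ transition x x' := by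
    have h1 : (extChartAt (𝓡 n) x).symm ⁻¹' (extChartAt (𝓡 n) x').source ∈ 𝓝 y :=
      (contMDiffAt_extChartAt_symm' x hy).continuousAt.preimage_mem_nhds
        ((isOpen_extChartAt_source x').mem_nhds hy')
    filter_upwards [h1] with z hz
    exact ((extChartAt (𝓡 n) x').left_inv hz).symm
  have hd : mfderiv (𝓡 n) (𝓡 n) (extChartAt (𝓡 n) x).symm y =
      (mfderiv (𝓡 n) (𝓡 n) (extChartAt (𝓡 n) x').symm (transition x x' y)) ∘L
        (mfderiv (𝓡 n) (𝓡 n) (transition x x') y) := by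
    rw [hev.mfderiv_eq]
    exact mfderiv_comp y ((contMDiffAt_extChartAt_symm' x' hτ).mdifferentiableAt (by simp))
      ((contDiffAt_transition x x' hy hy').contMDiffAt.mdifferentiableAt (by simp))
  rw [mfderiv_eq_fderiv] at hd
  unfold formCoeff
  rw [hd]
  have key := alternating_comp_eq_det (n := n)
    ((v ((extChartAt (𝓡 n) x').symm (transition x x' y))).compLinearMap
    (mfderiv (𝓡 n) (𝓡 n) (extChartAt (𝓡 n) x').symm (transition x x' y)).toLinearMap)
    (fderiv ℝ (transition x x') y)
  refine Eq.trans ?_ key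
  have hv : ∀ p q : M, p = q → ∀ z : Fin n → 𝔼, v p z = v q z := by
    rintro p _ rfl z; rfl
  exact hv _ _ hp.symm _

/-- A top-degree form is determined by its value on one basis, and the differential of the inverse
chart is onto, so a zero coefficient would force the form itself to vanish. -/
lemma formCoeff_ne_zero {v : (x : M) → (TangentSpace (𝓡 n) x) [⋀^Fin n]→ₗ[ℝ] ℝ}
    (hv : ∀ x, v x ≠ 0) (x : M) {y : 𝔼} (hy : y ∈ (extChartAt (𝓡 n) x).target) :
    formCoeff v x y ≠ 0 := by
  intro h
  set A := mfderiv (𝓡 n) (𝓡 n) (extChartAt (𝓡 n) x).symm y with hA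
  have hb : ((EuclideanSpace.basisFun (Fin n) ℝ).toBasis : Fin n → 𝔼) =
      fun i => EuclideanSpace.single i 1 := by ext1 i; simp
  let w : 𝔼 [⋀^Fin n]→ₗ[ℝ] ℝ :=
    (v ((extChartAt (𝓡 n) x).symm y)).compLinearMap A.toLinearMap
  have h1 := AlternatingMap.eq_smul_basis_det (EuclideanSpace.basisFun (Fin n) ℝ).toBasis w
  have h2 : w (EuclideanSpace.basisFun (Fin n) ℝ).toBasis = 0 := by
    rw [hb]; exact h
  rw [h2, zero_smul] at h1
  refine hv ((extChartAt (𝓡 n) x).symm y) (AlternatingMap.ext fun z => ?_)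
  have h3 := mfderiv_symm_comp x hy
  have h4 : w (fun i => mfderiv (𝓡 n) (𝓡 n) (extChartAt (𝓡 n) x)
      ((extChartAt (𝓡 n) x).symm y) (z i)) = 0 := by rw [h1]; rfl
  have h5 : ∀ i, A (mfderiv (𝓡 n) (𝓡 n) (extChartAt (𝓡 n) x)
      ((extChartAt (𝓡 n) x).symm y) (z i)) = z i := fun i =>
    congrArg (fun L => L (z i)) h3
  exact (congrArg (v ((extChartAt (𝓡 n) x).symm y)) (funext h5)).symm.trans h4

end Charts

/-- Inverse charts are continuous on the chart target only, so preimages are measurable only after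
intersecting with it. -/
lemma ContinuousOn.measurableSet_inter_preimage {α β : Type*} [TopologicalSpace α]
    [MeasurableSpace α] [OpensMeasurableSpace α] [TopologicalSpace β] [MeasurableSpace β]
    [BorelSpace β] {f : α → β} {s : Set α} (hf : ContinuousOn f s) (hs : MeasurableSet s)
    {t : Set β} (ht : MeasurableSet t) : MeasurableSet (s ∩ f ⁻¹' t) := by
  have h1 : Measurable (s.domRestrict f) := (continuousOn_iff_continuous_domRestrict.1 hf).measurable
  have h2 : s ∩ f ⁻¹' t = Subtype.val '' (s.domRestrict f ⁻¹' t) := by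
    ext y; simp [Set.domRestrict, and_comm]
  rw [h2]
  exact hs.subtype_image (h1 ht)

/-! ### The volume measure and its expression in charts. -/

namespace CCStructure

variable {n m : ℕ} {M : Type*} [TopologicalSpace M] [ChartedSpace (EuclideanSpace ℝ (Fin n)) M]
  [IsManifold (𝓡 n) ∞ M] (S : CCStructure n m M)

local notation "𝔼" => EuclideanSpace ℝ (Fin n)

/-- The density `|ρ|` of the volume in the chart at `x`. -/
noncomputable def dens (x : M) (y : 𝔼) : ℝ := |formCoeff S.volForm x y|

lemma dens_pos (x : M) {y : 𝔼} (hy : y ∈ (extChartAt (𝓡 n) x).target) : 0 < S.dens x y :=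
  abs_pos.2 (formCoeff_ne_zero S.volForm_ne_zero x hy)

lemma dens_nonneg (x : M) (y : 𝔼) : 0 ≤ S.dens x y := abs_nonneg _

lemma contDiffOn_dens (x : M) : ContDiffOn ℝ ∞ (S.dens x) (extChartAt (𝓡 n) x).target :=
  (S.smooth_volForm x).norm ℝ fun _ hy => formCoeff_ne_zero S.volForm_ne_zero x hy

lemma continuousOn_dens (x : M) : ContinuousOn (S.dens x) (extChartAt (𝓡 n) x).target :=
  (S.contDiffOn_dens x).continuousOn

lemma dens_transition (x x' : M) {y : 𝔼} (hy : y ∈ (extChartAt (𝓡 n) x).target)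
    (hy' : (extChartAt (𝓡 n) x).symm y ∈ (extChartAt (𝓡 n) x').source) :
    S.dens x y = |(fderiv ℝ (transition x x') y).det| * S.dens x' (transition x x' y) := by
  rw [dens, formCoeff_transition _ x x' hy hy', abs_mul, dens]

variable [MeasurableSpace M] [BorelSpace M]

lemma aemeasurable_symm (x : M) :
    AEMeasurable (extChartAt (𝓡 n) x).symm
      ((volume : Measure 𝔼).restrict (extChartAt (𝓡 n) x).target) :=
  (continuousOn_extChartAt_symm x).aemeasurable (isOpen_target x).measurableSet

lemma aemeasurable_symm' (x : M) : AEMeasurable (extChartAt (𝓡 n) x).symm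
    (((volume : Measure 𝔼).restrict (extChartAt (𝓡 n) x).target).withDensity
      fun y => ENNReal.ofReal (S.dens x y)) :=
  (aemeasurable_symm x).mono_ac (withDensity_absolutelyContinuous _ _)

lemma aemeasurable_dens (x : M) : AEMeasurable (fun y => ENNReal.ofReal (S.dens x y))
    ((volume : Measure 𝔼).restrict (extChartAt (𝓡 n) x).target) :=
  ((S.continuousOn_dens x).aemeasurable (isOpen_target x).measurableSet).ennreal_ofReal

lemma chartMeasure_apply (x : M) {A : Set M} (hA : MeasurableSet A) :
    S.chartMeasure x A = ∫⁻ y in (extChartAt (𝓡 n) x).target ∩ (extChartAt (𝓡 n) x).symm ⁻¹' A,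
      ENNReal.ofReal (S.dens x y) := by
  have h : S.chartMeasure x = Measure.map (extChartAt (𝓡 n) x).symm
    (((volume : Measure 𝔼).restrict (extChartAt (𝓡 n) x).target).withDensity
      fun y => ENNReal.ofReal (S.dens x y)) := rfl
  rw [h, Measure.map_apply_of_aemeasurable (S.aemeasurable_symm' x) hA, withDensity_apply',
    Measure.restrict_restrict' (isOpen_target x).measurableSet, inter_comm]

/-- Change of variables along the transition map, whose Jacobian is exactly the ratio of the two
densities. -/
lemma chartMeasure_eq_of_subset (x x' : M) {A : Set M} (hA : MeasurableSet A)
    (h : A ⊆ (extChartAt (𝓡 n) x).source) (h' : A ⊆ (extChartAt (𝓡 n) x').source) :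
    S.chartMeasure x A = S.chartMeasure x' A := by
  rw [S.chartMeasure_apply x hA, S.chartMeasure_apply x' hA]
  set B := (extChartAt (𝓡 n) x).target ∩ (extChartAt (𝓡 n) x).symm ⁻¹' A with hB
  have hBm : MeasurableSet B := ContinuousOn.measurableSet_inter_preimage
    (continuousOn_extChartAt_symm x) (isOpen_target x).measurableSet hA
  have himg : transition x x' '' B =
      (extChartAt (𝓡 n) x').target ∩ (extChartAt (𝓡 n) x').symm ⁻¹' A := by
    ext z
    constructor
    · rintro ⟨y, hy, rfl⟩
      refine ⟨(extChartAt (𝓡 n) x').map_source (h' hy.2), ?_⟩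
      rw [mem_preimage, transition, (extChartAt (𝓡 n) x').left_inv (h' hy.2)]
      exact hy.2
    · rintro ⟨hz, hzA⟩
      refine ⟨extChartAt (𝓡 n) x ((extChartAt (𝓡 n) x').symm z),
        ⟨(extChartAt (𝓡 n) x).map_source (h hzA), ?_⟩, ?_⟩
      · rw [mem_preimage, (extChartAt (𝓡 n) x).left_inv (h hzA)]; exact hzA
      · rw [transition, (extChartAt (𝓡 n) x).left_inv (h hzA), (extChartAt (𝓡 n) x').right_inv hz]
  have hinj : InjOn (transition x x') B := by
    intro y hy z hz hyz
    have h1 := (extChartAt (𝓡 n) x').injOn (h' hy.2) (h' hz.2) hyz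
    exact (extChartAt (𝓡 n) x).symm.injOn hy.1 hz.1 h1
  rw [← himg, lintegral_image_eq_lintegral_abs_det_fderiv_mul volume hBm
    (fun y hy => ((contDiffAt_transition x x' hy.1 (h' hy.2)).differentiableAt
      (by simp)).hasFDerivAt.hasFDerivWithinAt) hinj]
  refine setLIntegral_congr_fun hBm fun y hy => ?_
  rw [S.dens_transition x x' hy.1 (h' hy.2), ENNReal.ofReal_mul (abs_nonneg _)]

lemma chartMeasure_compl_source (x : M) : S.chartMeasure x (extChartAt (𝓡 n) x).sourceᶜ = 0 := by
  rw [S.chartMeasure_apply x (isOpen_extChartAt_source x).measurableSet.compl]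
  have : (extChartAt (𝓡 n) x).target ∩ (extChartAt (𝓡 n) x).symm ⁻¹'
      (extChartAt (𝓡 n) x).sourceᶜ = ∅ := by
    ext y
    simp only [mem_inter_iff, mem_preimage, mem_compl_iff, mem_empty_iff_false, iff_false, not_and,
      not_not]
    exact fun hy => (extChartAt (𝓡 n) x).map_target hy
  rw [this, Measure.restrict_empty, lintegral_zero_measure]

/-- Evaluates the supremum that defines `vol`: a single chart already attains it on subsets of its
domain. -/
lemma vol_apply_of_subset (x : M) {A : Set M} (hA : MeasurableSet A)
    (h : A ⊆ (extChartAt (𝓡 n) x).source) : S.vol A = S.chartMeasure x A := by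
  refine le_antisymm ?_ (Measure.le_iff.1 (le_iSup S.chartMeasure x) A hA)
  set s := (extChartAt (𝓡 n) x).source with hs
  have hsm : MeasurableSet s := (isOpen_extChartAt_source x).measurableSet
  -- An upper bound for all chart measures that agrees with the one at `x` inside its domain and is
  -- infinite on every non-empty measurable set outside.
  let ν : Measure M := S.chartMeasure x + ((⊤ : ENNReal) • Measure.count).restrict sᶜ
  have hle : S.vol ≤ ν := by
    refine iSup_le fun x' => Measure.le_iff.2 fun B hB => ?_
    have h0 : ν B = S.chartMeasure x B + ⊤ * Measure.count (B ∩ sᶜ) := by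
      simp only [ν, Measure.add_apply, Measure.restrict_apply hB, Measure.smul_apply, smul_eq_mul]
    rw [h0]
    by_cases hne : (B ∩ sᶜ) = ∅
    · rw [hne, measure_empty, mul_zero, add_zero]
      have hBs : B ⊆ s := by
        intro p hp
        by_contra hps
        exact (hne ▸ (⟨hp, hps⟩ : p ∈ B ∩ sᶜ) : p ∈ (∅ : Set M))
      set s' := (extChartAt (𝓡 n) x').source with hs'
      have hsm' : MeasurableSet s' := (isOpen_extChartAt_source x').measurableSet
      calc S.chartMeasure x' B ≤ S.chartMeasure x' (B ∩ s') + S.chartMeasure x' (B \ s') :=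
            measure_le_inter_add_sdiff _ _ _
        _ = S.chartMeasure x' (B ∩ s') := by
            rw [measure_mono_null (s := B \ s') (fun p hp => hp.2)
              (S.chartMeasure_compl_source x'), add_zero]
        _ = S.chartMeasure x (B ∩ s') := S.chartMeasure_eq_of_subset x' x (hB.inter hsm')
            inter_subset_right (inter_subset_left.trans hBs)
        _ ≤ S.chartMeasure x B := measure_mono inter_subset_left
    · have h1 : Measure.count (B ∩ sᶜ) ≠ 0 := by
        rw [Ne, Measure.count_eq_zero_iff]; exact hne
      rw [ENNReal.top_mul h1, add_top]
      exact le_top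
  have h2 := Measure.le_iff.1 hle A hA
  have h3 : A ∩ sᶜ = ∅ := by
    ext p; simp only [mem_inter_iff, mem_compl_iff, mem_empty_iff_false, iff_false, not_and, not_not]
    exact fun hp => h hp
  have h4 : ν A = S.chartMeasure x A := by
    simp only [ν, Measure.add_apply, Measure.restrict_apply hA, h3, measure_empty, add_zero]
  rwa [h4] at h2

lemma vol_restrict_source (x : M) :
    S.vol.restrict (extChartAt (𝓡 n) x).source = S.chartMeasure x := by
  have hsm : MeasurableSet (extChartAt (𝓡 n) x).source := (isOpen_extChartAt_source x).measurableSet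
  ext A hA
  rw [Measure.restrict_apply hA, S.vol_apply_of_subset x (hA.inter hsm) inter_subset_right]
  refine le_antisymm (measure_mono inter_subset_left) ?_
  refine (measure_le_inter_add_sdiff _ _ (extChartAt (𝓡 n) x).source).trans ?_
  rw [measure_mono_null (s := A \ (extChartAt (𝓡 n) x).source) (fun p hp => hp.2)
    (S.chartMeasure_compl_source x), add_zero]

lemma chartMeasure_eq_map (x : M) : S.chartMeasure x = Measure.map (extChartAt (𝓡 n) x).symm
    (((volume : Measure 𝔼).restrict (extChartAt (𝓡 n) x).target).withDensity
      fun y => ENNReal.ofReal (S.dens x y)) := rfl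

lemma integral_vol (x : M) {f : M → ℝ} (hf : AEStronglyMeasurable f S.vol)
    (h0 : ∀ p ∉ (extChartAt (𝓡 n) x).source, f p = 0) :
    ∫ p, f p ∂S.vol = ∫ y in (extChartAt (𝓡 n) x).target,
      S.dens x y * f ((extChartAt (𝓡 n) x).symm y) := by
  have hf1 : AEStronglyMeasurable f (S.chartMeasure x) := by
    rw [← S.vol_restrict_source x]; exact hf.restrict
  rw [← setIntegral_eq_integral_of_forall_compl_eq_zero h0, S.vol_restrict_source x,
    S.chartMeasure_eq_map, integral_map (S.aemeasurable_symm' x)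
    (by rw [← S.chartMeasure_eq_map]; exact hf1),
    integral_withDensity_eq_integral_toReal_smul₀ (S.aemeasurable_dens x)
    (.of_forall fun _ => ENNReal.ofReal_lt_top)]
  simp [ENNReal.toReal_ofReal (S.dens_nonneg x _)]

/-- The density is strictly positive on the chart target, so null sets for the volume are Lebesgue
null in the chart. -/
lemma ae_symm (x : M) {P : M → Prop}
    (h : ∀ᵐ p ∂S.vol.restrict (extChartAt (𝓡 n) x).source, P p) :
    ∀ᵐ y ∂(volume : Measure 𝔼).restrict (extChartAt (𝓡 n) x).target,
      P ((extChartAt (𝓡 n) x).symm y) := by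
  rw [S.vol_restrict_source x, S.chartMeasure_eq_map] at h
  have h1 := ae_of_ae_map (S.aemeasurable_symm' x) h
  refine (withDensity_absolutelyContinuous' (S.aemeasurable_dens x) ?_).ae_le h1
  rw [ae_restrict_iff' (isOpen_target x).measurableSet]
  refine .of_forall fun y hy => ?_
  simpa using S.dens_pos x hy

instance isLocallyFiniteMeasure_vol : IsLocallyFiniteMeasure S.vol := by
  refine ⟨fun p => ?_⟩
  have hp := mem_extChartAt_target (I := 𝓡 n) p
  obtain ⟨r, hr, hrs⟩ := Metric.isOpen_iff.1 (isOpen_target p) _ hp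
  have hsub : Metric.closedBall (extChartAt (𝓡 n) p p) (r / 2) ⊆ (extChartAt (𝓡 n) p).target :=
    (Metric.closedBall_subset_ball (by linarith)).trans hrs
  set B := Metric.ball (extChartAt (𝓡 n) p p) (r / 2)
  refine ⟨(extChartAt (𝓡 n) p).source ∩ extChartAt (𝓡 n) p ⁻¹' B,
    (isOpen_extChartAt_preimage' p Metric.isOpen_ball).mem_nhds
      ⟨mem_extChartAt_source p, Metric.mem_ball_self (by linarith)⟩, ?_⟩
  rw [S.vol_apply_of_subset p (isOpen_extChartAt_preimage' p Metric.isOpen_ball).measurableSet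
    inter_subset_left, S.chartMeasure_apply p
    (isOpen_extChartAt_preimage' p Metric.isOpen_ball).measurableSet]
  have hint : IntegrableOn (S.dens p) (Metric.closedBall (extChartAt (𝓡 n) p p) (r / 2)) :=
    ((S.continuousOn_dens p).mono hsub).integrableOn_compact (isCompact_closedBall _ _)
  refine lt_of_le_of_lt (lintegral_mono_set ?_) hint.lintegral_lt_top
  intro y hy
  have := hy.2.2
  rw [mem_preimage, (extChartAt (𝓡 n) p).right_inv hy.1] at this
  exact Metric.ball_subset_closedBall this

instance isOpenPosMeasure_vol : S.vol.IsOpenPosMeasure := by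
  refine ⟨fun U hU ⟨p, hp⟩ h0 => ?_⟩
  set V := U ∩ (extChartAt (𝓡 n) p).source with hV
  have hVo : IsOpen V := hU.inter (isOpen_extChartAt_source p)
  have h1 : S.vol V = 0 := measure_mono_null inter_subset_left h0
  rw [S.vol_apply_of_subset p hVo.measurableSet inter_subset_right,
    S.chartMeasure_apply p hVo.measurableSet] at h1
  set B := (extChartAt (𝓡 n) p).target ∩ (extChartAt (𝓡 n) p).symm ⁻¹' V with hB
  have hBo : IsOpen B := (continuousOn_extChartAt_symm p).isOpen_inter_preimage (isOpen_target p) hVo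
  have hne : B.Nonempty := ⟨extChartAt (𝓡 n) p p, mem_extChartAt_target p, by
    rw [mem_preimage, (extChartAt (𝓡 n) p).left_inv (mem_extChartAt_source p)]
    exact ⟨hp, mem_extChartAt_source p⟩⟩
  have h2 : AEMeasurable (fun y => ENNReal.ofReal (S.dens p y)) (volume.restrict B) :=
    (S.aemeasurable_dens p).mono_measure (Measure.restrict_mono inter_subset_left le_rfl)
  rw [lintegral_eq_zero_iff' h2] at h1
  have h3 : volume B = 0 := by
    have h4 : ∀ᵐ y ∂volume.restrict B, False := by
      filter_upwards [h1, ae_restrict_mem hBo.measurableSet] with y hy hyB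
      simp only [Pi.zero_apply, ENNReal.ofReal_eq_zero] at hy
      exact (S.dens_pos p hyB.1).not_ge hy
    rwa [ae_iff, show {a | ¬False} = (univ : Set 𝔼) by simp, Measure.restrict_apply_univ] at h4
  exact (hBo.measure_pos volume hne).ne' h3

end CCStructure

/-! ### Transfer of functions between chart and manifold, and calculus of `dirDeriv`. -/

section Charts

variable {n m : ℕ} {M : Type*} [TopologicalSpace M] [ChartedSpace (EuclideanSpace ℝ (Fin n)) M]

local notation "𝔼" => EuclideanSpace ℝ (Fin n)

/-- The function on `M` that is `ψ` in the chart at `x` and zero off the chart domain. -/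
noncomputable def chartExtend (x : M) (ψ : 𝔼 → ℝ) : M → ℝ :=
  (extChartAt (𝓡 n) x).source.indicator fun p => ψ (extChartAt (𝓡 n) x p)

lemma chartExtend_symm (x : M) (ψ : 𝔼 → ℝ) {y : 𝔼} (hy : y ∈ (extChartAt (𝓡 n) x).target) :
    chartExtend x ψ ((extChartAt (𝓡 n) x).symm y) = ψ y := by
  rw [chartExtend, indicator_of_mem ((extChartAt (𝓡 n) x).map_target hy),
    (extChartAt (𝓡 n) x).right_inv hy]

lemma support_chartExtend_subset (x : M) {ψ : 𝔼 → ℝ} :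
    Function.support (chartExtend x ψ) ⊆ (extChartAt (𝓡 n) x).symm '' tsupport ψ := by
  intro p hp
  have hps : p ∈ (extChartAt (𝓡 n) x).source := by
    by_contra h
    exact hp (indicator_of_notMem h _)
  refine ⟨extChartAt (𝓡 n) x p, subset_tsupport _ ?_, (extChartAt (𝓡 n) x).left_inv hps⟩
  rw [Function.mem_support, chartExtend, indicator_of_mem hps] at hp
  exact hp

lemma isCompact_image_symm (x : M) {K : Set 𝔼} (hK : IsCompact K)
    (hs : K ⊆ (extChartAt (𝓡 n) x).target) : IsCompact ((extChartAt (𝓡 n) x).symm '' K) :=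
  hK.image_of_continuousOn ((continuousOn_extChartAt_symm x).mono hs)

/-- The compact image of the support is closed in a Hausdorff space. Without this the extension by
zero could fail to be smooth at the edge of the chart. -/
lemma tsupport_chartExtend_subset [T2Space M] (x : M) {ψ : 𝔼 → ℝ} (hc : HasCompactSupport ψ)
    (hs : tsupport ψ ⊆ (extChartAt (𝓡 n) x).target) :
    tsupport (chartExtend x ψ) ⊆ (extChartAt (𝓡 n) x).symm '' tsupport ψ :=
  closure_minimal (support_chartExtend_subset x) (isCompact_image_symm x hc hs).isClosed

lemma image_symm_subset_source (x : M) {K : Set 𝔼} (hs : K ⊆ (extChartAt (𝓡 n) x).target) :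
    (extChartAt (𝓡 n) x).symm '' K ⊆ (extChartAt (𝓡 n) x).source := by
  rintro _ ⟨y, hy, rfl⟩
  exact (extChartAt (𝓡 n) x).map_target (hs hy)

lemma isTestFunction_chartExtend [T2Space M] [IsManifold (𝓡 n) ∞ M] (x : M) {ψ : 𝔼 → ℝ}
    (hψ : ContDiff ℝ ∞ ψ) (hc : HasCompactSupport ψ) {U : Set M}
    (hs : tsupport ψ ⊆ (extChartAt (𝓡 n) x).target ∩ (extChartAt (𝓡 n) x).symm ⁻¹' U) :
    IsTestFunction (n := n) U (chartExtend x ψ) := by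
  have hst : tsupport ψ ⊆ (extChartAt (𝓡 n) x).target := hs.trans inter_subset_left
  have hsub := tsupport_chartExtend_subset x hc hst
  refine ⟨fun p => ?_, (isCompact_image_symm x hc hst).of_isClosed_subset (isClosed_tsupport _) hsub,
    hsub.trans ?_⟩
  · by_cases hp : p ∈ tsupport (chartExtend x ψ)
    · have hps := image_symm_subset_source x hst (hsub hp)
      have h1 : ContMDiffAt (𝓡 n) 𝓘(ℝ, ℝ) ∞ (ψ ∘ extChartAt (𝓡 n) x) p := by
        refine (hψ.contMDiff _).comp p (contMDiffAt_extChartAt' ?_)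
        rwa [extChartAt_source] at hps
      refine h1.congr_of_eventuallyEq ?_
      filter_upwards [(isOpen_extChartAt_source x).mem_nhds hps] with q hq
      rw [chartExtend, indicator_of_mem hq]; rfl
    · exact contMDiffAt_const.congr_of_eventuallyEq (notMem_tsupport_iff_eventuallyEq.1 hp)
  · rintro _ ⟨y, hy, rfl⟩
    exact (hs hy).2

/-- The function `h` in the chart at `x`, extended by zero. -/
noncomputable def chartPull (x : M) (h : M → ℝ) : 𝔼 → ℝ :=
  (extChartAt (𝓡 n) x).target.indicator (h ∘ (extChartAt (𝓡 n) x).symm)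

lemma isCompact_image_extChartAt (x : M) {K : Set M} (hK : IsCompact K)
    (hs : K ⊆ (extChartAt (𝓡 n) x).source) : IsCompact (extChartAt (𝓡 n) x '' K) :=
  hK.image_of_continuousOn ((continuousOn_extChartAt x).mono hs)

lemma image_extChartAt_subset_target (x : M) {K : Set M}
    (hs : K ⊆ (extChartAt (𝓡 n) x).source) :
    extChartAt (𝓡 n) x '' K ⊆ (extChartAt (𝓡 n) x).target := by
  rintro _ ⟨y, hy, rfl⟩
  exact (extChartAt (𝓡 n) x).map_source (hs hy)

lemma tsupport_chartPull_subset (x : M) {h : M → ℝ} (hc : HasCompactSupport h)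
    (hs : tsupport h ⊆ (extChartAt (𝓡 n) x).source) :
    tsupport (chartPull (n := n) x h) ⊆ extChartAt (𝓡 n) x '' tsupport h := by
  refine closure_minimal (fun y hy => ?_) (isCompact_image_extChartAt x hc hs).isClosed
  have hyt : y ∈ (extChartAt (𝓡 n) x).target := by
    by_contra h
    exact hy (indicator_of_notMem h _)
  refine ⟨(extChartAt (𝓡 n) x).symm y, subset_tsupport _ ?_, (extChartAt (𝓡 n) x).right_inv hyt⟩
  rw [Function.mem_support, chartPull, indicator_of_mem hyt] at hy
  exact hy

lemma hasCompactSupport_chartPull (x : M) {h : M → ℝ} (hc : HasCompactSupport h)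
    (hs : tsupport h ⊆ (extChartAt (𝓡 n) x).source) : HasCompactSupport (chartPull (n := n) x h) :=
  (isCompact_image_extChartAt x hc hs).of_isClosed_subset (isClosed_tsupport _)
    (tsupport_chartPull_subset x hc hs)

lemma chartPull_eventuallyEq (x : M) (h : M → ℝ) {y : 𝔼} (hy : y ∈ (extChartAt (𝓡 n) x).target) :
    chartPull (n := n) x h =ᶠ[𝓝 y] h ∘ (extChartAt (𝓡 n) x).symm := by
  filter_upwards [(isOpen_extChartAt_target (I := 𝓡 n) x).mem_nhds hy] with z hz
  rw [chartPull, indicator_of_mem hz]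

lemma contDiffAt_comp_symm [IsManifold (𝓡 n) ∞ M] (x : M) {h : M → ℝ} {y : 𝔼}
    (hy : y ∈ (extChartAt (𝓡 n) x).target)
    (hh : ContMDiffAt (𝓡 n) 𝓘(ℝ, ℝ) ∞ h ((extChartAt (𝓡 n) x).symm y)) :
    ContDiffAt ℝ ∞ (h ∘ (extChartAt (𝓡 n) x).symm) y := by
  rw [← contMDiffAt_iff_contDiffAt]
  exact hh.comp y (contMDiffAt_extChartAt_symm' x hy)

lemma contDiff_chartPull [IsManifold (𝓡 n) ∞ M] (x : M) {h : M → ℝ}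
    (hh : ContMDiff (𝓡 n) 𝓘(ℝ, ℝ) ∞ h) (hc : HasCompactSupport h)
    (hs : tsupport h ⊆ (extChartAt (𝓡 n) x).source) : ContDiff ℝ ∞ (chartPull (n := n) x h) := by
  rw [contDiff_iff_contDiffAt]
  intro y
  by_cases hy : y ∈ tsupport (chartPull (n := n) x h)
  · have hyt := image_extChartAt_subset_target x hs (tsupport_chartPull_subset x hc hs hy)
    exact (contDiffAt_comp_symm x hyt (hh _)).congr_of_eventuallyEq (chartPull_eventuallyEq x h hyt)
  · exact contDiffAt_const.congr_of_eventuallyEq (notMem_tsupport_iff_eventuallyEq.1 hy)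

lemma dirDeriv_congr (Y : (x : M) → TangentSpace (𝓡 n) x) {f g : M → ℝ} {p : M}
    (h : f =ᶠ[𝓝 p] g) : dirDeriv Y f p = dirDeriv Y g p := by
  rw [dirDeriv, dirDeriv, h.mfderiv_eq]
  rfl

lemma dirDeriv_const (Y : (x : M) → TangentSpace (𝓡 n) x) (c : ℝ) (p : M) :
    dirDeriv Y (fun _ => c) p = 0 := by
  rw [dirDeriv, mfderiv_const]; rfl

lemma dirDeriv_eq_zero_of_notMem_tsupport (Y : (x : M) → TangentSpace (𝓡 n) x) {f : M → ℝ} {p : M}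
    (h : p ∉ tsupport f) : dirDeriv Y f p = 0 := by
  rw [dirDeriv_congr Y (notMem_tsupport_iff_eventuallyEq.1 h)]
  exact dirDeriv_const Y 0 p

variable [IsManifold (𝓡 n) ∞ M]

lemma dirDeriv_chart (Y : (x : M) → TangentSpace (𝓡 n) x) {f : M → ℝ} (x : M) {p : M}
    (hp : p ∈ (extChartAt (𝓡 n) x).source) (hf : ContMDiffAt (𝓡 n) 𝓘(ℝ, ℝ) ∞ f p) :
    dirDeriv Y f p = fderiv ℝ (f ∘ (extChartAt (𝓡 n) x).symm) (extChartAt (𝓡 n) x p)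
      (fieldCoeff Y x (extChartAt (𝓡 n) x p)) := by
  have h1 := (extChartAt (𝓡 n) x).left_inv hp
  have h2 := dirDeriv_symm Y (φ := f) x ((extChartAt (𝓡 n) x).map_source hp)
    (by rw [h1]; exact hf.mdifferentiableAt (by simp))
  rwa [h1] at h2

lemma dirDeriv_mul (Y : (x : M) → TangentSpace (𝓡 n) x) {f g : M → ℝ} {p : M}
    (hf : ContMDiffAt (𝓡 n) 𝓘(ℝ, ℝ) ∞ f p) (hg : ContMDiffAt (𝓡 n) 𝓘(ℝ, ℝ) ∞ g p) :
    dirDeriv Y (fun p => f p * g p) p = f p * dirDeriv Y g p + g p * dirDeriv Y f p := by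
  have hp := mem_extChartAt_source (I := 𝓡 n) p
  have ht := (extChartAt (𝓡 n) p).map_source hp
  have h1 := (extChartAt (𝓡 n) p).left_inv hp
  rw [dirDeriv_chart Y p hp hf, dirDeriv_chart Y p hp hg, dirDeriv_chart Y (f := fun p => f p * g p) p hp (hf.mul hg)]
  have h2 := fderiv_mul ((contDiffAt_comp_symm p ht (by rwa [h1])).differentiableAt (by simp))
    ((contDiffAt_comp_symm p ht (by rwa [h1])).differentiableAt (by simp)) (𝕜 := ℝ)
    (c := f ∘ (extChartAt (𝓡 n) p).symm) (d := g ∘ (extChartAt (𝓡 n) p).symm)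
  have h3 : (fun p => f p * g p) ∘ (extChartAt (𝓡 n) p).symm =
    (f ∘ (extChartAt (𝓡 n) p).symm) * (g ∘ (extChartAt (𝓡 n) p).symm) := rfl
  rw [h3, h2]
  simp

lemma dirDeriv_add (Y : (x : M) → TangentSpace (𝓡 n) x) {f g : M → ℝ} {p : M}
    (hf : ContMDiffAt (𝓡 n) 𝓘(ℝ, ℝ) ∞ f p) (hg : ContMDiffAt (𝓡 n) 𝓘(ℝ, ℝ) ∞ g p) :
    dirDeriv Y (fun p => f p + g p) p = dirDeriv Y f p + dirDeriv Y g p := by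
  have hp := mem_extChartAt_source (I := 𝓡 n) p
  have ht := (extChartAt (𝓡 n) p).map_source hp
  have h1 := (extChartAt (𝓡 n) p).left_inv hp
  rw [dirDeriv_chart Y p hp hf, dirDeriv_chart Y p hp hg, dirDeriv_chart Y (f := fun p => f p + g p) p hp (hf.add hg)]
  have h2 := fderiv_add ((contDiffAt_comp_symm p ht (by rwa [h1])).differentiableAt (by simp))
    ((contDiffAt_comp_symm p ht (by rwa [h1])).differentiableAt (by simp)) (𝕜 := ℝ)
    (f := f ∘ (extChartAt (𝓡 n) p).symm) (g := g ∘ (extChartAt (𝓡 n) p).symm)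
  have h3 : (fun p => f p + g p) ∘ (extChartAt (𝓡 n) p).symm =
    (f ∘ (extChartAt (𝓡 n) p).symm) + (g ∘ (extChartAt (𝓡 n) p).symm) := rfl
  rw [h3, h2]
  simp

lemma dirDeriv_comp (Y : (x : M) → TangentSpace (𝓡 n) x) {f : M → ℝ} {F : ℝ → ℝ} {p : M}
    (hf : ContMDiffAt (𝓡 n) 𝓘(ℝ, ℝ) ∞ f p) (hF : ContDiffAt ℝ ∞ F (f p)) :
    dirDeriv Y (fun p => F (f p)) p = deriv F (f p) * dirDeriv Y f p := by
  have hp := mem_extChartAt_source (I := 𝓡 n) p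
  have ht := (extChartAt (𝓡 n) p).map_source hp
  have h1 := (extChartAt (𝓡 n) p).left_inv hp
  rw [dirDeriv_chart Y p hp hf, dirDeriv_chart Y (f := fun p => F (f p)) p hp (hF.contMDiffAt.comp p hf)]
  have hd := (contDiffAt_comp_symm p ht (h := f) (by rwa [h1])).differentiableAt
    (by simp : (∞ : WithTop ℕ∞) ≠ 0)
  have hFd : HasDerivAt F (deriv F (f p)) ((f ∘ (extChartAt (𝓡 n) p).symm)
      (extChartAt (𝓡 n) p p)) := by
    have : (f ∘ (extChartAt (𝓡 n) p).symm) (extChartAt (𝓡 n) p p) = f p := by simp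
    rw [this]
    exact (hF.differentiableAt (by simp)).hasDerivAt
  have h2 := (hFd.comp_hasFDerivAt _ hd.hasFDerivAt).fderiv
  have h3 : (fun p => F (f p)) ∘ (extChartAt (𝓡 n) p).symm =
    F ∘ (f ∘ (extChartAt (𝓡 n) p).symm) := rfl
  rw [h3, h2]
  simp

lemma continuousOn_dirDeriv {Y : (x : M) → TangentSpace (𝓡 n) x} (hY : SmoothField Y) {f : M → ℝ}
    {U : Set M} (hU : IsOpen U) (hf : ContMDiffOn (𝓡 n) 𝓘(ℝ, ℝ) ∞ f U) :
    ContinuousOn (dirDeriv Y f) U := by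
  intro p hp
  refine ContinuousAt.continuousWithinAt ?_
  have hps := mem_extChartAt_source (I := 𝓡 n) p
  have ht := (extChartAt (𝓡 n) p).map_source hps
  have h1 := (extChartAt (𝓡 n) p).left_inv hps
  have hev : dirDeriv Y f =ᶠ[𝓝 p] (fun y => fderiv ℝ (f ∘ (extChartAt (𝓡 n) p).symm) y
      (fieldCoeff Y p y)) ∘ extChartAt (𝓡 n) p := by
    filter_upwards [(isOpen_extChartAt_source p).mem_nhds hps, hU.mem_nhds hp] with q hq hqU
    exact dirDeriv_chart Y p hq (hf.contMDiffAt (hU.mem_nhds hqU))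
  refine ContinuousAt.congr ?_ hev.symm
  refine ContinuousAt.comp ?_ (continuousAt_extChartAt p)
  have h2 : ContDiffAt ℝ ∞ (f ∘ (extChartAt (𝓡 n) p).symm) (extChartAt (𝓡 n) p p) :=
    contDiffAt_comp_symm p ht (by rw [h1]; exact hf.contMDiffAt (hU.mem_nhds hp))
  exact (h2.fderiv_right (m := 0) (by simp)).continuousAt.clm_apply
    ((contDiffOn_fieldCoeff hY p).continuousOn.continuousAt ((isOpen_target p).mem_nhds ht))

end Charts

/-! ### Divergence, integration by parts and weak derivatives on the manifold. -/

namespace CCStructure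

variable {n m : ℕ} {M : Type*} [TopologicalSpace M] [ChartedSpace (EuclideanSpace ℝ (Fin n)) M]
  [IsManifold (𝓡 n) ∞ M] (S : CCStructure n m M)

local notation "𝔼" => EuclideanSpace ℝ (Fin n)

/-- The divergence of `Y` computed in the chart at `x`. -/
noncomputable def chartDiv (x : M) (Y : (x : M) → TangentSpace (𝓡 n) x) (y : 𝔼) : ℝ :=
  (S.dens x y)⁻¹ * flatDiv (fun y => S.dens x y • fieldCoeff Y x y) y

lemma contDiffOn_dens_smul {Y : (x : M) → TangentSpace (𝓡 n) x} (hY : SmoothField Y) (x : M) :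
    ContDiffOn ℝ ∞ (fun y => S.dens x y • fieldCoeff Y x y) (extChartAt (𝓡 n) x).target :=
  (S.contDiffOn_dens x).smul (contDiffOn_fieldCoeff hY x)

lemma continuousOn_chartDiv {Y : (x : M) → TangentSpace (𝓡 n) x} (hY : SmoothField Y) (x : M) :
    ContinuousOn (S.chartDiv x Y) (extChartAt (𝓡 n) x).target :=
  ((S.continuousOn_dens x).inv₀ fun _ hy => (S.dens_pos x hy).ne').mul
    (contDiffOn_flatDiv (isOpen_target x) (S.contDiffOn_dens_smul hY x)).continuousOn

lemma continuousOn_chartDiv_comp {Y : (x : M) → TangentSpace (𝓡 n) x} (hY : SmoothField Y)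
    (x : M) : ContinuousOn (fun p => S.chartDiv x Y (extChartAt (𝓡 n) x p))
      (extChartAt (𝓡 n) x).source :=
  (S.continuousOn_chartDiv hY x).comp (continuousOn_extChartAt x)
    fun _ hp => (extChartAt (𝓡 n) x).map_source hp

/-- Near the point the signed coefficient and its absolute value differ by a constant sign, which
cancels in `ρ⁻¹ div (ρ Y)`. -/
lemma divergence_eq_chartDiv_self {Y : (x : M) → TangentSpace (𝓡 n) x} (hY : SmoothField Y)
    (p : M) : S.divergence Y p = S.chartDiv p Y (extChartAt (𝓡 n) p p) := by
  have hp := mem_extChartAt_target (I := 𝓡 n) p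
  set y₀ := extChartAt (𝓡 n) p p
  set ρ := formCoeff S.volForm p
  have hρ0 : ρ y₀ ≠ 0 := formCoeff_ne_zero S.volForm_ne_zero p hp
  have hρc : ContinuousAt ρ y₀ :=
    (S.smooth_volForm p).continuousOn.continuousAt ((isOpen_target p).mem_nhds hp)
  obtain ⟨s, hs, hev⟩ : ∃ s : ℝ, s ≠ 0 ∧ S.dens p =ᶠ[𝓝 y₀] fun y => s * ρ y := by
    rcases lt_or_gt_of_ne hρ0 with h | h
    · refine ⟨-1, by norm_num, ?_⟩
      filter_upwards [hρc.eventually_lt continuousAt_const h] with y hy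
      rw [dens, abs_of_neg hy]; ring
    · refine ⟨1, by norm_num, ?_⟩
      filter_upwards [continuousAt_const.eventually_lt hρc h] with y hy
      rw [dens, abs_of_pos hy]; ring
  have h1 : DifferentiableAt ℝ (fun y => ρ y • fieldCoeff Y p y) y₀ :=
    ((((S.smooth_volForm p).smul (contDiffOn_fieldCoeff hY p)).contDiffAt
      ((isOpen_target p).mem_nhds hp)).differentiableAt (by simp))
  have h2 : flatDiv (fun y => S.dens p y • fieldCoeff Y p y) y₀ =
      s * flatDiv (fun y => ρ y • fieldCoeff Y p y) y₀ := by
    rw [flatDiv_congr (G := fun y => s • (ρ y • fieldCoeff Y p y))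
      (hev.mono fun y hy => by simp only [hy, mul_smul])]
    rw [flatDiv_smul (differentiableAt_const s) h1]
    simp
  have h3 : S.divergence Y p = (ρ y₀)⁻¹ * flatDiv (fun y => ρ y • fieldCoeff Y p y) y₀ := rfl
  rw [h3, chartDiv, h2, hev.eq_of_nhds]
  field_simp

variable [MeasurableSpace M] [BorelSpace M]

lemma integrable_of_continuousOn [T2Space M] {f : M → ℝ} {K : Set M} (hK : IsCompact K)
    (hf : ContinuousOn f K) (h0 : ∀ p ∉ K, f p = 0) : Integrable f S.vol :=
  (integrableOn_iff_integrable_of_support_subset fun p hp => by_contra fun h => hp (h0 p h)).1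
    (hf.integrableOn_compact hK)

lemma aestronglyMeasurable_of_continuousOn {f : M → ℝ} {U : Set M} (hU : IsOpen U)
    (hf : ContinuousOn f U) (h0 : ∀ p ∉ U, f p = 0) : AEStronglyMeasurable f S.vol := by
  have h1 : U.indicator f = f := by
    ext p
    by_cases hp : p ∈ U
    · simp [hp]
    · simp [hp, h0 p hp]
  rw [← h1, aestronglyMeasurable_indicator_iff hU.measurableSet]
  exact hf.aestronglyMeasurable hU.measurableSet

/-- Integration by parts in a chart. -/
lemma integral_chart_eq_zero {Y : (x : M) → TangentSpace (𝓡 n) x} (hY : SmoothField Y) (x : M)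
    {h : M → ℝ} (hh : ContMDiff (𝓡 n) 𝓘(ℝ, ℝ) ∞ h) (hc : HasCompactSupport h)
    (hs : tsupport h ⊆ (extChartAt (𝓡 n) x).source) :
    ∫ p, (dirDeriv Y h p + S.chartDiv x Y (extChartAt (𝓡 n) x p) * h p) ∂S.vol = 0 := by
  have h0 : ∀ p ∉ (extChartAt (𝓡 n) x).source,
      dirDeriv Y h p + S.chartDiv x Y (extChartAt (𝓡 n) x p) * h p = 0 := by
    intro p hp
    rw [dirDeriv_eq_zero_of_notMem_tsupport Y fun h' => hp (hs h'),
      image_eq_zero_of_notMem_tsupport fun h' => hp (hs h'), mul_zero, add_zero]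
  have hcont : ContinuousOn
      (fun p => dirDeriv Y h p + S.chartDiv x Y (extChartAt (𝓡 n) x p) * h p)
      (extChartAt (𝓡 n) x).source :=
    (continuousOn_dirDeriv hY (isOpen_extChartAt_source x) hh.contMDiffOn).add
      ((S.continuousOn_chartDiv_comp hY x).mul hh.continuous.continuousOn)
  rw [S.integral_vol x (S.aestronglyMeasurable_of_continuousOn (isOpen_extChartAt_source x) hcont h0)
    h0]
  have hψ := contDiff_chartPull x hh hc hs
  have hψt : tsupport (chartPull (n := n) x h) ⊆ (extChartAt (𝓡 n) x).target :=
    (tsupport_chartPull_subset x hc hs).trans (image_extChartAt_subset_target x hs)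
  have hF := S.contDiffOn_dens_smul hY x
  -- Multiplied by the density, the integrand is the Euclidean divergence of the field `h |ρ| Y`.
  have key : ∀ y ∈ (extChartAt (𝓡 n) x).target, S.dens x y *
      (dirDeriv Y h ((extChartAt (𝓡 n) x).symm y) +
        S.chartDiv x Y (extChartAt (𝓡 n) x ((extChartAt (𝓡 n) x).symm y)) *
          h ((extChartAt (𝓡 n) x).symm y)) =
      flatDiv (fun y => chartPull x h y • (S.dens x y • fieldCoeff Y x y)) y := by
    intro y hy
    rw [flatDiv_smul (hψ.differentiable (by simp) y)
      ((hF.contDiffAt ((isOpen_target x).mem_nhds hy)).differentiableAt (by simp)),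
      (chartPull_eventuallyEq x h hy).fderiv_eq, (chartPull_eventuallyEq x h hy).eq_of_nhds,
      dirDeriv_symm Y x hy (hh.mdifferentiableAt (by simp)), (extChartAt (𝓡 n) x).right_inv hy,
      chartDiv, map_smul, smul_eq_mul, Function.comp_apply]
    have := (S.dens_pos x hy).ne'
    field_simp
  rw [setIntegral_congr_fun (isOpen_target x).measurableSet key,
    setIntegral_eq_integral_of_forall_compl_eq_zero]
  · exact integral_flatDiv_eq_zero ((contDiff_smul_of_tsupport_subset (k := ⊤) (isOpen_target x) hψ hψt
      hF).of_le one_le_infty) (hasCompactSupport_smul _ (hasCompactSupport_chartPull x hc hs))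
  · intro y hy
    exact flatDiv_eq_zero_of_notMem_tsupport fun h' => hy (tsupport_smul_subset _ hψt h')

variable [T2Space M] [SecondCountableTopology M]

/-- Chart independence without coordinate computations. `integral_chart_eq_zero` in both charts
shows that the two divergences have the same integral against every test function in the overlap, so
they agree almost everywhere, and by continuity everywhere. -/
lemma chartDiv_eq {Y : (x : M) → TangentSpace (𝓡 n) x} (hY : SmoothField Y) (x x' : M) {p : M}
    (hp : p ∈ (extChartAt (𝓡 n) x).source) (hp' : p ∈ (extChartAt (𝓡 n) x').source) :
    S.chartDiv x Y (extChartAt (𝓡 n) x p) = S.chartDiv x' Y (extChartAt (𝓡 n) x' p) := by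
  set V := (extChartAt (𝓡 n) x).source ∩ (extChartAt (𝓡 n) x').source with hV
  have hVo : IsOpen V := (isOpen_extChartAt_source x).inter (isOpen_extChartAt_source x')
  have c1 := (S.continuousOn_chartDiv_comp hY x).mono (inter_subset_left : V ⊆ _)
  have c2 := (S.continuousOn_chartDiv_comp hY x').mono (inter_subset_right : V ⊆ _)
  have := ChartedSpace.locallyCompactSpace (EuclideanSpace ℝ (Fin n)) M
  have hae := hVo.ae_eq_zero_of_integral_contMDiff_smul_eq_zero (𝓡 n) (μ := S.vol)
    (f := fun p => S.chartDiv x Y (extChartAt (𝓡 n) x p) -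
      S.chartDiv x' Y (extChartAt (𝓡 n) x' p))
    ((c1.sub c2).locallyIntegrableOn hVo.measurableSet) (fun h hh hc hs => by
      have hint : ∀ z, tsupport h ⊆ (extChartAt (𝓡 n) z).source → Integrable (fun p =>
          dirDeriv Y h p + S.chartDiv z Y (extChartAt (𝓡 n) z p) * h p) S.vol := fun z hz => by
        refine S.integrable_of_continuousOn hc ?_ fun p hp => ?_
        · exact ((continuousOn_dirDeriv hY isOpen_univ hh.contMDiffOn).mono (subset_univ _)).add
            (((S.continuousOn_chartDiv_comp hY z).mono hz).mul hh.continuous.continuousOn)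
        · rw [dirDeriv_eq_zero_of_notMem_tsupport Y hp, image_eq_zero_of_notMem_tsupport hp,
            mul_zero, add_zero]
      have hs1 := hs.trans inter_subset_left
      have hs2 := hs.trans inter_subset_right
      have e := integral_sub (hint x hs1) (hint x' hs2)
      rw [S.integral_chart_eq_zero hY x hh hc hs1, S.integral_chart_eq_zero hY x' hh hc hs2,
        sub_zero] at e
      rw [← e]
      refine integral_congr_ae (.of_forall fun p => ?_)
      simp only [smul_eq_mul]
      ring)
  have h1 : (fun p => S.chartDiv x Y (extChartAt (𝓡 n) x p)) =ᵐ[S.vol.restrict V]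
      fun p => S.chartDiv x' Y (extChartAt (𝓡 n) x' p) := by
    rw [Filter.EventuallyEq, ae_restrict_iff' hVo.measurableSet]
    filter_upwards [hae] with q hq hqV
    exact sub_eq_zero.1 (hq hqV)
  exact Measure.eqOn_open_of_ae_eq h1 hVo c1 c2 ⟨hp, hp'⟩

/-- The definition uses a chart that changes with the point; this allows one fixed chart, as
continuity and integration require. -/
lemma divergence_eq_chartDiv {Y : (x : M) → TangentSpace (𝓡 n) x} (hY : SmoothField Y) (x : M)
    {p : M} (hp : p ∈ (extChartAt (𝓡 n) x).source) :
    S.divergence Y p = S.chartDiv x Y (extChartAt (𝓡 n) x p) := by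
  rw [S.divergence_eq_chartDiv_self hY p]
  exact S.chartDiv_eq hY p x (mem_extChartAt_source p) hp

lemma continuous_divergence {Y : (x : M) → TangentSpace (𝓡 n) x} (hY : SmoothField Y) :
    Continuous (S.divergence Y) := by
  rw [continuous_iff_continuousAt]
  intro p
  have hp := (isOpen_extChartAt_source (I := 𝓡 n) p).mem_nhds (mem_extChartAt_source p)
  refine ((S.continuousOn_chartDiv_comp hY p).continuousAt hp).congr ?_
  filter_upwards [hp] with q hq
  exact (S.divergence_eq_chartDiv hY p hq).symm

-- Local finiteness leaves finitely many members that meet the compact set; summing to one is needed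
-- there only.
omit [BorelSpace M] [MeasurableSpace M] in
lemma exists_finset_smoothPartition {K : Set M} (hK : IsCompact K) :
    ∃ (s : Finset M) (χ : M → M → ℝ), (∀ x, ContMDiff (𝓡 n) 𝓘(ℝ, ℝ) ∞ (χ x)) ∧
      (∀ x, tsupport (χ x) ⊆ (extChartAt (𝓡 n) x).source) ∧ ∀ p ∈ K, ∑ x ∈ s, χ x p = 1 := by
  have := ChartedSpace.locallyCompactSpace 𝔼 M
  obtain ⟨f, hf⟩ := SmoothPartitionOfUnity.exists_isSubordinate_chartAt_source (𝓡 n) M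
  have hfin := f.locallyFinite.finite_nonempty_inter_compact hK
  refine ⟨hfin.toFinset, fun x => f x, fun x => (f x).contMDiff, fun x => ?_, fun p hp => ?_⟩
  · rw [extChartAt_source]; exact hf x
  · rw [← f.sum_eq_one (mem_univ p), finsum_eq_sum_of_support_subset]
    intro x hx
    rw [Finite.coe_toFinset]
    exact ⟨p, hx, hp⟩

/-- The integral of a divergence of a compactly supported field vanishes. -/
lemma integral_dirDeriv_add_divergence {Y : (x : M) → TangentSpace (𝓡 n) x} (hY : SmoothField Y)
    {h : M → ℝ} (hh : ContMDiff (𝓡 n) 𝓘(ℝ, ℝ) ∞ h) (hc : HasCompactSupport h) :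
    ∫ p, (dirDeriv Y h p + S.divergence Y p * h p) ∂S.vol = 0 := by
  obtain ⟨s, χ, hχ, hχs, hsum⟩ := exists_finset_smoothPartition (n := n) hc
  have hsm : ∀ x, ContMDiff (𝓡 n) 𝓘(ℝ, ℝ) ∞ fun p => χ x p * h p := fun x => (hχ x).mul hh
  have hcs : ∀ x, HasCompactSupport fun p => χ x p * h p := fun x => hc.mul_left
  have hts : ∀ x, tsupport (fun p => χ x p * h p) ⊆ (extChartAt (𝓡 n) x).source := fun x =>
    (closure_mono (Function.support_mul_subset_left _ _)).trans (hχs x)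
  have hone : ∀ (t : Finset M) (p : M), ContMDiffAt (𝓡 n) 𝓘(ℝ, ℝ) ∞
      (fun p => ∑ x ∈ t, χ x p * h p) p ∧
      dirDeriv Y (fun p => ∑ x ∈ t, χ x p * h p) p =
        ∑ x ∈ t, dirDeriv Y (fun p => χ x p * h p) p := by
    classical
    intro t p
    induction t using Finset.induction_on with
    | empty => simpa using ⟨contMDiffAt_const, dirDeriv_const Y 0 p⟩
    | insert a t ha ih =>
      simp_rw [Finset.sum_insert ha]
      exact ⟨(hsm a p).add ih.1, by rw [dirDeriv_add Y (hsm a p) ih.1, ih.2]⟩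
  -- Off the support of `h` both sides vanish, so it does not matter that the partition sums to one
  -- only on that support.
  have heq : h = fun p => ∑ x ∈ s, χ x p * h p := by
    ext p
    by_cases hp : p ∈ tsupport h
    · rw [← Finset.sum_mul, hsum p hp, one_mul]
    · simp [image_eq_zero_of_notMem_tsupport hp]
  have hpt : ∀ p, dirDeriv Y h p + S.divergence Y p * h p =
      ∑ x ∈ s, (dirDeriv Y (fun p => χ x p * h p) p + S.divergence Y p * (χ x p * h p)) := by
    intro p
    rw [Finset.sum_add_distrib, ← (hone s p).2, ← heq, ← Finset.mul_sum, ← congrFun heq p]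
  simp_rw [hpt]
  rw [integral_finsetSum]
  · refine Finset.sum_eq_zero fun x _ => ?_
    rw [← S.integral_chart_eq_zero hY x (hsm x) (hcs x) (hts x)]
    refine integral_congr_ae (.of_forall fun p => ?_)
    by_cases hp : p ∈ tsupport fun p => χ x p * h p
    · simp only [S.divergence_eq_chartDiv hY x (hts x hp)]
    · simp only [image_eq_zero_of_notMem_tsupport (f := fun p => χ x p * h p) hp, mul_zero]
  · intro x _
    refine S.integrable_of_continuousOn (hcs x) (Continuous.continuousOn ?_) fun p hp => ?_
    · exact (continuousOn_univ.1 (continuousOn_dirDeriv hY isOpen_univ (hsm x).contMDiffOn)).add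
        ((S.continuous_divergence hY).mul (hsm x).continuous)
    · rw [dirDeriv_eq_zero_of_notMem_tsupport Y hp,
        image_eq_zero_of_notMem_tsupport (f := fun p => χ x p * h p) hp, mul_zero, add_zero]

omit [MeasurableSpace M] [BorelSpace M] [IsManifold (𝓡 n) ∞ M] [SecondCountableTopology M] [T2Space M] in
lemma contMDiff_mul_of_tsupport_subset {U : Set M} (hU : IsOpen U) {f φ : M → ℝ}
    (hf : ContMDiffOn (𝓡 n) 𝓘(ℝ, ℝ) ∞ f U) (hφ : ContMDiff (𝓡 n) 𝓘(ℝ, ℝ) ∞ φ)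
    (hs : tsupport φ ⊆ U) : ContMDiff (𝓡 n) 𝓘(ℝ, ℝ) ∞ fun p => f p * φ p := by
  intro p
  by_cases hp : p ∈ tsupport φ
  · exact (hf.contMDiffAt (hU.mem_nhds (hs hp))).mul (hφ p)
  · refine (contMDiffAt_const (c := (0 : ℝ))).congr_of_eventuallyEq ?_
    filter_upwards [notMem_tsupport_iff_eventuallyEq.1 hp] with q hq
    simp [hq]

/-- Integration by parts on an open set, for a smooth function and a test function. -/
lemma integral_mul_adj {U : Set M} (hU : IsOpen U) (i : Fin m) {f φ : M → ℝ}
    (hf : ContMDiffOn (𝓡 n) 𝓘(ℝ, ℝ) ∞ f U) (hφ : IsTestFunction (n := n) U φ) :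
    ∫ p in U, f p * S.adj i φ p ∂S.vol = ∫ p in U, dirDeriv (S.X i) f p * φ p ∂S.vol := by
  obtain ⟨hφs, hφc, hφt⟩ := hφ
  have hY := S.smooth_X i
  -- The divergence of the field `f φ Xᵢ` integrates to zero; the product rule splits it into the
  -- two sides of the claim.
  have h0 := S.integral_dirDeriv_add_divergence hY
    (contMDiff_mul_of_tsupport_subset hU hf hφs hφt) hφc.mul_left
  have hz : ∀ p ∉ tsupport φ, f p * S.adj i φ p = 0 := fun p hp => by
    rw [adj, dirDeriv_eq_zero_of_notMem_tsupport _ hp, image_eq_zero_of_notMem_tsupport hp]; simp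
  have hz' : ∀ p ∉ tsupport φ, dirDeriv (S.X i) f p * φ p = 0 := fun p hp => by
    rw [image_eq_zero_of_notMem_tsupport hp]; simp
  have hdφ : Continuous (dirDeriv (S.X i) φ) :=
    continuousOn_univ.1 (continuousOn_dirDeriv hY isOpen_univ hφs.contMDiffOn)
  have i1 : Integrable (fun p => f p * S.adj i φ p) S.vol :=
    S.integrable_of_continuousOn hφc ((hf.continuousOn.mono hφt).mul
      (hdφ.neg.sub ((S.continuous_divergence hY).mul hφs.continuous)).continuousOn) hz
  have i2 : Integrable (fun p => dirDeriv (S.X i) f p * φ p) S.vol :=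
    S.integrable_of_continuousOn hφc (((continuousOn_dirDeriv hY hU hf).mono hφt).mul
      hφs.continuous.continuousOn) hz'
  rw [setIntegral_eq_integral_of_forall_compl_eq_zero fun p hp => hz p fun h => hp (hφt h),
    setIntegral_eq_integral_of_forall_compl_eq_zero fun p hp => hz' p fun h => hp (hφt h),
    ← sub_eq_zero, ← neg_eq_zero, ← integral_sub i1 i2, ← integral_neg, ← h0]
  refine integral_congr_ae (.of_forall fun p => ?_)
  by_cases hp : p ∈ tsupport φ
  · simp only [adj, dirDeriv_mul _ (hf.contMDiffAt (hU.mem_nhds (hφt hp))) (hφs p)]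
    ring
  · have hp' : p ∉ tsupport fun p => f p * φ p := fun h =>
      hp (closure_mono (Function.support_mul_subset_right f φ) h)
    simp only [hz p hp, dirDeriv_eq_zero_of_notMem_tsupport _ hp',
      image_eq_zero_of_notMem_tsupport hp]
    simp

/-- The weak derivative in a chart. -/
lemma HasWeakDeriv.chart {U : Set M} (hU : IsOpen U) {i : Fin m} {u g : S.L2 U}
    (h : S.HasWeakDeriv U i u g) (x : M) {ψ : 𝔼 → ℝ} (hψ : ContDiff ℝ ∞ ψ)
    (hc : HasCompactSupport ψ)
    (hs : tsupport ψ ⊆ (extChartAt (𝓡 n) x).target ∩ (extChartAt (𝓡 n) x).symm ⁻¹' U) :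
    ∫ y, u ((extChartAt (𝓡 n) x).symm y) * flatDiv (fun y => ψ y • fieldCoeff (S.X i) x y) y =
      - ∫ y, g ((extChartAt (𝓡 n) x).symm y) * ψ y := by
  have hY := S.smooth_X i
  have hst : tsupport ψ ⊆ (extChartAt (𝓡 n) x).target := hs.trans inter_subset_left
  have hinv : ContDiffOn ℝ ∞ (fun y => (S.dens x y)⁻¹) (extChartAt (𝓡 n) x).target :=
    (S.contDiffOn_dens x).inv fun y hy => (S.dens_pos x hy).ne'
  -- Dividing the test function by the density turns the volume integral into a Lebesgue integral
  -- and the adjoint `adj` into a Euclidean divergence.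
  set ψ' : 𝔼 → ℝ := fun y => ψ y • (S.dens x y)⁻¹ with hψ'
  have hψs : ContDiff ℝ ∞ ψ' := contDiff_smul_of_tsupport_subset (k := ⊤) (isOpen_target x) hψ hst hinv
  have hψc : HasCompactSupport ψ' := hasCompactSupport_smul _ hc
  have hψt := tsupport_smul_subset (fun y => (S.dens x y)⁻¹) hs
  set φ := chartExtend x ψ' with hφ
  have htest : IsTestFunction (n := n) U φ := isTestFunction_chartExtend x hψs hψc hψt
  have hφsrc : tsupport φ ⊆ (extChartAt (𝓡 n) x).source :=
    (tsupport_chartExtend_subset x hψc (hψt.trans inter_subset_left)).trans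
      (image_symm_subset_source x (hψt.trans inter_subset_left))
  have hw := h φ htest
  have hadj0 : ∀ p ∉ tsupport φ, S.adj i φ p = 0 := fun p hp => by
    rw [adj, dirDeriv_eq_zero_of_notMem_tsupport _ hp, image_eq_zero_of_notMem_tsupport hp]; simp
  have hdφ : Continuous (dirDeriv (S.X i) φ) :=
    continuousOn_univ.1 (continuousOn_dirDeriv hY isOpen_univ htest.1.contMDiffOn)
  have hadjc : Continuous (S.adj i φ) :=
    hdφ.neg.sub ((S.continuous_divergence hY).mul htest.1.continuous)
  have hconv : ∀ (w : S.L2 U) (a : M → ℝ), Continuous a → (∀ p ∉ tsupport φ, a p = 0) →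
      ∫ p in U, w p * a p ∂S.vol = ∫ y in (extChartAt (𝓡 n) x).target, S.dens x y *
        (w ((extChartAt (𝓡 n) x).symm y) * a ((extChartAt (𝓡 n) x).symm y)) := by
    intro w a ha ha0
    rw [← integral_indicator hU.measurableSet, S.integral_vol x]
    · refine setIntegral_congr_fun (isOpen_target x).measurableSet fun y hy => ?_
      by_cases hyU : (extChartAt (𝓡 n) x).symm y ∈ U
      · simp only [indicator_of_mem hyU]
      · simp only [indicator_of_notMem hyU, ha0 _ fun h => hyU (htest.2.2 h), mul_zero]
    · rw [aestronglyMeasurable_indicator_iff hU.measurableSet]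
      exact (Lp.aestronglyMeasurable w).mul ha.aestronglyMeasurable
    · intro p hp
      rw [indicator_apply_eq_zero]
      intro _
      rw [ha0 p fun h => hp (hφsrc h), mul_zero]
  rw [hconv u _ hadjc hadj0, hconv g φ htest.1.continuous fun p hp =>
    image_eq_zero_of_notMem_tsupport hp] at hw
  have e1 : ∀ y ∈ (extChartAt (𝓡 n) x).target, S.dens x y *
      (u ((extChartAt (𝓡 n) x).symm y) * S.adj i φ ((extChartAt (𝓡 n) x).symm y)) =
      - (u ((extChartAt (𝓡 n) x).symm y) *
        flatDiv (fun y => ψ y • fieldCoeff (S.X i) x y) y) := by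
    intro y hy
    have hd := (S.dens_pos x hy).ne'
    have hev : φ ∘ (extChartAt (𝓡 n) x).symm =ᶠ[𝓝 y] ψ' := by
      filter_upwards [(isOpen_target x).mem_nhds hy] with z hz
      exact chartExtend_symm x ψ' hz
    have hsplit : flatDiv (fun y => ψ y • fieldCoeff (S.X i) x y) y =
        flatDiv (fun y => ψ' y • (S.dens x y • fieldCoeff (S.X i) x y)) y := by
      refine flatDiv_congr ?_
      filter_upwards [(isOpen_target x).mem_nhds hy] with z hz
      simp only [hψ', smul_smul, smul_eq_mul]
      rw [mul_assoc, inv_mul_cancel₀ (S.dens_pos x hz).ne', mul_one]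
    rw [hsplit, flatDiv_smul (hψs.differentiable (by simp) y)
      (((S.contDiffOn_dens_smul hY x).contDiffAt ((isOpen_target x).mem_nhds hy)).differentiableAt
        (by simp)), adj, dirDeriv_symm _ x hy (htest.1.mdifferentiableAt (by simp)), hev.fderiv_eq,
      S.divergence_eq_chartDiv hY x ((extChartAt (𝓡 n) x).map_target hy),
      (extChartAt (𝓡 n) x).right_inv hy, chartDiv, hφ, chartExtend_symm x ψ' hy, map_smul,
      smul_eq_mul]
    field_simp
    ring
  have e2 : ∀ y ∈ (extChartAt (𝓡 n) x).target, S.dens x y *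
      (g ((extChartAt (𝓡 n) x).symm y) * φ ((extChartAt (𝓡 n) x).symm y)) =
      g ((extChartAt (𝓡 n) x).symm y) * ψ y := by
    intro y hy
    have hd := (S.dens_pos x hy).ne'
    rw [hφ, chartExtend_symm x ψ' hy]
    simp only [hψ', smul_eq_mul]
    field_simp
  rw [setIntegral_congr_fun (isOpen_target x).measurableSet e1,
    setIntegral_congr_fun (isOpen_target x).measurableSet e2, integral_neg,
    setIntegral_eq_integral_of_forall_compl_eq_zero, setIntegral_eq_integral_of_forall_compl_eq_zero]
    at hw
  · rw [← hw, neg_neg]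
  · intro y hy
    rw [image_eq_zero_of_notMem_tsupport fun h => hy (hst h), mul_zero]
  · intro y hy
    rw [flatDiv_eq_zero_of_notMem_tsupport fun h => hy (tsupport_smul_subset _ hst h), mul_zero]

end CCStructure

/-! ### The Lie hull, and constancy of functions with zero horizontal gradient. -/

section

variable {n m : ℕ} {M : Type*} [TopologicalSpace M] [ChartedSpace (EuclideanSpace ℝ (Fin n)) M]
  [IsManifold (𝓡 n) ∞ M]

local notation "𝔼" => EuclideanSpace ℝ (Fin n)

lemma LieHull.smoothField {X : Fin m → (x : M) → TangentSpace (𝓡 n) x}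
    (hX : ∀ i, SmoothField (X i)) {Y : (x : M) → TangentSpace (𝓡 n) x} (hY : LieHull X Y) :
    SmoothField Y := by
  induction hY with
  | horizontal a ha =>
    exact ContMDiff.sum_section fun i _ => (ha i).smul_section (hX i)
  | add _ _ h1 h2 => exact h1.add_section h2
  | smul c _ h => exact (contMDiff_const (c := c)).smul_section h
  | bracket _ _ h1 h2 =>
    have i1 : IsManifold (𝓡 n) (minSmoothness ℝ 2) M := IsManifold.of_le (n := ∞) (by
      rw [minSmoothness_of_isRCLikeNormedField]; exact ofNat_le_infty 2)
    have i2 : IsManifold (𝓡 n) ((⊤ : ℕ∞) + 1) M := by simpa using ‹IsManifold (𝓡 n) ∞ M›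
    intro p
    exact ContMDiffAt.mlieBracket_vectorField (n := ⊤) (m := ⊤) (h1 p) (h2 p) (by
      rw [minSmoothness_of_isRCLikeNormedField]; simp)

lemma isOpen_target_inter_preimage (x : M) {U : Set M} (hU : IsOpen U) :
    IsOpen ((extChartAt (𝓡 n) x).target ∩ (extChartAt (𝓡 n) x).symm ⁻¹' U) :=
  (continuousOn_extChartAt_symm x).isOpen_inter_preimage (isOpen_target x) hU

end

namespace CCStructure

variable {n m : ℕ} {M : Type*} [TopologicalSpace M] [ChartedSpace (EuclideanSpace ℝ (Fin n)) M]
  [IsManifold (𝓡 n) ∞ M] (S : CCStructure n m M) [MeasurableSpace M] [BorelSpace M] [T2Space M]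
  [SecondCountableTopology M]

local notation "𝔼" => EuclideanSpace ℝ (Fin n)

/-- On compact subsets of a chart, the volume is comparable to Lebesgue measure. -/
lemma exists_vol_comparison (x : M) {K : Set 𝔼} (hK : IsCompact K)
    (hs : K ⊆ (extChartAt (𝓡 n) x).target) : ∃ C : ENNReal, C ≠ ⊤ ∧
      Measure.map (extChartAt (𝓡 n) x).symm (volume.restrict K) ≤ C • S.vol ∧
      S.vol.restrict ((extChartAt (𝓡 n) x).symm '' K) ≤
        C • Measure.map (extChartAt (𝓡 n) x).symm (volume.restrict K) := by
  have hc1 := (S.continuousOn_dens x).mono hs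
  obtain ⟨C₁, hC₁⟩ := (hK.image_of_continuousOn hc1).bddAbove
  obtain ⟨C₂, hC₂⟩ := (hK.image_of_continuousOn (hc1.inv₀ fun y hy =>
    (S.dens_pos x (hs hy)).ne')).bddAbove
  -- `C₁` bounds the density and `C₂` its inverse on `K`; the `1` makes the constant positive.
  set C := max (max C₁ C₂) 1 with hC
  have hC0 : 0 < C := lt_of_lt_of_le one_pos (le_max_right _ _)
  have b1 : ∀ y ∈ K, S.dens x y ≤ C := fun y hy =>
    (hC₁ ⟨y, hy, rfl⟩).trans ((le_max_left _ _).trans (le_max_left _ _))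
  have b2 : ∀ y ∈ K, 1 ≤ C * S.dens x y := fun y hy => by
    have h := (hC₂ ⟨y, hy, rfl⟩).trans ((le_max_right C₁ C₂).trans (le_max_left _ 1))
    have hd := S.dens_pos x (hs hy)
    calc 1 = (S.dens x y)⁻¹ * S.dens x y := (inv_mul_cancel₀ hd.ne').symm
      _ ≤ _ := mul_le_mul_of_nonneg_right h hd.le
  have hsm : AEMeasurable (extChartAt (𝓡 n) x).symm (volume.restrict K) :=
    ((continuousOn_extChartAt_symm x).mono hs).aemeasurable hK.measurableSet
  have hmeas : ∀ A : Set M, MeasurableSet A →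
      MeasurableSet (K ∩ (extChartAt (𝓡 n) x).symm ⁻¹' A) := fun A hA =>
    ContinuousOn.measurableSet_inter_preimage ((continuousOn_extChartAt_symm x).mono hs)
      hK.measurableSet hA
  have e1 : ∀ A : Set M, MeasurableSet A →
      Measure.map (extChartAt (𝓡 n) x).symm (volume.restrict K) A =
        volume (K ∩ (extChartAt (𝓡 n) x).symm ⁻¹' A) := fun A hA => by
    rw [Measure.map_apply_of_aemeasurable hsm hA, Measure.restrict_apply' hK.measurableSet,
      inter_comm]
  have hI := isCompact_image_symm x hK hs
  have e2 : ∀ A : Set M, MeasurableSet A →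
      S.vol (A ∩ (extChartAt (𝓡 n) x).symm '' K) =
        ∫⁻ y in K ∩ (extChartAt (𝓡 n) x).symm ⁻¹' A, ENNReal.ofReal (S.dens x y) := fun A hA => by
    rw [S.vol_apply_of_subset x (hA.inter hI.measurableSet)
      (inter_subset_right.trans (image_symm_subset_source x hs)),
      S.chartMeasure_apply x (hA.inter hI.measurableSet)]
    congr 2
    ext y
    constructor
    · rintro ⟨hy, hyA, z, hz, hzy⟩
      have := (extChartAt (𝓡 n) x).symm.injOn (hs hz) hy hzy
      exact ⟨this ▸ hz, hyA⟩
    · rintro ⟨hy, hyA⟩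
      exact ⟨hs hy, hyA, y, hy, rfl⟩
  refine ⟨ENNReal.ofReal C, ENNReal.ofReal_ne_top, Measure.le_iff.2 fun A hA => ?_,
    Measure.le_iff.2 fun A hA => ?_⟩
  · rw [e1 A hA, Measure.smul_apply, smul_eq_mul]
    refine le_trans ?_ (mul_le_mul_right (measure_mono (inter_subset_left : A ∩
      (extChartAt (𝓡 n) x).symm '' K ⊆ A)) _)
    rw [e2 A hA, ← lintegral_const_mul' _ _ ENNReal.ofReal_ne_top, ← setLIntegral_one]
    refine setLIntegral_mono' (hmeas A hA) fun y hy => ?_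
    rw [← ENNReal.ofReal_mul hC0.le, ← ENNReal.ofReal_one]
    exact ENNReal.ofReal_le_ofReal (b2 y hy.1)
  · rw [Measure.restrict_apply hA, e2 A hA, Measure.smul_apply, smul_eq_mul, e1 A hA,
      ← setLIntegral_const]
    exact setLIntegral_mono' (hmeas A hA) fun y hy => ENNReal.ofReal_le_ofReal (b1 y hy.1)

lemma locallyIntegrableOn_symm (x : M) {U : Set M} (hU : IsOpen U) {f : M → ℝ}
    (hf : LocallyIntegrableOn f U S.vol) :
    LocallyIntegrableOn (fun y => f ((extChartAt (𝓡 n) x).symm y))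
      ((extChartAt (𝓡 n) x).target ∩ (extChartAt (𝓡 n) x).symm ⁻¹' U) := by
  rw [locallyIntegrableOn_iff (isOpen_target_inter_preimage (n := n) x hU).isLocallyClosed]
  intro K hKs hK
  have hKt := hKs.trans inter_subset_left
  obtain ⟨C, hC, h1, -⟩ := S.exists_vol_comparison x hK hKt
  have hI := isCompact_image_symm x hK hKt
  have h2 : IntegrableOn f ((extChartAt (𝓡 n) x).symm '' K) S.vol :=
    hf.integrableOn_compact_subset (by rintro _ ⟨y, hy, rfl⟩; exact (hKs hy).2) hI
  have h3 : Integrable (((extChartAt (𝓡 n) x).symm '' K).indicator f) S.vol :=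
    (integrable_indicator_iff hI.measurableSet).2 h2
  have h4 := (h3.smul_measure hC).mono_measure h1
  have hsm : AEMeasurable (extChartAt (𝓡 n) x).symm (volume.restrict K) :=
    ((continuousOn_extChartAt_symm x).mono hKt).aemeasurable hK.measurableSet
  have h5 := h4.comp_aemeasurable hsm
  refine h5.congr ?_
  rw [Filter.EventuallyEq, ae_restrict_iff' hK.measurableSet]
  refine .of_forall fun y hy => ?_
  rw [Function.comp_apply, indicator_of_mem (mem_image_of_mem _ hy)]

lemma locallyIntegrableOn_L2 {U : Set M} (u : S.L2 U) :
    LocallyIntegrableOn u U S.vol :=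
  locallyIntegrableOn_of_locallyIntegrable_restrict
    ((Lp.memLp u).locallyIntegrable (by norm_num))

/-- Induction over the Lie hull: each constructor is matched by a closure property of
`WeaklyInvariant`, and the base case is the weak derivative read in the chart. -/
lemma weaklyInvariant_of_lieHull {U : Set M} (hU : IsOpen U) {u : S.L2 U}
    (h : ∀ i, S.HasWeakDeriv U i u 0) (x : M) {Y : (x : M) → TangentSpace (𝓡 n) x}
    (hY : LieHull S.X Y) :
    WeaklyInvariant ((extChartAt (𝓡 n) x).target ∩ (extChartAt (𝓡 n) x).symm ⁻¹' U)
      (fun y => u ((extChartAt (𝓡 n) x).symm y)) (fieldCoeff Y x) := by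
  have hW := isOpen_target_inter_preimage (n := n) x hU
  have hu := S.locallyIntegrableOn_symm x hU (S.locallyIntegrableOn_L2 u)
  have hsm : ∀ {Y : (x : M) → TangentSpace (𝓡 n) x}, SmoothField Y → ContDiffOn ℝ ∞
      (fieldCoeff Y x) ((extChartAt (𝓡 n) x).target ∩ (extChartAt (𝓡 n) x).symm ⁻¹' U) :=
    fun hY => (contDiffOn_fieldCoeff hY x).mono inter_subset_left
  induction hY with
  | horizontal a ha =>
    have hac : ∀ i, ContDiffOn ℝ ∞ (a i ∘ (extChartAt (𝓡 n) x).symm)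
        ((extChartAt (𝓡 n) x).target ∩ (extChartAt (𝓡 n) x).symm ⁻¹' U) := fun i y hy =>
      (contDiffAt_comp_symm x hy.1 (ha i _)).contDiffWithinAt
    have h0 : ∀ i, WeaklyInvariant ((extChartAt (𝓡 n) x).target ∩
        (extChartAt (𝓡 n) x).symm ⁻¹' U) (fun y => u ((extChartAt (𝓡 n) x).symm y))
        (fieldCoeff (S.X i) x) := by
      intro i ψ hψ hc hs
      rw [HasWeakDeriv.chart S hU (h i) x hψ hc hs, neg_eq_zero]
      have hz : ∀ᵐ p ∂S.vol.restrict (extChartAt (𝓡 n) x).source, p ∈ U →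
          (0 : S.L2 U) p = 0 :=
        ae_restrict_of_ae ((ae_restrict_iff' hU.measurableSet).1 (Lp.coeFn_zero ℝ 2 _))
      have hz' := (ae_restrict_iff' (isOpen_target x).measurableSet).1 (S.ae_symm x hz)
      refine integral_eq_zero_of_ae ?_
      filter_upwards [hz'] with y hy
      by_cases hyW : y ∈ (extChartAt (𝓡 n) x).target ∩ (extChartAt (𝓡 n) x).symm ⁻¹' U
      · rw [hy hyW.1 hyW.2, zero_mul]; rfl
      · rw [image_eq_zero_of_notMem_tsupport fun h => hyW (hs h), mul_zero]; rfl
    have key := WeaklyInvariant.sum hW hu Finset.univ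
      (b := fun i y => (a i ∘ (extChartAt (𝓡 n) x).symm) y • fieldCoeff (S.X i) x y)
      (fun i _ => (hac i).smul (hsm (S.smooth_X i)))
      fun i _ => (h0 i).smul hW (hac i)
    refine key.congr fun y _ => ?_
    simp only [fieldCoeff, map_sum, map_smul, Function.comp_apply]
    rfl
  | add h1 h2 i1 i2 =>
    refine (WeaklyInvariant.add hW hu (hsm (h1.smoothField S.smooth_X))
      (hsm (h2.smoothField S.smooth_X)) i1 i2).congr fun y _ => ?_
    simp only [fieldCoeff, map_add]
    rfl
  | smul c h1 i1 =>
    refine (i1.smul hW (contDiffOn_const (c := c))).congr fun y _ => ?_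
    simp only [fieldCoeff, map_smul]
    rfl
  | bracket h1 h2 i1 i2 =>
    refine (WeaklyInvariant.lieBracket hW hu (hsm (h1.smoothField S.smooth_X))
      (hsm (h2.smoothField S.smooth_X)) i1 i2).congr fun y hy => ?_
    exact (fieldCoeff_mlieBracket (h1.smoothField S.smooth_X) (h2.smoothField S.smooth_X) x
      hy.1).symm

/-- Bracket generation at the single point `p` provides fields of the hull with any prescribed
coordinate vector there, which is what `ae_const_of_weaklyInvariant` asks for. -/
lemma exists_nhds_ae_const {U : Set M} (hU : IsOpen U) {u : S.L2 U}
    (h : ∀ i, S.HasWeakDeriv U i u 0) {p : M} (hp : p ∈ U) :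
    ∃ V, IsOpen V ∧ p ∈ V ∧ ∃ a : ℝ, ∀ᵐ q ∂S.vol, q ∈ V → u q = a := by
  have hW := isOpen_target_inter_preimage (n := n) p hU
  have hy := (extChartAt (𝓡 n) p).map_source (mem_extChartAt_source (I := 𝓡 n) p)
  have hyW : extChartAt (𝓡 n) p p ∈
      (extChartAt (𝓡 n) p).target ∩ (extChartAt (𝓡 n) p).symm ⁻¹' U :=
    ⟨hy, by rw [mem_preimage, extChartAt_to_inv]; exact hp⟩
  obtain ⟨r, hr, a, ha⟩ := ae_const_of_weaklyInvariant hW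
    (S.locallyIntegrableOn_symm p hU (S.locallyIntegrableOn_L2 u)) hyW (fun w => by
      have hsurj : ∃ v : TangentSpace (𝓡 n) ((extChartAt (𝓡 n) p).symm (extChartAt (𝓡 n) p p)),
          mfderiv (𝓡 n) (𝓡 n) (extChartAt (𝓡 n) p)
            ((extChartAt (𝓡 n) p).symm (extChartAt (𝓡 n) p p)) v = w :=
        ⟨mfderiv (𝓡 n) (𝓡 n) (extChartAt (𝓡 n) p).symm (extChartAt (𝓡 n) p p) w,
          congrArg (fun L => L w) (mfderiv_comp_symm p hy)⟩
      obtain ⟨v, hv⟩ := hsurj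
      obtain ⟨Y, hY, hYv⟩ := S.bracket_generating _ v
      refine ⟨fieldCoeff Y p, (contDiffOn_fieldCoeff (hY.smoothField S.smooth_X) p).mono
        inter_subset_left, S.weaklyInvariant_of_lieHull hU h p hY, ?_⟩
      rw [fieldCoeff, hYv]
      exact hv)
  obtain ⟨R, hR, hRW⟩ := Metric.isOpen_iff.1 (isOpen_target p) _ hy
  -- The closed ball of radius `s` lies in the chart target, where the measures are comparable, and
  -- inside the ball on which the coordinate function is constant.
  set s := min (r / 2) (R / 2) with hs
  have hs0 : 0 < s := by positivity
  have hKt : Metric.closedBall (extChartAt (𝓡 n) p p) s ⊆ (extChartAt (𝓡 n) p).target :=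
    (Metric.closedBall_subset_ball (by
      have := min_le_right (r / 2) (R / 2); linarith)).trans hRW
  have hKr : Metric.closedBall (extChartAt (𝓡 n) p p) s ⊆ Metric.ball (extChartAt (𝓡 n) p p) r :=
    Metric.closedBall_subset_ball (by have := min_le_left (r / 2) (R / 2); linarith)
  have hK := isCompact_closedBall (extChartAt (𝓡 n) p p) s
  obtain ⟨C, -, -, hC⟩ := S.exists_vol_comparison p hK hKt
  have hm : MeasurableSet {q | u q = a} :=
    (Lp.stronglyMeasurable u).measurable (measurableSet_singleton a)
  have hsm : AEMeasurable (extChartAt (𝓡 n) p).symm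
      (volume.restrict (Metric.closedBall (extChartAt (𝓡 n) p p) s)) :=
    ((continuousOn_extChartAt_symm p).mono hKt).aemeasurable hK.measurableSet
  have h1 : ∀ᵐ q ∂Measure.map (extChartAt (𝓡 n) p).symm
      (volume.restrict (Metric.closedBall (extChartAt (𝓡 n) p p) s)), u q = a := by
    rw [ae_map_iff hsm hm, ae_restrict_iff' hK.measurableSet]
    filter_upwards [ha] with y hy hyK using hy (hKr hyK)
  have h2 : ∀ᵐ q ∂S.vol.restrict ((extChartAt (𝓡 n) p).symm ''
      Metric.closedBall (extChartAt (𝓡 n) p p) s), u q = a :=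
    (Measure.absolutelyContinuous_of_le_smul hC).ae_le h1
  rw [ae_restrict_iff' (isCompact_image_symm p hK hKt).measurableSet] at h2
  refine ⟨(extChartAt (𝓡 n) p).source ∩ extChartAt (𝓡 n) p ⁻¹'
    Metric.ball (extChartAt (𝓡 n) p p) s, (continuousOn_extChartAt p).isOpen_inter_preimage
      (isOpen_extChartAt_source p) Metric.isOpen_ball,
    ⟨mem_extChartAt_source p, Metric.mem_ball_self hs0⟩, a, ?_⟩
  filter_upwards [h2] with q hq hqV
  exact hq ⟨extChartAt (𝓡 n) p q, Metric.ball_subset_closedBall hqV.2,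
    (extChartAt (𝓡 n) p).left_inv hqV.1⟩

/-- A function on a connected open set whose horizontal gradient vanishes is constant. -/
theorem ae_const_of_hasWeakDeriv_zero {U : Set M} (hU : IsOpen U) (hUc : IsConnected U)
    {u : S.L2 U} (h : ∀ i, S.HasWeakDeriv U i u 0) :
    ∃ a : ℝ, u =ᵐ[S.vol.restrict U] fun _ => a := by
  -- `Q p a` says that `a` is the almost everywhere value near `p`; it is unique since non-empty
  -- open sets have positive volume.
  let Q : M → ℝ → Prop := fun p a => ∃ V, IsOpen V ∧ p ∈ V ∧ ∀ᵐ q ∂S.vol, q ∈ V → u q = a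
  have hex : ∀ p ∈ U, ∃ a, Q p a := fun p hp => by
    obtain ⟨V, hV, hpV, a, ha⟩ := S.exists_nhds_ae_const hU h hp
    exact ⟨a, V, hV, hpV, ha⟩
  have huniq : ∀ p a b, Q p a → Q p b → a = b := by
    rintro p a b ⟨V, hV, hpV, ha⟩ ⟨V', hV', hpV', hb⟩
    by_contra hab
    refine (hV.inter hV').measure_ne_zero S.vol ⟨p, hpV, hpV'⟩ ?_
    have : ∀ᵐ q ∂S.vol, q ∉ V ∩ V' := by
      filter_upwards [ha, hb] with q h1 h2 h3
      exact hab ((h1 h3.1).symm.trans (h2 h3.2))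
    simpa [ae_iff] using this
  have hconn : ∀ {p q : M}, p ∈ U → q ∈ U → ∃ a, Q p a ∧ Q q a := by
    -- Sharing a local value is an equivalence relation on `U` with open classes, so connectedness
    -- leaves one class.
    refine hUc.isPreconnected.induction₂ (fun p q => ∃ a, Q p a ∧ Q q a) ?_ ?_ ?_
    · intro p hp
      obtain ⟨a, V, hV, hpV, ha⟩ := hex p hp
      filter_upwards [mem_nhdsWithin_of_mem_nhds (hV.mem_nhds hpV)] with q hq
      exact ⟨a, ⟨V, hV, hpV, ha⟩, ⟨V, hV, hq, ha⟩⟩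
    · rintro p q r _ _ _ ⟨a, h1, h2⟩ ⟨b, h3, h4⟩
      obtain rfl := huniq q a b h2 h3
      exact ⟨a, h1, h4⟩
    · rintro p q _ _ ⟨a, h1, h2⟩
      exact ⟨a, h2, h1⟩
  obtain ⟨p, hp⟩ := hUc.nonempty
  obtain ⟨a, ha⟩ := hex p hp
  refine ⟨a, ?_⟩
  -- Second countability passes from locally null to null.
  have hnull : S.vol (U ∩ {q | u q ≠ a}) = 0 := by
    refine measure_null_of_locally_null _ fun q hq => ?_
    obtain ⟨b, hb1, V, hV, hqV, hb⟩ := hconn hp hq.1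
    obtain rfl := huniq p a b ha hb1
    refine ⟨V ∩ {q | u q ≠ a}, ?_, ?_⟩
    · exact (nhdsWithin_mono q inter_subset_right)
        (inter_mem (mem_nhdsWithin_of_mem_nhds (hV.mem_nhds hqV)) self_mem_nhdsWithin)
    · rw [ae_iff] at hb
      simpa [Classical.not_imp, ofPred_and] using hb
  rw [Filter.EventuallyEq, ae_restrict_iff' hU.measurableSet, ae_iff]
  simpa [Classical.not_imp, ofPred_and] using hnull

end CCStructure

/-! ### Smooth approximation of continuous elements of `S¹`, locally. -/

section

variable {n : ℕ}

local notation "𝔼" => EuclideanSpace ℝ (Fin n)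

lemma continuous_mul_of_tsupport_subset {W : Set 𝔼} (hW : IsOpen W) {ψ w : 𝔼 → ℝ}
    (hψ : Continuous ψ) (hs : tsupport ψ ⊆ W) (hw : ContinuousOn w W) :
    Continuous fun y => ψ y * w y :=
  contDiff_zero.1 (contDiff_smul_of_tsupport_subset (k := 0) hW (contDiff_zero.2 hψ) hs
    (contDiffOn_zero.2 hw))

/-- The product of a continuous function with weak derivatives in `L²` and a smooth cutoff is
approximated by smooth functions, uniformly and with the derivatives along the given fields. -/
theorem exists_smooth_approx_flat {ι : Type*} [Finite ι] {W K : Set 𝔼} (hW : IsOpen W)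
    (hK : IsCompact K) (hKW : K ⊆ W) {χ w : 𝔼 → ℝ} (hχ : ContDiff ℝ ∞ χ)
    (hχK : tsupport χ ⊆ interior K) (hw : ContinuousOn w W) {b : ι → 𝔼 → 𝔼}
    (hb : ∀ i, ContDiffOn ℝ ∞ (b i) W) {g : ι → 𝔼 → ℝ}
    (hg : ∀ i, MemLp (fun y => χ y * g i y) 2 volume)
    (hweak : ∀ i, ∀ ψ : 𝔼 → ℝ, ContDiff ℝ ∞ ψ → HasCompactSupport ψ → tsupport ψ ⊆ W →
      ∫ y, w y * flatDiv (fun y => ψ y • b i y) y = - ∫ y, g i y * ψ y)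
    {ε : ℝ} (hε : 0 < ε) : ∃ f : 𝔼 → ℝ, ContDiff ℝ ∞ f ∧ tsupport f ⊆ K ∧
      (∀ y, |f y - χ y * w y| ≤ ε) ∧ ∀ i, eLpNorm (fun y => fderiv ℝ f y (b i y) -
        (χ y * g i y + w y * fderiv ℝ χ y (b i y))) 2 (volume.restrict K) ≤ ENNReal.ofReal ε := by
  have hχs : tsupport χ ⊆ K := hχK.trans interior_subset
  have hχW : tsupport χ ⊆ W := hχs.trans hKW
  have hχc : HasCompactSupport χ := hK.of_isClosed_subset (isClosed_tsupport _) hχs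
  obtain ⟨L, hL, hKL, hLW⟩ := exists_compact_between hK hW hKW
  obtain ⟨κ, hκ1, hκ0, -⟩ := exists_contMDiffMap_one_nhds_of_subset_interior (n := ⊤) 𝓘(ℝ, 𝔼)
    hK.isClosed hKL
  have hκs : ContDiff ℝ ∞ κ := κ.contMDiff.contDiff
  have hκL : tsupport κ ⊆ L := closure_minimal (fun y hy => by_contra fun h => hy (hκ0 y h))
    hL.isClosed
  have hκc : HasCompactSupport κ := hL.of_isClosed_subset (isClosed_tsupport _) hκL
  have hκ1' : ∀ y ∈ K, ∀ᶠ z in 𝓝 y, κ z = 1 := fun y hy =>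
    hκ1.filter_mono (nhds_le_nhdsSet hy)
  -- Friedrichs' lemma asks for globally defined compactly supported fields; the cutoff `κ` is `1`
  -- near `K`, so nothing changes where `χ` lives.
  set B : ι → 𝔼 → 𝔼 := fun i y => κ y • b i y with hB
  have hBs : ∀ i, ContDiff ℝ ∞ (B i) := fun i =>
    contDiff_smul_of_tsupport_subset (k := ⊤) hW hκs (hκL.trans hLW) (hb i)
  have hBc : ∀ i, HasCompactSupport (B i) := fun i => hasCompactSupport_smul _ hκc
  have hBb : ∀ i, ∀ y ∈ K, B i =ᶠ[𝓝 y] b i := fun i y hy => by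
    filter_upwards [hκ1' y hy] with z hz
    simp only [hB, hz, one_smul]
  have hdχ0 : ∀ y ∉ tsupport χ, fderiv ℝ χ y = 0 := fun y hy =>
    image_eq_zero_of_notMem_tsupport fun h => hy (tsupport_fderiv_subset ℝ h)
  set χ' : ι → 𝔼 → ℝ := fun i y => fderiv ℝ χ y (B i y) with hχ'
  have hχ's : ∀ i, ContDiff ℝ ∞ (χ' i) := fun i =>
    (hχ.fderiv_right (m := ∞) (by simp)).clm_apply (hBs i)
  have hχ't : ∀ i, tsupport (χ' i) ⊆ tsupport χ := fun i =>
    closure_minimal (fun y hy => by_contra fun h => hy (by simp [hχ', hdχ0 y h]))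
      (isClosed_tsupport _)
  have hχ'c : ∀ i, HasCompactSupport (χ' i) := fun i =>
    hχc.of_isClosed_subset (isClosed_tsupport _) (hχ't i)
  set v : 𝔼 → ℝ := fun y => χ y * w y with hv
  have hvc : Continuous v := continuous_mul_of_tsupport_subset hW hχ.continuous hχW hw
  have hvs : HasCompactSupport v := hχc.mul_right
  have hvt : tsupport v ⊆ tsupport χ := closure_mono (Function.support_mul_subset_left _ _)
  -- The expected weak derivative of `v = χ w` along `B i`, by the product rule.
  set h : ι → 𝔼 → ℝ := fun i y => χ y * g i y + χ' i y * w y with hh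
  have hcw : ∀ i, Continuous fun y => χ' i y * w y := fun i =>
    continuous_mul_of_tsupport_subset hW (hχ's i).continuous ((hχ't i).trans hχW) hw
  have hcw2 : ∀ i, MemLp (fun y => χ' i y * w y) 2 volume := fun i =>
    (hcw i).memLp_of_hasCompactSupport (hχ'c i).mul_right
  have hh2 : ∀ i, MemLp (h i) 2 volume := fun i => (hg i).add (hcw2 i)
  have hwv : ∀ i, ∀ ψ : 𝔼 → ℝ, ContDiff ℝ ∞ ψ → HasCompactSupport ψ →
      ∫ y, v y * flatDiv (fun y => ψ y • B i y) y = - ∫ y, h i y * ψ y := by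
    intro i ψ hψ hψc
    have hχψ : ContDiff ℝ ∞ fun y => χ y * ψ y := hχ.mul hψ
    have hχψc : HasCompactSupport fun y => χ y * ψ y := hχc.mul_right
    have hχψt : tsupport (fun y => χ y * ψ y) ⊆ W :=
      (closure_mono (Function.support_mul_subset_left _ _)).trans hχW
    -- The factor `χ` is moved into the test function; the commutation error is the derivative of
    -- `χ` along the field.
    have hpt : ∀ y, v y * flatDiv (fun y => ψ y • B i y) y =
        w y * flatDiv (fun y => (χ y * ψ y) • b i y) y - χ' i y * w y * ψ y := by
      intro y
      by_cases hy : y ∈ tsupport χ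
      · have hyK := hχs hy
        have hbd : DifferentiableAt ℝ (b i) y :=
          ((hb i).contDiffAt (hW.mem_nhds (hχW hy))).differentiableAt (by simp)
        have hψd := hψ.differentiable (by simp) y
        have e1 : flatDiv (fun y => ψ y • B i y) y = flatDiv (fun y => ψ y • b i y) y :=
          flatDiv_congr ((hBb i y hyK).mono fun z hz => by simp only [hz])
        have e2 : flatDiv (fun y => (χ y * ψ y) • b i y) y =
            fderiv ℝ χ y (ψ y • b i y) + χ y * flatDiv (fun y => ψ y • b i y) y := by
          simp only [mul_smul]
          exact flatDiv_smul (hχ.differentiable (by simp) y) (hψd.smul hbd)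
        rw [e1, e2, map_smul, smul_eq_mul]
        simp only [hv, hχ', (hBb i y hyK).eq_of_nhds]
        ring
      · have h1 : χ y = 0 := image_eq_zero_of_notMem_tsupport hy
        have h2 : flatDiv (fun y => (χ y * ψ y) • b i y) y = 0 :=
          flatDiv_eq_zero_of_notMem_tsupport fun hy' =>
            hy (tsupport_smul_subset (b i) (closure_mono (Function.support_mul_subset_left _ _)) hy')
        rw [h2]
        simp [hv, hχ', h1, hdχ0 y hy]
    have i1 : Integrable fun y => w y * flatDiv (fun y => (χ y * ψ y) • b i y) y :=
      integrable_mul_flatDiv hW (hw.locallyIntegrableOn hW.measurableSet) (hb i) hχψ hχψc hχψt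
    have hψ2 : MemLp ψ 2 volume := hψ.continuous.memLp_of_hasCompactSupport hψc
    have i2 : Integrable fun y => χ' i y * w y * ψ y := (hcw2 i).integrable_mul hψ2
    have i3 : Integrable fun y => χ y * g i y * ψ y := (hg i).integrable_mul hψ2
    have e3 : ∫ y, h i y * ψ y = (∫ y, χ y * g i y * ψ y) + ∫ y, χ' i y * w y * ψ y := by
      rw [← integral_add i3 i2]
      exact integral_congr_ae (.of_forall fun y => by simp only [hh]; ring)
    simp_rw [hpt]
    rw [integral_sub i1 i2, hweak i _ hχψ hχψc hχψt, e3, neg_add, sub_eq_add_neg]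
    congr 2
    exact integral_congr_ae (.of_forall fun y => by ring)
  -- Mollifying at a scale below `δ` keeps the support inside `K`.
  obtain ⟨δ, hδ, hδK⟩ := hχc.exists_cthickening_subset_open isOpen_interior hχK
  have hlim : ∀ᶠ t in 𝓝[>] (0 : ℝ), ∀ i, eLpNorm (fun x => fderiv ℝ (mollify t v) x (B i x) - h i x)
      2 volume ≤ ENNReal.ofReal ε := by
    rw [eventually_all]
    intro i
    exact (tendsto_fderiv_mollify (hBs i) (hBc i) hvc hvs (hh2 i) (hwv i)).eventually_le_const
      (by simpa using hε)
  obtain ⟨t, ht1, ht2, ht3⟩ := (hlim.and ((eventually_mollify_sub_le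
    (hvs.uniformContinuous_of_continuous hvc) hε).and (Ioo_mem_nhdsGT hδ))).exists
  refine ⟨mollify t v, contDiff_mollify (k := ⊤) ht3.1 hvc.locallyIntegrable, ?_, ht2, fun i => ?_⟩
  · exact (tsupport_mollify_subset ht3.1).trans ((Metric.cthickening_subset_of_subset t hvt).trans
      ((Metric.cthickening_mono ht3.2.le _).trans (hδK.trans interior_subset)))
  · refine le_trans (le_of_eq ?_) ((eLpNorm_mono_measure _
      (Measure.restrict_le_self (s := K))).trans (ht1 i))
    refine eLpNorm_congr_ae ?_
    rw [Filter.EventuallyEq, ae_restrict_iff' hK.measurableSet]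
    refine .of_forall fun y hy => ?_
    simp only [hh, hχ', (hBb i y hy).eq_of_nhds]
    ring

end

namespace CCStructure

variable {n m : ℕ} {M : Type*} [TopologicalSpace M] [ChartedSpace (EuclideanSpace ℝ (Fin n)) M]
  [IsManifold (𝓡 n) ∞ M] (S : CCStructure n m M) [MeasurableSpace M] [BorelSpace M] [T2Space M]
  [SecondCountableTopology M]

local notation "𝔼" => EuclideanSpace ℝ (Fin n)

/-- Approximation in a chart. -/
lemma exists_isTestFunction_approx_chart {U V : Set M} (hU : IsOpen U) (hV : IsOpen V)
    (hVU : V ⊆ U) (x : M) (hVx : V ⊆ (extChartAt (𝓡 n) x).source) {u : M → ℝ}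
    (huc : ContinuousOn u U) {p : S.L2 U × (Fin m → S.L2 U)} (hp : p ∈ S.sobolev U)
    (hpu : p.1 =ᵐ[S.vol.restrict U] u) {χ : M → ℝ} (hχ : IsTestFunction (n := n) V χ)
    {ε : ℝ} (hε : 0 < ε) : ∃ φ : M → ℝ, IsTestFunction (n := n) V φ ∧
      (∀ q, |φ q - χ q * u q| ≤ ε) ∧ ∀ i, eLpNorm (fun q => dirDeriv (S.X i) φ q -
        (χ q * p.2 i q + u q * dirDeriv (S.X i) χ q)) 2 (S.vol.restrict U) ≤ ENNReal.ofReal ε := by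
  obtain ⟨hχs, hχc, hχV⟩ := hχ
  have hχx := hχV.trans hVx
  set e := extChartAt (𝓡 n) x with he
  have hW := isOpen_target_inter_preimage (n := n) x hV
  set W := (extChartAt (𝓡 n) x).target ∩ (extChartAt (𝓡 n) x).symm ⁻¹' V with hWdef
  have hWt : W ⊆ e.target := inter_subset_left
  have hsub : e '' tsupport χ ⊆ W := by
    rintro _ ⟨q, hq, rfl⟩
    exact ⟨e.map_source (hχx hq), by rw [mem_preimage, e.left_inv (hχx hq)]; exact hχV hq⟩
  obtain ⟨K, hK, hKχ, hKW⟩ := exists_compact_between (isCompact_image_extChartAt x hχc hχx) hW hsub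
  have hKt := hKW.trans hWt
  obtain ⟨C, hC, hC1, hC2⟩ := S.exists_vol_comparison x hK hKt
  have hI := isCompact_image_symm x hK hKt
  have hIV : e.symm '' K ⊆ V := by rintro _ ⟨y, hy, rfl⟩; exact (hKW hy).2
  have hsm : AEMeasurable e.symm (volume.restrict K) :=
    ((continuousOn_extChartAt_symm x).mono hKt).aemeasurable hK.measurableSet
  have hχ'K : tsupport (chartPull (n := n) x χ) ⊆ interior K :=
    (tsupport_chartPull_subset x hχc hχx).trans hKχ
  have hpull : ∀ y ∈ e.target, chartPull (n := n) x χ y = χ (e.symm y) := fun y hy =>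
    (chartPull_eventuallyEq x χ hy).eq_of_nhds
  have hχcM := hχs.continuous
  have hg : ∀ i, MemLp (fun y => chartPull (n := n) x χ y * p.2 i (e.symm y)) 2 volume := by
    intro i
    obtain ⟨c, hc⟩ := hχcM.bounded_above_of_compact_support hχc
    have h1 : MemLp (fun q => χ q * p.2 i q) 2 (S.vol.restrict U) :=
      (Lp.memLp (p.2 i)).of_le_mul (c := c) (hχcM.aestronglyMeasurable.mul
        (Lp.aestronglyMeasurable _)) (.of_forall fun q => by
          rw [norm_mul]
          exact mul_le_mul_of_nonneg_right (hc q) (norm_nonneg _))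
    have h2 : MemLp (fun q => χ q * p.2 i q) 2 S.vol := by
      rw [← memLp_indicator_iff_restrict hU.measurableSet] at h1
      refine h1.ae_eq (.of_forall fun q => ?_)
      by_cases hq : q ∈ U
      · simp only [indicator_of_mem hq]
      · simp only [indicator_of_notMem hq, image_eq_zero_of_notMem_tsupport
          fun h => hq (hVU (hχV h)), zero_mul]
    have h3 := ((h2.smul_measure hC).mono_measure hC1).comp_of_map hsm
    have h4 := (memLp_indicator_iff_restrict hK.measurableSet).2 h3
    refine h4.ae_eq (.of_forall fun y => ?_)
    by_cases hy : y ∈ K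
    · simp only [indicator_of_mem hy, Function.comp_apply, hpull y (hKt hy)]
      rfl
    · simp only [indicator_of_notMem hy, image_eq_zero_of_notMem_tsupport
        fun h => hy (interior_subset (hχ'K h)), zero_mul]
  have huw : ContinuousOn (fun y => u (e.symm y)) W :=
    huc.comp ((continuousOn_extChartAt_symm x).mono hWt) fun y hy => hVU hy.2
  have hweak : ∀ i, ∀ ψ : 𝔼 → ℝ, ContDiff ℝ ∞ ψ → HasCompactSupport ψ → tsupport ψ ⊆ W →
      ∫ y, u (e.symm y) * flatDiv (fun y => ψ y • fieldCoeff (S.X i) x y) y =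
        - ∫ y, p.2 i (e.symm y) * ψ y := by
    intro i ψ hψ hψc hψt
    rw [← HasWeakDeriv.chart S hU (hp i) x hψ hψc
      (hψt.trans (inter_subset_inter_right _ (preimage_mono hVU)))]
    have hz : ∀ᵐ q ∂S.vol.restrict e.source, q ∈ U → p.1 q = u q :=
      ae_restrict_of_ae ((ae_restrict_iff' hU.measurableSet).1 hpu)
    have hz' := (ae_restrict_iff' (isOpen_target x).measurableSet).1 (S.ae_symm x hz)
    refine integral_congr_ae ?_
    filter_upwards [hz'] with y hy
    by_cases hyW : y ∈ W
    · rw [hy hyW.1 (hVU hyW.2)]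
    · rw [flatDiv_eq_zero_of_notMem_tsupport fun h =>
        hyW (tsupport_smul_subset (fieldCoeff (S.X i) x) hψt h), mul_zero, mul_zero]
  -- The comparison constant `C` for measures distorts `L²` norms by its square root `D`; `η` is
  -- chosen to absorb this factor.
  set D := C ^ (1 / 2 : ENNReal).toReal with hD
  have hDtop : D ≠ ⊤ := ENNReal.rpow_ne_top_of_nonneg (by positivity) hC
  set η := ε / (D.toReal + 1) with hη
  have hη0 : 0 < η := by positivity
  have hηε : η ≤ ε := div_le_self hε.le (by linarith [ENNReal.toReal_nonneg (a := D)])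
  obtain ⟨f, hf, hfK, hf1, hf2⟩ := exists_smooth_approx_flat hW hK hKW
    (contDiff_chartPull x hχs hχc hχx) hχ'K huw
    (fun i => (contDiffOn_fieldCoeff (S.smooth_X i) x).mono hWt) hg hweak hη0
  have hfc : HasCompactSupport f := hK.of_isClosed_subset (isClosed_tsupport _) hfK
  have htest : IsTestFunction (n := n) V (chartExtend x f) :=
    isTestFunction_chartExtend x hf hfc (hfK.trans hKW)
  have hft : tsupport (chartExtend x f) ⊆ e.symm '' K :=
    (tsupport_chartExtend_subset x hfc (hfK.trans hKt)).trans (image_mono hfK)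
  have hχI : tsupport χ ⊆ e.symm '' K := fun q hq =>
    ⟨e q, interior_subset (hKχ ⟨q, hq, rfl⟩), e.left_inv (hχx hq)⟩
  refine ⟨chartExtend x f, htest, fun q => ?_, fun i => ?_⟩
  · by_cases hq : q ∈ e.source
    · have h1 := hf1 (e q)
      rw [hpull _ (e.map_source hq), e.left_inv hq] at h1
      have h2 := chartExtend_symm x f (e.map_source hq)
      rw [e.left_inv hq] at h2
      rw [h2]
      exact h1.trans hηε
    · rw [image_eq_zero_of_notMem_tsupport fun h => hq (hVx (htest.2.2 h)),
        image_eq_zero_of_notMem_tsupport fun h => hq (hχx h)]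
      simpa using hε.le
  set R : M → ℝ := fun q => dirDeriv (S.X i) (chartExtend x f) q -
        (χ q * p.2 i q + u q * dirDeriv (S.X i) χ q) with hR
  have hR0 : ∀ q ∉ e.symm '' K, R q = 0 := fun q hq => by
    simp only [hR]
    rw [dirDeriv_eq_zero_of_notMem_tsupport _ fun h => hq (hft h),
      dirDeriv_eq_zero_of_notMem_tsupport _ fun h => hq (hχI h),
      image_eq_zero_of_notMem_tsupport fun h => hq (hχI h)]
    simp
  have hRI : (e.symm '' K).indicator R = R := by
    ext q
    by_cases hq : q ∈ e.symm '' K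
    · rw [indicator_of_mem hq]
    · rw [indicator_of_notMem hq, hR0 q hq]
  have hRm : AEStronglyMeasurable R (S.vol.restrict U) := by
    have c1 := (continuousOn_dirDeriv (S.smooth_X i) hU htest.1.contMDiffOn)
    have c2 := (continuousOn_dirDeriv (S.smooth_X i) hU hχs.contMDiffOn)
    exact (c1.aestronglyMeasurable hU.measurableSet).sub
      ((hχcM.aestronglyMeasurable.mul (Lp.aestronglyMeasurable _)).add
        ((huc.mul c2).aestronglyMeasurable hU.measurableSet))
  have hRm' : AEStronglyMeasurable R (Measure.map e.symm (volume.restrict K)) := by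
    have h1 : AEStronglyMeasurable R S.vol := by
      rw [← hRI]
      exact (aestronglyMeasurable_indicator_iff hI.measurableSet).2
        (hRm.mono_measure (Measure.restrict_mono (hIV.trans hVU) le_rfl))
    exact h1.mono_ac (Measure.absolutelyContinuous_of_le_smul hC1)
  calc eLpNorm R 2 (S.vol.restrict U)
      ≤ eLpNorm R 2 S.vol := eLpNorm_mono_measure _ Measure.restrict_le_self
    _ = eLpNorm R 2 (S.vol.restrict (e.symm '' K)) := by
        rw [← eLpNorm_indicator_eq_eLpNorm_restrict hI.measurableSet, hRI]
    _ ≤ eLpNorm R 2 (C • Measure.map e.symm (volume.restrict K)) := eLpNorm_mono_measure _ hC2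
    _ = D * eLpNorm (R ∘ e.symm) 2 (volume.restrict K) := by
        rw [eLpNorm_smul_measure_of_ne_top (by simp), eLpNorm_map_measure hRm' hsm, smul_eq_mul]
    _ ≤ D * ENNReal.ofReal η := by
        refine mul_le_mul_right (le_trans (le_of_eq (eLpNorm_congr_ae ?_)) (hf2 i)) _
        rw [Filter.EventuallyEq, ae_restrict_iff' hK.measurableSet]
        refine .of_forall fun y hy => ?_
        have hyt := hKt hy
        have hev : chartExtend x f ∘ e.symm =ᶠ[𝓝 y] f := by
          filter_upwards [(isOpen_target x).mem_nhds hyt] with z hz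
          exact chartExtend_symm x f hz
        simp only [hR, Function.comp_apply, hpull y hyt]
        rw [dirDeriv_symm _ x hyt (htest.1.mdifferentiableAt (by simp)), hev.fderiv_eq,
          dirDeriv_symm _ x hyt (hχs.mdifferentiableAt (by simp)),
          (chartPull_eventuallyEq x χ hyt).fderiv_eq]
    _ ≤ ENNReal.ofReal ε := by
        rw [← ENNReal.ofReal_toReal hDtop, ← ENNReal.ofReal_mul ENNReal.toReal_nonneg]
        refine ENNReal.ofReal_le_ofReal ?_
        rw [hη, mul_div_assoc', div_le_iff₀ (by positivity)]
        nlinarith [ENNReal.toReal_nonneg (a := D)]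

end CCStructure

/-! ### Smooth approximation on an open set: Meyers–Serrin patching. -/

section

variable {n m : ℕ} {M : Type*} [TopologicalSpace M] [ChartedSpace (EuclideanSpace ℝ (Fin n)) M]
  [IsManifold (𝓡 n) ∞ M]

local notation "𝔼" => EuclideanSpace ℝ (Fin n)

lemma dirDeriv_sum (Y : (x : M) → TangentSpace (𝓡 n) x) {ι : Type*} (s : Finset ι)
    {f : ι → M → ℝ} {p : M} (hf : ∀ j ∈ s, ContMDiffAt (𝓡 n) 𝓘(ℝ, ℝ) ∞ (f j) p) :
    dirDeriv Y (fun q => ∑ j ∈ s, f j q) p = ∑ j ∈ s, dirDeriv Y (f j) p := by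
  classical
  induction s using Finset.induction_on with
  | empty => simpa using dirDeriv_const Y 0 p
  | insert a t ha ih =>
    have h1 : ∀ j ∈ t, ContMDiffAt (𝓡 n) 𝓘(ℝ, ℝ) ∞ (f j) p := fun j hj =>
      hf j (Finset.mem_insert_of_mem hj)
    simp_rw [Finset.sum_insert ha]
    rw [dirDeriv_add Y (hf a (Finset.mem_insert_self a t)) (contMDiffAt_finsetSum h1), ih h1]

lemma IsTestFunction.mono {U V : Set M} {φ : M → ℝ} (h : IsTestFunction (n := n) V φ)
    (hVU : V ⊆ U) : IsTestFunction (n := n) U φ := ⟨h.1, h.2.1, h.2.2.trans hVU⟩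

lemma IsTestFunction.sum {V : Set M} {ι : Type*} (s : Finset ι) {f : ι → M → ℝ}
    (hf : ∀ j ∈ s, IsTestFunction (n := n) V (f j)) :
    IsTestFunction (n := n) V fun q => ∑ j ∈ s, f j q := by
  have hsub : tsupport (fun q => ∑ j ∈ s, f j q) ⊆ ⋃ j ∈ s, tsupport (f j) := by
    refine closure_minimal (fun q hq => ?_)
      (s.finite_toSet.isClosed_biUnion fun j _ => isClosed_tsupport _)
    obtain ⟨j, hj, hjq⟩ := Finset.exists_ne_zero_of_sum_ne_zero hq
    exact mem_biUnion hj (subset_tsupport _ hjq)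
  refine ⟨contMDiff_finsetSum fun j hj => (hf j hj).1, ?_, hsub.trans
    (iUnion₂_subset fun j hj => (hf j hj).2.2)⟩
  exact (s.finite_toSet.isCompact_biUnion fun j hj => (hf j hj).2.1).of_isClosed_subset
    (isClosed_tsupport _) hsub

/-- An open set in a manifold is exhausted by compact sets `K j`, with smooth functions that are
`1` near `K j` and vanish off `K (j + 1)`. -/
lemma exists_exhaustion [T2Space M] [SecondCountableTopology M] {U : Set M} (hU : IsOpen U) :
    ∃ (K : ℕ → Set M) (E : ℕ → M → ℝ), (∀ j, IsCompact (K j)) ∧ (∀ j, K j ⊆ interior (K (j + 1))) ∧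
      Monotone K ∧ ⋃ j, K j = U ∧ ⋃ j, interior (K j) = U ∧
      (∀ j, ContMDiff (𝓡 n) 𝓘(ℝ, ℝ) ∞ (E j)) ∧ (∀ j, ∀ᶠ x in 𝓝ˢ (K j), E j x = 1) ∧
      (∀ j, ∀ x ∉ K (j + 1), E j x = 0) ∧ E 0 = 0 := by
  have := ChartedSpace.locallyCompactSpace 𝔼 M
  have : LocallyCompactSpace U := hU.locallyCompactSpace
  -- The shift makes the first compact set empty. Hence `E 0 = 0` is possible, and the telescoping
  -- sum of the `E (j + 1) - E j` has no leftover term.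
  let C : CompactExhaustion U := (CompactExhaustion.choice U).shiftr
  set K : ℕ → Set M := fun j => Subtype.val '' C j with hK
  have hKc : ∀ j, IsCompact (K j) := fun j => (C.isCompact j).image continuous_subtype_val
  have hKi : ∀ j, K j ⊆ interior (K (j + 1)) := fun j => by
    refine (image_mono (C.subset_interior_succ j)).trans (interior_maximal
      (image_mono interior_subset) (hU.isOpenMap_subtype_val _ isOpen_interior))
  have hKm : Monotone K := monotone_nat_of_le_succ fun j => (hKi j).trans interior_subset
  have hKU : ⋃ j, K j = U := by
    rw [← image_iUnion, C.iUnion_eq, image_univ, Subtype.range_coe]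
  have h0 : K 0 = ∅ := by
    have : C 0 = ∅ := rfl
    show Subtype.val '' C 0 = ∅
    rw [this, image_empty]
  have hE : ∀ j, ∃ E : M → ℝ, ContMDiff (𝓡 n) 𝓘(ℝ, ℝ) ∞ E ∧ (∀ᶠ x in 𝓝ˢ (K j), E x = 1) ∧
      (∀ x ∉ K (j + 1), E x = 0) ∧ (j = 0 → E = 0) := by
    intro j
    rcases eq_or_ne j 0 with rfl | hj
    · exact ⟨0, contMDiff_const, by simp [h0], fun _ _ => rfl, fun _ => rfl⟩
    · obtain ⟨f, h1, h2, -⟩ := exists_contMDiffMap_one_nhds_of_subset_interior (n := ⊤) (𝓡 n)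
        (hKc j).isClosed (hKi j)
      exact ⟨f, f.contMDiff, h1, h2, fun h => absurd h hj⟩
  choose E hE1 hE2 hE3 hE4 using hE
  refine ⟨K, E, hKc, hKi, hKm, hKU, ?_, hE1, hE2, hE3, hE4 0 rfl⟩
  refine Subset.antisymm (iUnion_subset fun j => interior_subset.trans (hKU ▸ subset_iUnion K j)) ?_
  rw [← hKU]
  exact iUnion_subset fun j => (hKi j).trans (subset_iUnion (fun j => interior (K j)) (j + 1))

end

/-- Monotone convergence: a bound uniform along the exhaustion holds on the whole open set, with no
prior knowledge that the function is in `L²` there. -/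
lemma eLpNorm_two_le_of_monotone {α : Type*} [MeasurableSpace α] {μ : Measure α} {f : α → ℝ}
    {s : ℕ → Set α} (hs : Monotone s) {c : ENNReal}
    (h : ∀ j, eLpNorm f 2 (μ.restrict (s j)) ≤ c) : eLpNorm f 2 (μ.restrict (⋃ j, s j)) ≤ c := by
  have key : ∀ t : Set α, eLpNorm f 2 (μ.restrict t) ≤ c ↔
      ∫⁻ x in t, ‖f x‖ₑ ^ (2 : ℝ) ∂μ ≤ c ^ (2 : ℝ) := fun t => by
    rw [eLpNorm_eq_lintegral_rpow_enorm_toReal (by norm_num) (by norm_num), ENNReal.toReal_ofNat,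
      one_div, ENNReal.rpow_inv_le_iff (by norm_num)]
  rw [key, setLIntegral_iUnion_of_directed _ hs.directed_le]
  exact iSup_le fun j => (key _).1 (h j)

namespace CCStructure

variable {n m : ℕ} {M : Type*} [TopologicalSpace M] [ChartedSpace (EuclideanSpace ℝ (Fin n)) M]
  [IsManifold (𝓡 n) ∞ M] (S : CCStructure n m M) [MeasurableSpace M] [BorelSpace M] [T2Space M]
  [SecondCountableTopology M]

/-- The difference between `Xᵢ φ` and the weak derivative `χ Xᵢ u + u Xᵢ χ` of `χ u`. -/
noncomputable def defect {U : Set M} (u : M → ℝ) (g : Fin m → S.L2 U) (i : Fin m) (φ χ : M → ℝ)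
    (q : M) : ℝ :=
  dirDeriv (S.X i) φ q - (χ q * g i q + u q * dirDeriv (S.X i) χ q)

lemma aestronglyMeasurable_defect {U : Set M} (hU : IsOpen U) {u : M → ℝ}
    (huc : ContinuousOn u U) (g : Fin m → S.L2 U) (i : Fin m) {φ χ : M → ℝ}
    (hφ : ContMDiffOn (𝓡 n) 𝓘(ℝ, ℝ) ∞ φ U) (hχ : ContMDiffOn (𝓡 n) 𝓘(ℝ, ℝ) ∞ χ U) :
    AEStronglyMeasurable (S.defect u g i φ χ) (S.vol.restrict U) :=
  ((continuousOn_dirDeriv (S.smooth_X i) hU hφ).aestronglyMeasurable hU.measurableSet).sub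
    (((hχ.continuousOn.aestronglyMeasurable hU.measurableSet).mul (Lp.aestronglyMeasurable _)).add
      ((huc.mul (continuousOn_dirDeriv (S.smooth_X i) hU hχ)).aestronglyMeasurable
        hU.measurableSet))

lemma defect_sum {U : Set M} (u : M → ℝ) (g : Fin m → S.L2 U) (i : Fin m) {ι : Type*}
    (s : Finset ι) {φ χ : ι → M → ℝ} {q : M}
    (hφ : ∀ j ∈ s, ContMDiffAt (𝓡 n) 𝓘(ℝ, ℝ) ∞ (φ j) q)
    (hχ : ∀ j ∈ s, ContMDiffAt (𝓡 n) 𝓘(ℝ, ℝ) ∞ (χ j) q) :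
    S.defect u g i (fun q => ∑ j ∈ s, φ j q) (fun q => ∑ j ∈ s, χ j q) q =
      ∑ j ∈ s, S.defect u g i (φ j) (χ j) q := by
  simp only [defect]
  rw [dirDeriv_sum _ s hφ, dirDeriv_sum _ s hχ, Finset.sum_mul, Finset.mul_sum,
    ← Finset.sum_add_distrib, ← Finset.sum_sub_distrib]

/-- Removes the restriction to one chart. The defect is additive in the pair of functions, so a
finite partition of unity with errors `ε / (card + 1)` suffices. -/
lemma exists_isTestFunction_approx {U V : Set M} (hU : IsOpen U) (hV : IsOpen V)
    (hVU : V ⊆ U) {u : M → ℝ}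
    (huc : ContinuousOn u U) {p : S.L2 U × (Fin m → S.L2 U)} (hp : p ∈ S.sobolev U)
    (hpu : p.1 =ᵐ[S.vol.restrict U] u) {χ : M → ℝ} (hχ : IsTestFunction (n := n) V χ)
    {ε : ℝ} (hε : 0 < ε) : ∃ φ : M → ℝ, IsTestFunction (n := n) V φ ∧
      (∀ q, |φ q - χ q * u q| ≤ ε) ∧
      ∀ i, eLpNorm (S.defect u p.2 i φ χ) 2 (S.vol.restrict U) ≤ ENNReal.ofReal ε := by
  obtain ⟨hχs, hχc, hχV⟩ := hχ
  obtain ⟨s, θ, hθ, hθs, hsum⟩ := exists_finset_smoothPartition (n := n) hχc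
  set η := ε / (s.card + 1) with hη
  have hη0 : 0 < η := by positivity
  have hsη : s.card * η ≤ ε := by
    rw [hη, mul_div_assoc', div_le_iff₀ (by positivity)]
    nlinarith
  have htest : ∀ x, IsTestFunction (n := n) (V ∩ (extChartAt (𝓡 n) x).source)
      fun q => θ x q * χ q := fun x =>
    ⟨(hθ x).mul hχs, hχc.mul_left, subset_inter
      ((closure_mono (Function.support_mul_subset_right _ _)).trans hχV)
      ((closure_mono (Function.support_mul_subset_left _ _)).trans (hθs x))⟩
  have hex := fun x => S.exists_isTestFunction_approx_chart hU
    (hV.inter (isOpen_extChartAt_source x)) (inter_subset_left.trans hVU) x inter_subset_right huc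
    hp hpu (htest x) hη0
  choose φ h1 h2 h3 using hex
  have heq : χ = fun q => ∑ x ∈ s, θ x q * χ q := by
    ext q
    by_cases hq : q ∈ tsupport χ
    · rw [← Finset.sum_mul, hsum q hq, one_mul]
    · simp only [image_eq_zero_of_notMem_tsupport hq, mul_zero, Finset.sum_const_zero]
  refine ⟨fun q => ∑ x ∈ s, φ x q, IsTestFunction.sum s fun x _ => (h1 x).mono inter_subset_left,
    fun q => ?_, fun i => ?_⟩
  · rw [congrFun heq q, Finset.sum_mul, ← Finset.sum_sub_distrib]
    refine (Finset.abs_sum_le_sum_abs _ _).trans ((Finset.sum_le_sum fun x _ => h2 x q).trans ?_)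
    rwa [Finset.sum_const, nsmul_eq_mul]
  · have e : S.defect u p.2 i (fun q => ∑ x ∈ s, φ x q) χ =
        ∑ x ∈ s, S.defect u p.2 i (φ x) fun q => θ x q * χ q := by
      ext q
      rw [Finset.sum_apply, ← S.defect_sum u p.2 i s (fun x _ => (h1 x).1 q)
        (fun x _ => (htest x).1 q), ← heq]
    rw [e]
    refine (eLpNorm_sum_le (fun x _ => S.aestronglyMeasurable_defect hU huc p.2 i
      (h1 x).1.contMDiffOn (htest x).1.contMDiffOn) (by norm_num)).trans
      ((Finset.sum_le_sum fun x _ => h3 x i).trans ?_)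
    rw [Finset.sum_const, nsmul_eq_mul, ← ENNReal.ofReal_natCast,
      ← ENNReal.ofReal_mul (Nat.cast_nonneg _)]
    exact ENNReal.ofReal_le_ofReal hsη

/-- A continuous element of `S¹(U)` is approximated, uniformly and in `S¹(U)`, by smooth
functions on `U`. -/
theorem exists_smooth_approx {U : Set M} (hU : IsOpen U) {u : M → ℝ} (huc : ContinuousOn u U)
    {p : S.L2 U × (Fin m → S.L2 U)} (hp : p ∈ S.sobolev U) (hpu : p.1 =ᵐ[S.vol.restrict U] u)
    {ε : ℝ} (hε : 0 < ε) : ∃ φ : M → ℝ, ContMDiffOn (𝓡 n) 𝓘(ℝ, ℝ) ∞ φ U ∧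
      (∀ q ∈ U, |φ q - u q| ≤ ε) ∧ ∀ i, eLpNorm (fun q => dirDeriv (S.X i) φ q - p.2 i q) 2
        (S.vol.restrict U) ≤ ENNReal.ofReal ε := by
  obtain ⟨K, E, hKc, hKi, hKm, hKU, hKU', hEs, hE1, hE0, hE00⟩ := exists_exhaustion (n := n) hU
  have hKsub : ∀ j, K j ⊆ U := fun j => hKU ▸ subset_iUnion K j
  -- A telescoping partition of unity: `θ j` vanishes near `K j` and off `K (j + 2)`. Approximating
  -- `θ j * u` inside the open shell `V j` with error `ε / 2 ^ (j + 1)` keeps the sum locally finite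
  -- and the total error below `ε`.
  set θ : ℕ → M → ℝ := fun j q => E (j + 1) q - E j q with hθ
  set V : ℕ → Set M := fun j => interior (K (j + 3)) \ K j with hV
  have hVo : ∀ j, IsOpen (V j) := fun j => isOpen_interior.sdiff (hKc j).isClosed
  have hVU : ∀ j, V j ⊆ U := fun j => sdiff_subset.trans (interior_subset.trans (hKsub _))
  have hE1' : ∀ j, ∀ q ∈ K j, ∀ᶠ z in 𝓝 q, E j z = 1 := fun j q hq =>
    (hE1 j).filter_mono (nhds_le_nhdsSet hq)
  have hθs : ∀ j, ContMDiff (𝓡 n) 𝓘(ℝ, ℝ) ∞ (θ j) := fun j => (hEs (j + 1)).sub (hEs j)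
  have hθK : ∀ j, tsupport (θ j) ⊆ K (j + 2) := fun j => by
    refine closure_minimal (fun q hq => by_contra fun h => hq ?_) (hKc _).isClosed
    simp only [hθ]
    rw [hE0 (j + 1) q h, hE0 j q fun h' => h (hKm (by omega) h'), sub_zero]
  have hθt : ∀ j, IsTestFunction (n := n) (V j) (θ j) := fun j => by
    refine ⟨hθs j, (hKc (j + 2)).of_isClosed_subset (isClosed_tsupport _) (hθK j),
      subset_sdiff.2 ⟨(hθK j).trans (hKi (j + 2)), ?_⟩⟩
    rw [Set.disjoint_left]
    intro q hq hqK
    refine (notMem_tsupport_iff_eventuallyEq (f := θ j)).2 ?_ hq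
    filter_upwards [hE1' j q hqK, hE1' (j + 1) q (hKm (by omega) hqK)] with z h1 h2
    simp [hθ, h1, h2]
  have hsumθ : ∀ N q, ∑ j ∈ Finset.range N, θ j q = E N q := fun N q => by
    simp only [hθ]
    rw [Finset.sum_range_sub (fun j => E j q) N, hE00]
    simp
  have hε' : ∀ j : ℕ, 0 < ε * (1 / 2) ^ (j + 1) := fun j => by positivity
  have hεsum : ∀ N, ∑ j ∈ Finset.range N, ε * (1 / 2 : ℝ) ^ (j + 1) ≤ ε := fun N => by
    have : ∀ N, ∑ j ∈ Finset.range N, ε * (1 / 2 : ℝ) ^ (j + 1) = ε * (1 - (1 / 2) ^ N) := by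
      intro N
      induction N with
      | zero => simp
      | succ N ih => rw [Finset.sum_range_succ, ih]; ring
    rw [this]
    have : (0 : ℝ) ≤ (1 / 2) ^ N := by positivity
    nlinarith
  have hex := fun j => S.exists_isTestFunction_approx hU (hVo j) (hVU j) huc hp hpu (hθt j) (hε' j)
  choose φ h1 h2 h3 using hex
  have hφ0 : ∀ N, ∀ q ∈ K N, ∀ j ∉ Finset.range N, φ j q = 0 := fun N q hq j hj => by
    refine image_eq_zero_of_notMem_tsupport fun h => ((h1 j).2.2 h).2 (hKm ?_ hq)
    simpa using hj
  set Φ : M → ℝ := fun q => ∑' j, φ j q with hΦ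
  have hΦN : ∀ N, ∀ q ∈ K N, Φ q = ∑ j ∈ Finset.range N, φ j q := fun N q hq =>
    tsum_eq_sum fun j hj => hφ0 N q hq j hj
  have hloc : ∀ q ∈ U, ∃ N, q ∈ interior (K N) := fun q hq => by
    rw [← hKU'] at hq
    exact mem_iUnion.1 hq
  have hΦev : ∀ N, ∀ q ∈ interior (K N), Φ =ᶠ[𝓝 q] fun q => ∑ j ∈ Finset.range N, φ j q :=
    fun N q hq => by
      filter_upwards [isOpen_interior.mem_nhds hq] with z hz using hΦN N z (interior_subset hz)
  refine ⟨Φ, fun q hq => ?_, fun q hq => ?_, fun i => ?_⟩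
  · obtain ⟨N, hN⟩ := hloc q hq
    exact ((contMDiffAt_finsetSum fun j _ => (h1 j).1 q).congr_of_eventuallyEq
      (hΦev N q hN)).contMDiffWithinAt
  · obtain ⟨N, hN⟩ := hloc q hq
    have hqN := interior_subset hN
    have hone : ∑ j ∈ Finset.range N, θ j q = 1 := by
      rw [hsumθ]; exact (hE1' N q hqN).self_of_nhds
    rw [hΦN N q hqN, ← one_mul (u q), ← hone, Finset.sum_mul, ← Finset.sum_sub_distrib]
    exact (Finset.abs_sum_le_sum_abs _ _).trans ((Finset.sum_le_sum fun j _ => h2 j q).trans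
      (hεsum N))
  -- On the interior of `K N` the finite sum of the `θ j` is identically `1` and has no derivative,
  -- so the total defect there is just the error of the derivative.
  · have hmono : Monotone fun N => interior (K N) := fun _ _ h => interior_mono (hKm h)
    have hUi : S.vol.restrict (⋃ N, interior (K N)) = S.vol.restrict U := by rw [hKU']
    refine (le_of_eq (by rw [hUi])).trans (eLpNorm_two_le_of_monotone hmono fun N => ?_)
    have e : ∀ q ∈ interior (K N), dirDeriv (S.X i) Φ q - p.2 i q =
        (∑ j ∈ Finset.range N, S.defect u p.2 i (φ j) (θ j)) q := by
      intro q hq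
      rw [Finset.sum_apply, ← S.defect_sum u p.2 i _ (fun j _ => (h1 j).1 q)
        (fun j _ => hθs j q), defect]
      have hev : (fun q => ∑ j ∈ Finset.range N, θ j q) =ᶠ[𝓝 q] fun _ => 1 := by
        filter_upwards [hE1' N q (interior_subset hq)] with z hz
        rw [hsumθ, hz]
      rw [dirDeriv_congr _ hev, hev.eq_of_nhds, dirDeriv_const, dirDeriv_congr _ (hΦev N q hq)]
      ring
    have hsubN : interior (K N) ⊆ U := interior_subset.trans (hKsub N)
    calc eLpNorm (fun q => dirDeriv (S.X i) Φ q - p.2 i q) 2 (S.vol.restrict (interior (K N)))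
        = eLpNorm (∑ j ∈ Finset.range N, S.defect u p.2 i (φ j) (θ j)) 2
            (S.vol.restrict (interior (K N))) := by
          refine eLpNorm_congr_ae ?_
          rw [Filter.EventuallyEq, ae_restrict_iff' isOpen_interior.measurableSet]
          exact .of_forall e
      _ ≤ eLpNorm (∑ j ∈ Finset.range N, S.defect u p.2 i (φ j) (θ j)) 2 (S.vol.restrict U) :=
          eLpNorm_mono_measure _ (Measure.restrict_mono hsubN le_rfl)
      _ ≤ ∑ j ∈ Finset.range N, ENNReal.ofReal (ε * (1 / 2) ^ (j + 1)) :=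
          (eLpNorm_sum_le (fun j _ => S.aestronglyMeasurable_defect hU huc p.2 i
            (h1 j).1.contMDiffOn (hθs j).contMDiffOn) (by norm_num)).trans
            (Finset.sum_le_sum fun j _ => h3 j i)
      _ = ENNReal.ofReal (∑ j ∈ Finset.range N, ε * (1 / 2) ^ (j + 1)) :=
          (ENNReal.ofReal_sum_of_nonneg fun j _ => (hε' j).le).symm
      _ ≤ ENNReal.ofReal ε := ENNReal.ofReal_le_ofReal (hεsum N)

end CCStructure

/-! ### Eigenvalue criteria, sign change, and extension by zero from a nodal domain. -/

namespace CCStructure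

section Abstract

variable {n m : ℕ} {M : Type*} [TopologicalSpace M] [ChartedSpace (EuclideanSpace ℝ (Fin n)) M]
  [IsManifold (𝓡 n) ∞ M] {S : CCStructure n m M} [MeasurableSpace M]

lemma inner_L2 {U : Set M} (f g : S.L2 U) : inner ℝ f g = ∫ x in U, f x * g x ∂S.vol := by
  rw [L2.inner_def]
  exact integral_congr_ae (.of_forall fun x => by simp [mul_comm])

lemma norm_sq_L2 {U : Set M} (f : S.L2 U) : ‖f‖ ^ 2 = ∫ x in U, f x * f x ∂S.vol := by
  rw [← real_inner_self_eq_norm_sq, inner_L2]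

lemma IsNegLaplacian.exists_energy {U : Set M} {V : Set (S.L2 U × (Fin m → S.L2 U))}
    {u : S.L2 U} {lam : ℝ} (h : IsNegLaplacian V u (lam • u)) :
    ∃ g, (u, g) ∈ V ∧ ∑ i, ‖g i‖ ^ 2 = lam * ‖u‖ ^ 2 := by
  obtain ⟨g, hg, h⟩ := h
  refine ⟨g, hg, ?_⟩
  have := h _ hg
  simpa only [real_inner_self_eq_norm_sq, real_inner_smul_right] using this

/-- If the form is bounded below by `lam` and `u` is an eigenvector with eigenvalue `lam`, then
`lam` is the first eigenvalue and the minimum of the Rayleigh quotient. -/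
lemma first_eigenvalue_of_le {U : Set M} {V : Set (S.L2 U × (Fin m → S.L2 U))} {u : S.L2 U}
    {lam : ℝ} (h : IsEigenvector V lam u) (hle : ∀ p ∈ V, lam * ‖p.1‖ ^ 2 ≤ ∑ i, ‖p.2 i‖ ^ 2) :
    IsKthEigenvalue V 1 lam ∧ IsRayleighMin V lam := by
  have hpos : ∀ w : S.L2 U, w ≠ 0 → 0 < ‖w‖ ^ 2 := fun w hw => by
    have := norm_pos_iff.2 hw
    positivity
  refine ⟨⟨?_, ?_⟩, ?_, ?_⟩
  · have h0 : {u : S.L2 U | ∃ μ < lam, IsEigenvector V μ u} = ∅ := by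
      refine eq_empty_of_forall_notMem ?_
      rintro w ⟨μ, hμ, hw0, hw⟩
      obtain ⟨g, hg, hgw⟩ := hw.exists_energy
      have h1 := hle _ hg
      simp only [hgw] at h1
      exact absurd (le_of_mul_le_mul_right h1 (hpos w hw0)) (not_le.2 hμ)
    rw [h0, Submodule.span_empty]
    simp
  · rw [Nat.cast_one, Cardinal.one_le_iff_pos, rank_pos_iff_exists_ne_zero]
    exact ⟨⟨u, Submodule.subset_span ⟨lam, le_rfl, h⟩⟩, fun h0 => h.1 (congrArg Subtype.val h0)⟩
  · obtain ⟨g, hg, hgu⟩ := h.2.exists_energy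
    refine ⟨_, hg, h.1, ?_⟩
    simp only [hgu]
    rw [mul_div_cancel_right₀ _ (hpos u h.1).ne']
  · rintro r ⟨p, hp, hp0, rfl⟩
    exact (le_div_iff₀ (hpos _ hp0)).2 (hle p hp)

end Abstract

variable {n m : ℕ} {M : Type*} [TopologicalSpace M] [ChartedSpace (EuclideanSpace ℝ (Fin n)) M]
  [IsManifold (𝓡 n) ∞ M] (S : CCStructure n m M) [MeasurableSpace M] [BorelSpace M] [T2Space M]
  [SecondCountableTopology M]

lemma mem_sobolev_of_contMDiffOn {U : Set M} (hU : IsOpen U) {f : M → ℝ}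
    (hf : ContMDiffOn (𝓡 n) 𝓘(ℝ, ℝ) ∞ f U) {p : S.L2 U × (Fin m → S.L2 U)}
    (h1 : p.1 =ᵐ[S.vol.restrict U] f)
    (h2 : ∀ i, p.2 i =ᵐ[S.vol.restrict U] dirDeriv (S.X i) f) : p ∈ S.sobolev U := by
  intro i φ hφ
  have e := S.integral_mul_adj hU i hf hφ
  rw [integral_congr_ae (g := fun x => f x * S.adj i φ x), e]
  · refine integral_congr_ae ?_
    filter_upwards [h2 i] with x hx
    rw [hx]
  · filter_upwards [h1] with x hx
    rw [hx]

lemma isFiniteMeasure_restrict {U : Set M} (hU : IsCompact (closure U)) :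
    IsFiniteMeasure (S.vol.restrict U) :=
  ⟨by rw [Measure.restrict_apply_univ]; exact (measure_mono subset_closure).trans_lt hU.measure_lt_top⟩

variable {S}

/-- The second Neumann eigenvalue of a connected set is positive. -/
lemma second_eigenvalue_pos {U : Set M} (hU : IsOpen U) (hUc : IsConnected U)
    (hUb : IsCompact (closure U)) {lam : ℝ} (hlam : IsKthEigenvalue (S.sobolev U) 2 lam) :
    0 < lam := by
  have := S.isFiniteMeasure_restrict hUb
  by_contra hneg
  set e : S.L2 U := (memLp_const (1 : ℝ)).toLp _ with he
  -- With `lam ≤ 0` all eigenfunctions counted have non-positive energy, hence zero gradient, hence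
  -- are multiples of the constant `e`: a span of dimension at most one, where two is required.
  have hsub : {u : S.L2 U | ∃ μ ≤ lam, IsEigenvector (S.sobolev U) μ u} ⊆
      Submodule.span ℝ {e} := by
    rintro w ⟨μ, hμ, -, hw⟩
    obtain ⟨g, hg, hgw⟩ := hw.exists_energy
    have hg0 : ∀ i, g i = 0 := fun i => by
      have h1 : ∑ i, ‖g i‖ ^ 2 ≤ 0 := by
        rw [hgw]
        exact mul_nonpos_of_nonpos_of_nonneg (hμ.trans (not_lt.1 hneg)) (by positivity)
      have h2 := (Finset.single_le_sum (f := fun i => ‖g i‖ ^ 2) (fun i _ => by positivity)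
        (Finset.mem_univ i)).trans h1
      have h3 : ‖g i‖ ^ 2 = 0 := le_antisymm h2 (by positivity)
      simpa using h3
    obtain ⟨a, ha⟩ := S.ae_const_of_hasWeakDeriv_zero hU hUc (u := w) fun i => by
      have h4 : S.HasWeakDeriv U i w (g i) := hg i
      rwa [hg0 i] at h4
    refine Submodule.mem_span_singleton.2 ⟨a, Lp.ext ?_⟩
    filter_upwards [Lp.coeFn_smul a e, MemLp.coeFn_toLp (memLp_const (μ := S.vol.restrict U)
      (p := 2) (1 : ℝ)), ha] with x h1 h2 h3
    rw [h1, h3, Pi.smul_apply, he, h2, smul_eq_mul, mul_one]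
  have h1 := (Submodule.rank_mono (Submodule.span_le.2 hsub)).trans (rank_span_le _)
  rw [Cardinal.mk_singleton] at h1
  have h2 := hlam.2.trans h1
  norm_num at h2

/-- Eigenfunctions with a non-zero Neumann eigenvalue change sign. -/
lemma exists_pos_of_isNegLaplacian {U : Set M} (hU : IsOpen U) (hUb : IsCompact (closure U))
    {lam : ℝ} (hlam : lam ≠ 0) {u : M → ℝ} {w : S.L2 U} (hwu : w =ᵐ[S.vol.restrict U] u)
    (hw0 : w ≠ 0) (hw : IsNegLaplacian (S.sobolev U) w (lam • w)) : ∃ x ∈ U, 0 < u x := by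
  have := S.isFiniteMeasure_restrict hUb
  by_contra! hneg
  obtain ⟨g, -, hg⟩ := hw
  -- The constant `1` is an admissible Neumann test function because `U` has finite volume. As `lam
  -- ≠ 0`, it forces the eigenfunction to have integral zero, which with `u ≤ 0` gives `u = 0`.
  have h1 : (((memLp_const (1 : ℝ)).toLp _, 0) : S.L2 U × (Fin m → S.L2 U)) ∈ S.sobolev U := by
    refine S.mem_sobolev_of_contMDiffOn hU (f := fun _ => 1) contMDiffOn_const
      (MemLp.coeFn_toLp (memLp_const (1 : ℝ))) fun i => ?_
    filter_upwards [Lp.coeFn_zero ℝ 2 (S.vol.restrict U)] with x hx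
    rw [dirDeriv_const]
    exact hx
  have h2 := hg _ h1
  simp only [Pi.zero_apply, inner_zero_left, Finset.sum_const_zero, real_inner_smul_right] at h2
  have h3 := (mul_eq_zero.1 h2.symm).resolve_left hlam
  rw [inner_L2] at h3
  have h4 : ∫ x in U, w x ∂S.vol = 0 := by
    rw [← h3]
    refine integral_congr_ae ?_
    filter_upwards [MemLp.coeFn_toLp (memLp_const (μ := S.vol.restrict U) (p := 2) (1 : ℝ))]
      with x hx
    rw [hx, one_mul]
  have h5 : ∀ᵐ x ∂S.vol.restrict U, 0 ≤ (-w : M → ℝ) x := by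
    filter_upwards [hwu, ae_restrict_mem hU.measurableSet] with x hx hxU
    have := hneg x hxU
    simp only [Pi.neg_apply, hx]
    linarith
  have h6 : Integrable w (S.vol.restrict U) := (Lp.memLp w).integrable (by norm_num)
  have h7 := (integral_eq_zero_iff_of_nonneg_ae h5 h6.neg).1 (by
    simp only [Pi.neg_apply]
    rw [integral_neg, h4, neg_zero])
  refine hw0 ((Lp.eq_zero_iff_ae_eq_zero).2 ?_)
  filter_upwards [h7] with x hx
  simpa using hx

variable (S)

/-- The restriction of a square integrable function. -/
noncomputable def restr {U W : Set M} (h : W ⊆ U) (f : S.L2 U) : S.L2 W :=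
  ((Lp.memLp f).mono_measure (Measure.restrict_mono h le_rfl)).toLp f

variable {S}

lemma coeFn_restr {U W : Set M} (h : W ⊆ U) (f : S.L2 U) : S.restr h f =ᵐ[S.vol.restrict W] f :=
  MemLp.coeFn_toLp _

/-- Near every point of `U` the extension is either `φ` or zero; the hypothesis at `U \ W` covers
the part of the boundary of `W` lying in `U`. -/
lemma contMDiffOn_indicator {U W : Set M} (hW : IsOpen W) {φ : M → ℝ}
    (hφ : ContMDiffOn (𝓡 n) 𝓘(ℝ, ℝ) ∞ φ W)
    (h0 : ∀ y ∈ U \ W, W.indicator φ =ᶠ[𝓝 y] 0) :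
    ContMDiffOn (𝓡 n) 𝓘(ℝ, ℝ) ∞ (W.indicator φ) U ∧
      ∀ (Y : (x : M) → TangentSpace (𝓡 n) x), ∀ y ∈ U,
        dirDeriv Y (W.indicator φ) y = W.indicator (dirDeriv Y φ) y := by
  have hin : ∀ y ∈ W, W.indicator φ =ᶠ[𝓝 y] φ := fun y hy => by
    filter_upwards [hW.mem_nhds hy] with z hz using indicator_of_mem hz _
  refine ⟨fun y hy => ?_, fun Y y hy => ?_⟩ <;> by_cases hyW : y ∈ W
  · exact ((hφ.contMDiffAt (hW.mem_nhds hyW)).congr_of_eventuallyEq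
      (hin y hyW)).contMDiffWithinAt
  · exact ((contMDiffAt_const (c := (0 : ℝ))).congr_of_eventuallyEq
      (h0 y ⟨hy, hyW⟩)).contMDiffWithinAt
  · rw [indicator_of_mem hyW, dirDeriv_congr Y (hin y hyW)]
  · rw [indicator_of_notMem hyW, dirDeriv_congr Y (h0 y ⟨hy, hyW⟩)]
    exact dirDeriv_const Y 0 y

/-- Functions vanishing near the nodal set inside a nodal domain extend by zero. -/
lemma indicator_eventuallyEq_zero {Ω : Set M} (hΩ : IsOpen Ω) {u : M → ℝ}
    (huc : ContinuousOn u Ω) {φ : M → ℝ}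
    (hcl : closure {x ∈ {x ∈ Ω | 0 < u x} | φ x ≠ 0} ∩ closure {x ∈ Ω | u x = 0} ∩ Ω = ∅) :
    ∀ y ∈ Ω \ {x ∈ Ω | 0 < u x}, {x ∈ Ω | 0 < u x}.indicator φ =ᶠ[𝓝 y] 0 := by
  rintro y ⟨hy, hyW⟩
  have hyu : u y ≤ 0 := not_lt.1 fun h => hyW ⟨hy, h⟩
  -- Where `u < 0`, continuity keeps a whole neighbourhood away from the nodal domain. Where `u =
  -- 0`, the point is nodal and the support condition applies.
  rcases hyu.lt_or_eq with h | h
  · have hc := huc.continuousAt (hΩ.mem_nhds hy)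
    filter_upwards [hc.eventually_lt continuousAt_const h] with z hz
    exact indicator_of_notMem (fun h' => lt_asymm hz h'.2) _
  · have hy' : y ∉ closure {x ∈ {x ∈ Ω | 0 < u x} | φ x ≠ 0} := fun h' => by
      have : y ∈ (∅ : Set M) := hcl ▸ ⟨⟨h', subset_closure ⟨hy, h⟩⟩, hy⟩
      exact this
    filter_upwards [isClosed_closure.isOpen_compl.mem_nhds hy'] with z hz
    by_cases hzW : z ∈ {x ∈ Ω | 0 < u x}
    · rw [indicator_of_mem hzW]
      by_contra h0
      exact hz (subset_closure ⟨hzW, h0⟩)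
    · exact indicator_of_notMem hzW _

/-- The weak eigenvalue equation on a nodal domain. -/
lemma nodal_equation {Ω W Z : Set M} (hΩ : IsOpen Ω) {u : M → ℝ} (huc : ContinuousOn u Ω)
    (hplus : W = {x ∈ Ω | 0 < u x}) (hZ : Z = {x ∈ Ω | u x = 0}) (hW : IsOpen W) (hWΩ : W ⊆ Ω)
    {h : S.L2 Ω} {g : Fin m → S.L2 Ω}
    (hg : ∀ p ∈ S.sobolev Ω, ∑ i, inner ℝ (p.2 i) (g i) = inner ℝ p.1 h)
    {q : S.L2 W × (Fin m → S.L2 W)} (hq : q ∈ S.mixedSmooth Ω W Z) :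
    ∑ i, inner ℝ (q.2 i) (S.restr hWΩ (g i)) = inner ℝ q.1 (S.restr hWΩ h) := by
  obtain ⟨φ, hφ, hcl, h1, h2⟩ := hq
  obtain ⟨hs, hd⟩ := contMDiffOn_indicator hW hφ (by
    subst hplus hZ
    exact indicator_eventuallyEq_zero hΩ huc hcl)
  have hmem : ∀ {f : M → ℝ} {F : S.L2 W}, F =ᵐ[S.vol.restrict W] f →
      MemLp (W.indicator f) 2 (S.vol.restrict Ω) := fun {f F} hF => by
    rw [memLp_indicator_iff_restrict hW.measurableSet, Measure.restrict_restrict hW.measurableSet,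
      inter_eq_self_of_subset_left hWΩ]
    exact (Lp.memLp F).ae_eq hF
  -- Pairing the extension by zero with `k` over `Ω` is pairing the original with the restriction of
  -- `k` over `W`.
  have hin : ∀ {f : M → ℝ} {F : S.L2 W} (hF : F =ᵐ[S.vol.restrict W] f) (k : S.L2 Ω),
      inner ℝ ((hmem hF).toLp _) k = inner ℝ F (S.restr hWΩ k) := fun {f F} hF k => by
    rw [inner_L2, inner_L2]
    have e1 : ∫ x in W, F x * S.restr hWΩ k x ∂S.vol = ∫ x in W, f x * k x ∂S.vol := by
      refine integral_congr_ae ?_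
      filter_upwards [hF, coeFn_restr hWΩ k] with x hx1 hx2
      rw [hx1, hx2]
    have e2 : ∫ x in Ω, ((hmem hF).toLp _ : M → ℝ) x * k x ∂S.vol =
        ∫ x in Ω, W.indicator (fun x => f x * k x) x ∂S.vol := by
      refine integral_congr_ae ?_
      filter_upwards [MemLp.coeFn_toLp (hmem hF)] with x hx
      rw [hx]
      by_cases hxW : x ∈ W
      · simp only [indicator_of_mem hxW]
      · simp only [indicator_of_notMem hxW, zero_mul]
    rw [e1, e2, setIntegral_indicator hW.measurableSet, inter_eq_self_of_subset_right hWΩ]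
  have hp := hg ((hmem h1).toLp _, fun i => (hmem (h2 i)).toLp _)
    (S.mem_sobolev_of_contMDiffOn hΩ hs (MemLp.coeFn_toLp (hmem h1)) fun i => by
      filter_upwards [MemLp.coeFn_toLp (hmem (h2 i)), ae_restrict_mem hΩ.measurableSet]
        with x hx hxΩ
      rw [hx, hd _ x hxΩ])
  rw [hin h1 h] at hp
  rw [← hp]
  exact Finset.sum_congr rfl fun i _ => (hin (h2 i) (g i)).symm

end CCStructure

/-! ### Truncation: the eigenfunction lies in the mixed form domain. -/

/-- A smooth function that vanishes for `s ≤ 2`, is the identity for `3 ≤ s` and has bounded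
derivative. -/
lemma exists_smooth_truncation : ∃ (F : ℝ → ℝ) (C : ℝ), ContDiff ℝ ∞ F ∧ (∀ s ≤ 2, F s = 0) ∧
    (∀ s ≥ 3, F s = s) ∧ (∀ s, |F s - max s 0| ≤ 3) ∧ ∀ s, |deriv F s| ≤ C := by
  set F : ℝ → ℝ := fun s => s * Real.smoothTransition (s - 2) with hF
  have hs : ContDiff ℝ ∞ F :=
    contDiff_id.mul (Real.smoothTransition.contDiff.comp (contDiff_id.sub contDiff_const))
  have h2 : ∀ s ≤ 2, F s = 0 := fun s hs => by
    simp only [hF]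
    rw [Real.smoothTransition.zero_of_nonpos (by linarith), mul_zero]
  have h3 : ∀ s ≥ 3, F s = s := fun s hs => by
    simp only [hF]
    rw [Real.smoothTransition.one_of_one_le (by linarith), mul_one]
  obtain ⟨C, hC⟩ := (isCompact_Icc (a := (2 : ℝ)) (b := 3)).exists_bound_of_continuousOn
    (hs.continuous_deriv (by simp)).continuousOn
  refine ⟨F, max C 1, hs, h2, h3, fun s => ?_, fun s => ?_⟩
  · rcases le_total s 0 with h | h
    · rw [h2 s (by linarith), max_eq_right h]; norm_num
    · rw [max_eq_left h]
      rcases le_total s 3 with h' | h'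
      · have e1 := Real.smoothTransition.nonneg (s - 2)
        have e2 := Real.smoothTransition.le_one (s - 2)
        rw [abs_le]
        simp only [hF]
        constructor <;> nlinarith
      · rw [h3 s h']; norm_num
  · rcases lt_or_ge s 2 with h | h
    · have : F =ᶠ[𝓝 s] fun _ => 0 := by
        filter_upwards [Iio_mem_nhds h] with t ht using h2 t (le_of_lt ht)
      rw [this.deriv_eq]
      simp
    · rcases le_or_gt s 3 with h' | h'
      · exact (hC s ⟨h, h'⟩).trans (le_max_left _ _)
      · have : F =ᶠ[𝓝 s] id := by
          filter_upwards [Ioi_mem_nhds h'] with t ht using h3 t (le_of_lt ht)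
        rw [this.deriv_eq]
        simp

lemma tendsto_eLpNorm_two_of_dominated {α : Type*} [MeasurableSpace α] {μ : Measure α}
    {f : ℕ → α → ℝ} {G : α → ℝ} (hf : ∀ k, AEStronglyMeasurable (f k) μ) (hG : MemLp G 2 μ)
    (hb : ∀ k, ∀ᵐ x ∂μ, |f k x| ≤ |G x|) (hl : ∀ᵐ x ∂μ, Tendsto (fun k => f k x) atTop (𝓝 0)) :
    Tendsto (fun k => eLpNorm (f k) 2 μ) atTop (𝓝 0) := by
  have e : ∀ g : α → ℝ, eLpNorm g 2 μ = (∫⁻ x, ‖g x‖ₑ ^ (2 : ℝ) ∂μ) ^ (1 / 2 : ℝ) := fun g => by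
    rw [eLpNorm_eq_lintegral_rpow_enorm_toReal (by norm_num) (by norm_num), ENNReal.toReal_ofNat]
  have h1 : Tendsto (fun k => ∫⁻ x, ‖f k x‖ₑ ^ (2 : ℝ) ∂μ) atTop (𝓝 (∫⁻ _, 0 ∂μ)) := by
    refine tendsto_lintegral_of_dominated_convergence' (fun x => ‖G x‖ₑ ^ (2 : ℝ))
      (fun k => (hf k).enorm.pow_const _) (fun k => ?_) ?_ ?_
    · filter_upwards [hb k] with x hx
      exact ENNReal.rpow_le_rpow (enorm_le_iff_norm_le.2 hx) (by norm_num)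
    · have := hG.2
      rw [e] at this
      intro h
      rw [h] at this
      simp at this
    · filter_upwards [hl] with x hx
      have h2 : Tendsto (fun k => ‖f k x‖ₑ ^ (2 : ℝ)) atTop (𝓝 (‖(0 : ℝ)‖ₑ ^ (2 : ℝ))) :=
        (ENNReal.continuous_rpow_const.tendsto _).comp ((continuous_enorm.tendsto _).comp hx)
      simpa using h2
  simp_rw [e]
  have h3 := ((ENNReal.continuous_rpow_const (y := (1 / 2 : ℝ))).tendsto _).comp h1
  simpa [Function.comp_def] using h3

namespace CCStructure

variable {n m : ℕ} {M : Type*} [TopologicalSpace M] [ChartedSpace (EuclideanSpace ℝ (Fin n)) M]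
  [IsManifold (𝓡 n) ∞ M] {S : CCStructure n m M} [MeasurableSpace M] [BorelSpace M] [T2Space M]
  [SecondCountableTopology M]

/-- The restriction to `{u > 0}` of a continuous element `u` of `S¹(Ω)` satisfies the Dirichlet
condition on the nodal set. -/
theorem restr_mem_mixedSobolev {Ω W Z A : Set M} (hΩ : IsOpen Ω) (hΩb : IsCompact (closure Ω))
    {u : M → ℝ} (huc : ContinuousOn u Ω) (hplus : W = {x ∈ Ω | 0 < u x}) (hW : IsOpen W)
    (hWΩ : W ⊆ Ω) (hA : ∀ y ∈ closure Z ∩ A, Tendsto u (𝓝[Ω] y) (𝓝 0))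
    {p : S.L2 Ω × (Fin m → S.L2 Ω)} (hp : p ∈ S.sobolev Ω) (hpu : p.1 =ᵐ[S.vol.restrict Ω] u) :
    (S.restr hWΩ p.1, fun i => S.restr hWΩ (p.2 i)) ∈ S.mixedSobolev A W Z := by
  have := S.isFiniteMeasure_restrict hΩb
  have hle : S.vol.restrict W ≤ S.vol.restrict Ω := Measure.restrict_mono hWΩ le_rfl
  have : IsFiniteMeasure (S.vol.restrict W) := isFiniteMeasure_of_le _ hle
  obtain ⟨F, C, hFs, hF2, hF3, hFm, hFC⟩ := exists_smooth_truncation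
  have hC0 : 0 ≤ C := (abs_nonneg _).trans (hFC 0)
  have hK : ∀ k : ℕ, (0 : ℝ) < k + 1 := fun k => by positivity
  have hex := fun k : ℕ => S.exists_smooth_approx hΩ huc hp hpu (inv_pos.2 (hK k))
  choose φ hφs hφu hφg using hex
  have hpuW : p.1 =ᵐ[S.vol.restrict W] u := hpu.filter_mono (ae_mono hle)
  have huW : ∀ x ∈ W, 0 < u x := fun x hx => by rw [hplus] at hx; exact hx.2
  -- The rescaled truncation vanishes below `2 / (k + 1)`, is the identity above `3 / (k + 1)`, and
  -- its derivative is bounded by `C` independently of `k`.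
  set Fk : ℕ → ℝ → ℝ := fun k t => F ((k + 1) * t) / (k + 1) with hFk
  have hFks : ∀ k, ContDiff ℝ ∞ (Fk k) := fun k =>
    (hFs.comp (contDiff_const.mul contDiff_id)).div_const _
  have hFkd : ∀ k t, deriv (Fk k) t = deriv F ((k + 1) * t) := fun k t => by
    have h1 : HasDerivAt (fun t : ℝ => ((k : ℝ) + 1) * t) (k + 1) t := by
      simpa using (hasDerivAt_id t).const_mul ((k : ℝ) + 1)
    have h2 := (((hFs.differentiable (by simp) _).hasDerivAt (x := ((k : ℝ) + 1) * t)).comp t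
      h1).div_const ((k : ℝ) + 1)
    rw [mul_div_cancel_right₀ _ (hK k).ne'] at h2
    exact h2.deriv
  set w : ℕ → M → ℝ := fun k q => Fk k (φ k q) with hw
  have hφW : ∀ k, ContMDiffOn (𝓡 n) 𝓘(ℝ, ℝ) ∞ (φ k) W := fun k => (hφs k).mono hWΩ
  have hws : ∀ k, ContMDiffOn (𝓡 n) 𝓘(ℝ, ℝ) ∞ (w k) W := fun k =>
    (hFks k).contMDiff.comp_contMDiffOn (hφW k)
  have hwd : ∀ k i, ∀ q ∈ W, dirDeriv (S.X i) (w k) q =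
      deriv F ((k + 1) * φ k q) * dirDeriv (S.X i) (φ k) q := fun k i q hq => by
    rw [← hFkd]
    exact dirDeriv_comp _ ((hφW k).contMDiffAt (hW.mem_nhds hq)) (hFks k).contDiffAt
  -- Of the `4`, three parts come from the truncation and one from the distance between `φ k` and
  -- `u`.
  have hwu : ∀ k, ∀ q ∈ W, |w k q - u q| ≤ 4 * ((k : ℝ) + 1)⁻¹ := fun k q hq => by
    have h1 := hFm ((k + 1) * φ k q)
    have h2 : max ((k + 1) * φ k q) 0 = (k + 1) * max (φ k q) 0 := by
      rw [mul_max_of_nonneg _ _ (hK k).le, mul_zero]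
    have h3 : |w k q - max (φ k q) 0| ≤ 3 * ((k : ℝ) + 1)⁻¹ := by
      have : w k q - max (φ k q) 0 =
          (F ((k + 1) * φ k q) - (k + 1) * max (φ k q) 0) * ((k : ℝ) + 1)⁻¹ := by
        simp only [hw, hFk]
        have := (hK k).ne'
        field_simp
      rw [this, abs_mul, abs_of_pos (inv_pos.2 (hK k)), ← h2]
      exact mul_le_mul_of_nonneg_right h1 (inv_pos.2 (hK k)).le
    have h4 : |max (φ k q) 0 - u q| ≤ ((k : ℝ) + 1)⁻¹ := by
      have h5 := abs_max_sub_max_le_abs (φ k q) (u q) 0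
      rw [max_eq_left (huW q hq).le] at h5
      exact h5.trans (hφu k q (hWΩ hq))
    calc |w k q - u q| ≤ |w k q - max (φ k q) 0| + |max (φ k q) 0 - u q| := abs_sub_le _ _ _
      _ ≤ _ := by linarith
  have hwm : ∀ k, AEStronglyMeasurable (w k) (S.vol.restrict W) := fun k =>
    (hws k).continuousOn.aestronglyMeasurable hW.measurableSet
  have hum : MemLp u 2 (S.vol.restrict W) := ((Lp.memLp p.1).mono_measure hle).ae_eq hpuW
  have hwum : ∀ k, MemLp (w k - u) 2 (S.vol.restrict W) := fun k =>
    MemLp.of_bound ((hwm k).sub hum.1) (4 * ((k : ℝ) + 1)⁻¹) (by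
      filter_upwards [ae_restrict_mem hW.measurableSet] with q hq using hwu k q hq)
  have hwL : ∀ k, MemLp (w k) 2 (S.vol.restrict W) := fun k => by
    simpa using (hwum k).add hum
  have hFdm : ∀ k, ContinuousOn (fun q => deriv F ((k + 1) * φ k q)) W := fun k =>
    (hFs.continuous_deriv (by simp)).comp_continuousOn
      (continuousOn_const.mul (hφW k).continuousOn)
  have hgW : ∀ i, MemLp (p.2 i) 2 (S.vol.restrict W) := fun i => (Lp.memLp _).mono_measure hle
  have hdm : ∀ k i, AEStronglyMeasurable (dirDeriv (S.X i) (φ k)) (S.vol.restrict W) :=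
    fun k i => (continuousOn_dirDeriv (S.smooth_X i) hW (hφW k)).aestronglyMeasurable
      hW.measurableSet
  have hrW : ∀ k i, eLpNorm (fun q => dirDeriv (S.X i) (φ k) q - p.2 i q) 2 (S.vol.restrict W) ≤
      ENNReal.ofReal ((k : ℝ) + 1)⁻¹ := fun k i => (eLpNorm_mono_measure _ hle).trans (hφg k i)
  -- The derivative error is split in two. `a` is small because the derivative of `F` is bounded and
  -- the gradients converge; `b` is dominated by a multiple of the weak derivative and tends to zero
  -- pointwise.
  set a : ℕ → Fin m → M → ℝ := fun k i q =>
    deriv F ((k + 1) * φ k q) * (dirDeriv (S.X i) (φ k) q - p.2 i q) with ha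
  set b : ℕ → Fin m → M → ℝ := fun k i q => (deriv F ((k + 1) * φ k q) - 1) * p.2 i q with hb
  have ham : ∀ k i, AEStronglyMeasurable (a k i) (S.vol.restrict W) := fun k i =>
    ((hFdm k).aestronglyMeasurable hW.measurableSet).mul ((hdm k i).sub (hgW i).1)
  have hbm : ∀ k i, AEStronglyMeasurable (b k i) (S.vol.restrict W) := fun k i =>
    (((hFdm k).sub continuousOn_const).aestronglyMeasurable hW.measurableSet).mul (hgW i).1
  have haN : ∀ k i, eLpNorm (a k i) 2 (S.vol.restrict W) ≤
      ENNReal.ofReal C * ENNReal.ofReal ((k : ℝ) + 1)⁻¹ := fun k i => by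
    refine (eLpNorm_le_mul_eLpNorm_of_ae_le_mul (c := C) (g := fun q =>
      dirDeriv (S.X i) (φ k) q - p.2 i q) (.of_forall fun q => ?_) 2).trans
      (mul_le_mul_right (hrW k i) _)
    simp only [ha]
    rw [norm_mul]
    exact mul_le_mul_of_nonneg_right (hFC _) (norm_nonneg _)
  have hbB : ∀ k i q, |b k i q| ≤ |(C + 1) * p.2 i q| := fun k i q => by
    simp only [hb]
    rw [abs_mul, abs_mul, abs_of_nonneg (by linarith : (0 : ℝ) ≤ C + 1)]
    refine mul_le_mul_of_nonneg_right ((abs_sub _ _).trans ?_) (abs_nonneg _)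
    rw [abs_one]
    linarith [hFC ((k + 1) * φ k q)]
  have hab : ∀ k i, ∀ q ∈ W, dirDeriv (S.X i) (w k) q - p.2 i q = a k i q + b k i q :=
    fun k i q hq => by
      rw [hwd k i q hq]
      simp only [ha, hb]
      ring
  have hbL : ∀ k i, MemLp (b k i) 2 (S.vol.restrict W) := fun k i =>
    ((hgW i).const_mul (C + 1)).mono (hbm k i) (.of_forall (hbB k i))
  have haL : ∀ k i, MemLp (a k i) 2 (S.vol.restrict W) := fun k i =>
    ⟨ham k i, (haN k i).trans_lt (ENNReal.mul_lt_top ENNReal.ofReal_lt_top ENNReal.ofReal_lt_top)⟩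
  have hae : ∀ k i, dirDeriv (S.X i) (w k) =ᵐ[S.vol.restrict W] (a k i + b k i + p.2 i) :=
    fun k i => by
      filter_upwards [ae_restrict_mem hW.measurableSet] with q hq
      simp only [Pi.add_apply]
      linarith [hab k i q hq]
  have hdL : ∀ k i, MemLp (dirDeriv (S.X i) (w k)) 2 (S.vol.restrict W) := fun k i =>
    (((haL k i).add (hbL k i)).add (hgW i)).ae_eq (hae k i).symm
  have hinv : Tendsto (fun k : ℕ => ENNReal.ofReal ((k : ℝ) + 1)⁻¹) atTop (𝓝 0) := by
    have h1 : Tendsto (fun k : ℕ => ((k : ℝ) + 1)⁻¹) atTop (𝓝 0) := by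
      simpa [one_div] using tendsto_one_div_add_atTop_nhds_zero_nat (𝕜 := ℝ)
    simpa using ENNReal.tendsto_ofReal h1
  refine mem_closure_of_tendsto (b := atTop)
    (f := fun k => ((hwL k).toLp _, fun i => (hdL k i).toLp _)) ?_ (.of_forall fun k => ?_)
  · refine Tendsto.prodMk_nhds ?_ (tendsto_pi_nhds.2 fun i => ?_)
    · rw [Lp.tendsto_Lp_iff_tendsto_eLpNorm']
      have h1 : ∀ k, eLpNorm (((hwL k).toLp _ : M → ℝ) - (S.restr hWΩ p.1 : M → ℝ)) 2 (S.vol.restrict W) ≤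
          ENNReal.ofReal (4 * (S.vol.restrict W univ ^ (2⁻¹ : ℝ)).toReal) *
            ENNReal.ofReal ((k : ℝ) + 1)⁻¹ := fun k => by
        have h2 : eLpNorm (w k - u) 2 (S.vol.restrict W) ≤
            S.vol.restrict W univ ^ (2⁻¹ : ℝ) * ENNReal.ofReal (4 * ((k : ℝ) + 1)⁻¹) := by
          simpa using eLpNorm_le_of_ae_bound (p := 2) (f := w k - u) (μ := S.vol.restrict W)
            (C := 4 * ((k : ℝ) + 1)⁻¹) (by
              filter_upwards [ae_restrict_mem hW.measurableSet] with q hq using hwu k q hq)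
        refine le_trans (le_of_eq (eLpNorm_congr_ae ?_)) (h2.trans (le_of_eq ?_))
        · filter_upwards [MemLp.coeFn_toLp (hwL k), coeFn_restr hWΩ p.1, hpuW] with q e1 e2 e3
          simp only [Pi.sub_apply, e1, e2, e3]
        · rw [mul_comm (4 : ℝ) (ENNReal.toReal _), ENNReal.ofReal_mul ENNReal.toReal_nonneg,
            ENNReal.ofReal_mul (by norm_num : (0 : ℝ) ≤ 4),
            ENNReal.ofReal_toReal (ENNReal.rpow_ne_top_of_nonneg (by norm_num)
              (measure_ne_top _ _)), mul_assoc]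
      refine tendsto_of_tendsto_of_tendsto_of_le_of_le tendsto_const_nhds ?_
        (fun _ => zero_le) h1
      have h3 := ENNReal.Tendsto.const_mul (a := ENNReal.ofReal
        (4 * (S.vol.restrict W univ ^ (2⁻¹ : ℝ)).toReal)) hinv (Or.inr ENNReal.ofReal_ne_top)
      rwa [mul_zero] at h3
    · rw [Lp.tendsto_Lp_iff_tendsto_eLpNorm']
      have h1 : ∀ k, eLpNorm (((hdL k i).toLp _ : M → ℝ) - (S.restr hWΩ (p.2 i) : M → ℝ)) 2
          (S.vol.restrict W) ≤ ENNReal.ofReal C * ENNReal.ofReal ((k : ℝ) + 1)⁻¹ +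
            eLpNorm (b k i) 2 (S.vol.restrict W) := fun k => by
        refine le_trans (le_of_eq (eLpNorm_congr_ae (g := a k i + b k i) ?_))
          ((eLpNorm_add_le (ham k i) (hbm k i) (by norm_num)).trans (add_le_add_left (haN k i) _))
        filter_upwards [MemLp.coeFn_toLp (hdL k i), coeFn_restr hWΩ (p.2 i), hae k i]
          with q e1 e2 e3
        simp only [Pi.sub_apply, e1, e2, e3, Pi.add_apply]
        ring
      have h2 : Tendsto (fun k => eLpNorm (b k i) 2 (S.vol.restrict W)) atTop (𝓝 0) := by
        refine tendsto_eLpNorm_two_of_dominated (fun k => hbm k i) ((hgW i).const_mul (C + 1))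
          (fun k => .of_forall (hbB k i)) ?_
        filter_upwards [ae_restrict_mem hW.measurableSet] with q hq
        refine tendsto_const_nhds.congr' ?_
        -- At a fixed point with `u > 0`, once `k * u > 4` the scaled value `(k + 1) * φ k` exceeds
        -- `4 - 1 = 3`, where `F` is the identity, so `b` vanishes exactly.
        have hlarge : ∀ᶠ k : ℕ in atTop, 4 < (k : ℝ) * u q :=
          ((tendsto_natCast_atTop_atTop (R := ℝ)).atTop_mul_const (huW q hq)).eventually_gt_atTop 4
        filter_upwards [hlarge] with k hk
        have h3 : 3 < ((k : ℝ) + 1) * φ k q := by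
          have h4 := (abs_le.1 (hφu k q (hWΩ hq))).1
          have h5 : ((k : ℝ) + 1) * (u q - ((k : ℝ) + 1)⁻¹) ≤ ((k : ℝ) + 1) * φ k q :=
            mul_le_mul_of_nonneg_left (by linarith) (hK k).le
          rw [mul_sub, mul_inv_cancel₀ (hK k).ne'] at h5
          nlinarith [huW q hq]
        have h6 : F =ᶠ[𝓝 (((k : ℝ) + 1) * φ k q)] id := by
          filter_upwards [Ioi_mem_nhds h3] with t ht using hF3 t (le_of_lt ht)
        simp only [hb]
        rw [h6.deriv_eq, deriv_id, sub_self, zero_mul]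
      refine tendsto_of_tendsto_of_tendsto_of_le_of_le tendsto_const_nhds ?_
        (fun _ => zero_le) h1
      simpa using (ENNReal.Tendsto.const_mul hinv (Or.inr (ENNReal.ofReal_ne_top (r := C)))).add h2
  · refine ⟨w k, hws k, ?_, MemLp.coeFn_toLp (hwL k), fun i => MemLp.coeFn_toLp (hdL k i)⟩
    refine eq_empty_of_forall_notMem ?_
    rintro y ⟨⟨hy1, hy2⟩, hyA⟩
    -- A non-zero value needs `φ k > 2 / (k + 1)`, hence `u ≥ 1 / (k + 1)`. Such points cannot
    -- accumulate where `u` tends to zero, which gives the support condition in the ambient set `A`.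
    have hsub : {x ∈ W | w k x ≠ 0} ⊆ {x ∈ Ω | ((k : ℝ) + 1)⁻¹ ≤ u x} := by
      rintro q ⟨hq, hq0⟩
      refine ⟨hWΩ hq, ?_⟩
      by_contra hlt
      refine hq0 ?_
      have h4 := (abs_le.1 (hφu k q (hWΩ hq))).2
      simp only [hw, hFk]
      rw [hF2, zero_div]
      have h5 : ((k : ℝ) + 1) * φ k q ≤ ((k : ℝ) + 1) * (2 * ((k : ℝ) + 1)⁻¹) :=
        mul_le_mul_of_nonneg_left (by linarith [not_le.1 hlt]) (hK k).le
      rwa [mul_left_comm, mul_inv_cancel₀ (hK k).ne', mul_one] at h5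
    have hev : ∀ᶠ x in 𝓝 y, x ∈ Ω → u x < ((k : ℝ) + 1)⁻¹ :=
      eventually_nhdsWithin_iff.1 ((hA y ⟨hy2, hyA⟩).eventually_lt_const (inv_pos.2 (hK k)))
    obtain ⟨x, hx, hx'⟩ := (mem_closure_iff_frequently.1 (closure_mono hsub hy1)).and_eventually hev
      |>.exists
    exact absurd (hx' hx.1) (not_lt.2 hx.2)

end CCStructure

/-! ### Picone's inequality and the lower bound for the form. -/

lemma two_mul_le_of_pos {η : ℝ} (hη : 0 < η) (a b : ℝ) : 2 * (a * b) ≤ η * a ^ 2 + η⁻¹ * b ^ 2 := by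
  have h : η * a ^ 2 + η⁻¹ * b ^ 2 - 2 * (a * b) = η * (a - η⁻¹ * b) ^ 2 := by
    field_simp
    ring
  nlinarith [mul_nonneg hη.le (sq_nonneg (a - η⁻¹ * b))]

/-- Picone's inequality with an error term. -/
lemma picone_inequality {b c f g r η B : ℝ} (hc : |c| ≤ 1) (hb : |b| ≤ B) (hη : 0 < η) :
    (2 * b * c * f - b ^ 2 * (g + r)) * g ≤
      f ^ 2 + (2 * B + B ^ 2) * (η * (f ^ 2 + g ^ 2) + (η⁻¹ + 1) * r ^ 2) := by
  have hB : 0 ≤ B := (abs_nonneg b).trans hb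
  have hη' : 0 < η⁻¹ := inv_pos.2 hη
  have hc2 : c ^ 2 ≤ 1 := (sq_le_one_iff_abs_le_one c).2 hc
  have hb2 : b ^ 2 ≤ B ^ 2 := by rw [← sq_abs]; exact pow_le_pow_left₀ (abs_nonneg b) hb 2
  -- This is the inequality proper, from `(c f - b (g + r))² ≥ 0` and `c² ≤ 1`. The other estimates
  -- pay for multiplying by `g` in place of `g + r`.
  have e1 : (2 * b * c * f - b ^ 2 * (g + r)) * (g + r) ≤ f ^ 2 := by
    nlinarith [sq_nonneg (c * f - b * (g + r)), mul_le_mul_of_nonneg_right hc2 (sq_nonneg f)]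
  have e2 : -(2 * b * c * f * r) ≤ B * (η * f ^ 2 + η⁻¹ * r ^ 2) := by
    have h1 := two_mul_le_of_pos hη |f| |r|
    rw [sq_abs, sq_abs] at h1
    have h2 : -(2 * b * c * f * r) ≤ |b| * |c| * (2 * (|f| * |r|)) := by
      refine (neg_le_abs _).trans (le_of_eq ?_)
      simp only [abs_mul, abs_two]
      ring
    have h3 : |b| * |c| ≤ B := by
      calc |b| * |c| ≤ B * 1 := mul_le_mul hb hc (abs_nonneg c) hB
        _ = B := mul_one B
    exact h2.trans (mul_le_mul h3 h1 (by positivity) hB)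
  have e3 : b ^ 2 * (g * r) ≤ B ^ 2 * (η * g ^ 2 + η⁻¹ * r ^ 2) := by
    have h1 := two_mul_le_of_pos hη |g| |r|
    rw [sq_abs, sq_abs] at h1
    have h2 : g * r ≤ 2 * (|g| * |r|) := by
      rw [← abs_mul]
      linarith [le_abs_self (g * r), abs_nonneg (g * r)]
    calc b ^ 2 * (g * r) ≤ b ^ 2 * (η * g ^ 2 + η⁻¹ * r ^ 2) :=
          mul_le_mul_of_nonneg_left (h2.trans h1) (sq_nonneg b)
      _ ≤ _ := mul_le_mul_of_nonneg_right hb2 (by positivity)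
  have e4 : b ^ 2 * r ^ 2 ≤ B ^ 2 * r ^ 2 := mul_le_mul_of_nonneg_right hb2 (sq_nonneg r)
  have p1 : 0 ≤ B * (η * f ^ 2) := by positivity
  have p2 : 0 ≤ B * (η * g ^ 2) := by positivity
  have p3 : 0 ≤ B * (η⁻¹ * r ^ 2) := by positivity
  have p4 : 0 ≤ B ^ 2 * (η * f ^ 2) := by positivity
  have p5 : 0 ≤ B * r ^ 2 := by positivity
  nlinarith

/-- `N sin (t / N)` is a bounded smooth substitute for `t` that vanishes at `0` and has derivative a
cosine; the `sinc` form gives both its limit and its domination by `|t|`. -/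
lemma mul_sin_div_eq {N : ℝ} (hN : N ≠ 0) (t : ℝ) :
    N * Real.sin (t / N) = t * Real.sinc (t / N) := by
  rcases eq_or_ne t 0 with rfl | ht
  · simp
  · rw [Real.sinc_of_ne_zero (div_ne_zero ht hN)]
    field_simp

lemma abs_mul_sin_div_le {N : ℝ} (hN : N ≠ 0) (t : ℝ) : |N * Real.sin (t / N)| ≤ |t| := by
  rw [mul_sin_div_eq hN, abs_mul]
  exact mul_le_of_le_one_right (abs_nonneg t) (Real.abs_sinc_le_one _)

namespace CCStructure

variable {n m : ℕ} {M : Type*} [TopologicalSpace M] [ChartedSpace (EuclideanSpace ℝ (Fin n)) M]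
  [IsManifold (𝓡 n) ∞ M] {S : CCStructure n m M} [MeasurableSpace M] [BorelSpace M] [T2Space M]
  [SecondCountableTopology M]

/-- The test function `(N sin (φ / N))² / (u + 2 / N)`, up to smoothing of `u`, in the weak
eigenvalue equation. -/
lemma nodal_poincare_aux {Ω W Z : Set M} (hΩ : IsOpen Ω) (hΩb : IsCompact (closure Ω))
    {u : M → ℝ} (huc : ContinuousOn u Ω) (hW : IsOpen W) (hWΩ : W ⊆ Ω) (hu0 : ∀ x ∈ W, 0 < u x)
    {p : S.L2 Ω × (Fin m → S.L2 Ω)} (hp : p ∈ S.sobolev Ω) (hpu : p.1 =ᵐ[S.vol.restrict Ω] u)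
    {lam : ℝ} (hlam : 0 < lam)
    (heq : ∀ q ∈ S.mixedSmooth Ω W Z, ∑ i, inner ℝ (q.2 i) (S.restr hWΩ (p.2 i)) =
      lam * ∫ x in W, q.1 x * u x ∂S.vol)
    {q : S.L2 W × (Fin m → S.L2 W)} (hq : q ∈ S.mixedSmooth Ω W Z) {N : ℝ} (hN : 0 < N) :
    lam * ∫ x in W, (N * Real.sin (q.1 x / N)) ^ 2 * (u x / (u x + 3 * N⁻¹)) ∂S.vol ≤
      ∑ i, ‖q.2 i‖ ^ 2 := by
  have := S.isFiniteMeasure_restrict hΩb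
  have hle : S.vol.restrict W ≤ S.vol.restrict Ω := Measure.restrict_mono hWΩ le_rfl
  have : IsFiniteMeasure (S.vol.restrict W) := isFiniteMeasure_of_le _ hle
  obtain ⟨φ, hφ, hcl, h1, h2⟩ := hq
  set δ := N⁻¹ with hδ
  have hδ0 : 0 < δ := inv_pos.2 hN
  -- `B` bounds `β * ι`: the sine factor is at most `N`, and so is the reciprocal, whose denominator
  -- is at least `δ = N⁻¹`.
  set B := N ^ 2 with hB
  set A := 2 * B + B ^ 2 with hA
  have hA0 : 0 ≤ A := by positivity
  set G : Fin m → S.L2 W := fun i => S.restr hWΩ (p.2 i) with hG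
  set K := A * ∑ i, (‖q.2 i‖ ^ 2 + ‖G i‖ ^ 2 + 2) with hK
  have hK0 : 0 ≤ K := mul_nonneg hA0 (Finset.sum_nonneg fun i _ => by positivity)
  have hae : ∫ x in W, (N * Real.sin (q.1 x / N)) ^ 2 * (u x / (u x + 3 * δ)) ∂S.vol =
      ∫ x in W, (N * Real.sin (φ x / N)) ^ 2 * (u x / (u x + 3 * δ)) ∂S.vol := by
    refine integral_congr_ae ?_
    filter_upwards [h1] with x hx
    rw [hx]
  rw [hae]
  -- `η` measures how well `u` is replaced by a smooth function; `N` and `δ` stay fixed, so `K` does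
  -- not depend on it and the error disappears as `η → 0`.
  suffices h : ∀ η, 0 < η → η ≤ δ → η ≤ 1 →
      lam * ∫ x in W, (N * Real.sin (φ x / N)) ^ 2 * (u x / (u x + 3 * δ)) ∂S.vol ≤
        ∑ i, ‖q.2 i‖ ^ 2 + η * K by
    refine le_of_forall_pos_le_add fun e he => ?_
    have hη := h (min (min δ 1) (e / (K + 1))) (by positivity)
      ((min_le_left _ _).trans (min_le_left _ _)) ((min_le_left _ _).trans (min_le_right _ _))
    refine hη.trans (add_le_add_right ?_ _)
    calc min (min δ 1) (e / (K + 1)) * K ≤ e / (K + 1) * K :=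
          mul_le_mul_of_nonneg_right (min_le_right _ _) hK0
      _ ≤ e := by
          rw [div_mul_eq_mul_div, div_le_iff₀ (by positivity)]
          nlinarith
  intro η hη hηδ hη1
  obtain ⟨v, hvs, hvu, hvg⟩ := S.exists_smooth_approx hΩ huc hp hpu hη
  have hvW := hvs.mono hWΩ
  -- As `|v - u| ≤ η ≤ δ`, the denominator `v + 2 δ` lies between `u + δ` and `u + 3 δ`. The lower
  -- bound keeps it positive, and the upper one explains the `3 * N⁻¹` in the statement.
  have hv1 : ∀ x ∈ W, u x + δ ≤ v x + 2 * δ := fun x hx => by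
    linarith [(abs_le.1 (hvu x (hWΩ hx))).1]
  have hv2 : ∀ x ∈ W, v x + 2 * δ ≤ u x + 3 * δ := fun x hx => by
    linarith [(abs_le.1 (hvu x (hWΩ hx))).2]
  have hv3 : ∀ x ∈ W, δ ≤ v x + 2 * δ := fun x hx => by linarith [hv1 x hx, hu0 x hx]
  have hv0 : ∀ x ∈ W, 0 < v x + 2 * δ := fun x hx => hδ0.trans_le (hv3 x hx)
  set β : M → ℝ := fun x => N * Real.sin (φ x / N) with hβ
  set ι : M → ℝ := fun x => (v x + 2 * δ)⁻¹ with hι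
  set τ : M → ℝ := fun x => β x * (β x * ι x) with hτ
  have hFs : ContDiff ℝ ∞ fun t : ℝ => N * Real.sin (t / N) :=
    contDiff_const.mul (Real.contDiff_sin.comp (contDiff_id.div_const N))
  have hβs : ContMDiffOn (𝓡 n) 𝓘(ℝ, ℝ) ∞ β W := hFs.contMDiff.comp_contMDiffOn hφ
  have hJs : ∀ x ∈ W, ContDiffAt ℝ ∞ (fun t : ℝ => (t + 2 * δ)⁻¹) (v x) := fun x hx =>
    (contDiffAt_id.add contDiffAt_const).inv (hv0 x hx).ne'
  have hιs : ContMDiffOn (𝓡 n) 𝓘(ℝ, ℝ) ∞ ι W := fun x hx =>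
    ((hJs x hx).contMDiffAt.comp x (hvW.contMDiffAt (hW.mem_nhds hx))).contMDiffWithinAt
  have hτs : ContMDiffOn (𝓡 n) 𝓘(ℝ, ℝ) ∞ τ W := hβs.mul (hβs.mul hιs)
  have hβd : ∀ i, ∀ x ∈ W, dirDeriv (S.X i) β x = Real.cos (φ x / N) * dirDeriv (S.X i) φ x :=
    fun i x hx => by
      have hd : HasDerivAt (fun t : ℝ => N * Real.sin (t / N)) (Real.cos (φ x / N)) (φ x) := by
        have h3 : HasDerivAt (fun t : ℝ => N * Real.sin (t / N))
            (N * (Real.cos (φ x / N) * (1 / N))) (φ x) :=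
          ((hasDerivAt_id (φ x)).div_const N).sin.const_mul N
        exact h3.congr_deriv (by field_simp)
      rw [← hd.deriv]
      exact dirDeriv_comp _ (hφ.contMDiffAt (hW.mem_nhds hx)) hFs.contDiffAt
  have hιd : ∀ i, ∀ x ∈ W, dirDeriv (S.X i) ι x = -(ι x) ^ 2 * dirDeriv (S.X i) v x :=
    fun i x hx => by
      have hd : HasDerivAt (fun t : ℝ => (t + 2 * δ)⁻¹) (-(ι x) ^ 2) (v x) := by
        have h3 : HasDerivAt (fun t : ℝ => (t + 2 * δ)⁻¹) (-1 / (v x + 2 * δ) ^ 2) (v x) :=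
          ((hasDerivAt_id (v x)).add_const (2 * δ)).inv (hv0 x hx).ne'
        exact h3.congr_deriv (by simp only [hι, inv_pow]; ring)
      rw [← hd.deriv]
      exact dirDeriv_comp _ (hvW.contMDiffAt (hW.mem_nhds hx)) (hJs x hx)
  -- The quotient rule for `β² / (v + 2 δ)`, in the shape of the left side of `picone_inequality`
  -- with `c` the cosine and `b = β ι`.
  have hτd : ∀ i, ∀ x ∈ W, dirDeriv (S.X i) τ x =
      2 * (β x * ι x) * Real.cos (φ x / N) * dirDeriv (S.X i) φ x -
        (β x * ι x) ^ 2 * dirDeriv (S.X i) v x := fun i x hx => by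
    have hx' := hW.mem_nhds hx
    have c1 := hβs.contMDiffAt hx'
    have c2 := hιs.contMDiffAt hx'
    rw [hτ, dirDeriv_mul (S.X i) (g := fun x => β x * ι x) c1 (c1.mul c2),
      dirDeriv_mul (S.X i) c1 c2, hβd i x hx,
      hιd i x hx]
    ring
  have hβN : ∀ x, |β x| ≤ N := fun x => by
    simp only [hβ]
    rw [abs_mul, abs_of_pos hN]
    exact mul_le_of_le_one_right hN.le (Real.abs_sin_le_one _)
  have hιN : ∀ x ∈ W, |ι x| ≤ N := fun x hx => by
    simp only [hι]
    rw [abs_of_pos (inv_pos.2 (hv0 x hx))]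
    exact inv_le_of_inv_le₀ hN (hv3 x hx)
  have hbB : ∀ x ∈ W, |β x * ι x| ≤ B := fun x hx => by
    rw [abs_mul, hB, sq]
    exact mul_le_mul (hβN x) (hιN x hx) (abs_nonneg _) hN.le
  have hWm := hW.measurableSet
  have huW : MemLp u 2 (S.vol.restrict W) :=
    ((Lp.memLp p.1).mono_measure hle).ae_eq (hpu.filter_mono (ae_mono hle))
  have hτL : MemLp τ 2 (S.vol.restrict W) :=
    MemLp.of_bound (hτs.continuousOn.aestronglyMeasurable hWm) (N * B) (by
      filter_upwards [ae_restrict_mem hWm] with x hx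
      simp only [hτ]
      rw [norm_mul]
      exact mul_le_mul (hβN x) (hbB x hx) (norm_nonneg _) hN.le)
  have hdm : ∀ {ψ : M → ℝ}, ContMDiffOn (𝓡 n) 𝓘(ℝ, ℝ) ∞ ψ W → ∀ i,
      AEStronglyMeasurable (dirDeriv (S.X i) ψ) (S.vol.restrict W) := fun hψ i =>
    (continuousOn_dirDeriv (S.smooth_X i) hW hψ).aestronglyMeasurable hWm
  have hfL : ∀ i, MemLp (dirDeriv (S.X i) φ) 2 (S.vol.restrict W) := fun i =>
    (Lp.memLp (q.2 i)).ae_eq (h2 i)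
  have hgL : ∀ i, MemLp (p.2 i) 2 (S.vol.restrict W) := fun i => (Lp.memLp _).mono_measure hle
  set r : Fin m → M → ℝ := fun i x => dirDeriv (S.X i) v x - p.2 i x with hr
  have hrN : ∀ i, eLpNorm (r i) 2 (S.vol.restrict W) ≤ ENNReal.ofReal η := fun i =>
    (eLpNorm_mono_measure _ hle).trans (hvg i)
  have hrL : ∀ i, MemLp (r i) 2 (S.vol.restrict W) := fun i =>
    ⟨(hdm hvW i).sub (hgL i).1, (hrN i).trans_lt ENNReal.ofReal_lt_top⟩
  have hr2 : ∀ i, ∫ x in W, r i x ^ 2 ∂S.vol ≤ η ^ 2 := fun i => by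
    have h3 : ‖(hrL i).toLp _‖ ≤ η := by
      rw [Lp.norm_toLp]
      exact ENNReal.toReal_le_of_le_ofReal hη.le (hrN i)
    have h4 : ‖((hrL i).toLp _ : S.L2 W)‖ ^ 2 = ∫ x in W, r i x ^ 2 ∂S.vol := by
      rw [norm_sq_L2]
      refine integral_congr_ae ?_
      filter_upwards [MemLp.coeFn_toLp (hrL i)] with x hx
      rw [hx, sq]
    rw [← h4]
    exact pow_le_pow_left₀ (norm_nonneg _) h3 2
  have hdτ : ∀ i, ∀ x ∈ W, dirDeriv (S.X i) τ x =
      2 * (β x * ι x) * Real.cos (φ x / N) * dirDeriv (S.X i) φ x -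
        (β x * ι x) ^ 2 * (p.2 i x + r i x) := fun i x hx => by
    rw [hτd i x hx]
    simp only [hr]
    ring
  have hvL : ∀ i, MemLp (dirDeriv (S.X i) v) 2 (S.vol.restrict W) := fun i => by
    refine ((hgL i).add (hrL i)).ae_eq (.of_forall fun x => ?_)
    simp only [Pi.add_apply, hr]
    ring
  have hdτL : ∀ i, MemLp (dirDeriv (S.X i) τ) 2 (S.vol.restrict W) := fun i => by
    refine (((hfL i).norm.const_mul (2 * B)).add ((hvL i).norm.const_mul (B ^ 2))).mono
      (hdm hτs i) ?_
    filter_upwards [ae_restrict_mem hWm] with x hx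
    rw [hτd i x hx]
    simp only [Pi.add_apply, Real.norm_eq_abs]
    refine (abs_sub _ _).trans ?_
    rw [abs_of_nonneg (by positivity : (0 : ℝ) ≤ 2 * B * |dirDeriv (S.X i) φ x| +
      B ^ 2 * |dirDeriv (S.X i) v x|)]
    refine add_le_add ?_ ?_
    · rw [abs_mul]
      refine mul_le_mul_of_nonneg_right ?_ (abs_nonneg _)
      rw [abs_mul, abs_mul, abs_two]
      exact (mul_le_of_le_one_right (by positivity) (Real.abs_cos_le_one _)).trans
        (mul_le_mul_of_nonneg_left (hbB x hx) zero_le_two)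
    · rw [abs_mul, abs_pow]
      exact mul_le_mul_of_nonneg_right (pow_le_pow_left₀ (abs_nonneg _) (hbB x hx) 2)
        (abs_nonneg _)
  have hmem : ((hτL.toLp _, fun i => (hdτL i).toLp _) : S.L2 W × (Fin m → S.L2 W)) ∈
      S.mixedSmooth Ω W Z := by
    refine ⟨τ, hτs, ?_, MemLp.coeFn_toLp hτL, fun i => MemLp.coeFn_toLp (hdτL i)⟩
    -- The sine vanishes where `φ` does, so passing from `φ` to `τ` does not enlarge the support.
    refine subset_empty_iff.1 (hcl ▸ inter_subset_inter_left _ (inter_subset_inter_left _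
      (closure_mono ?_)))
    rintro x ⟨hx, hx0⟩
    refine ⟨hx, fun h0 => hx0 ?_⟩
    simp only [hτ, hβ, h0, zero_div, Real.sin_zero, mul_zero, zero_mul]
  have hmain := heq _ hmem
  have hL : lam * ∫ x in W, (N * Real.sin (φ x / N)) ^ 2 * (u x / (u x + 3 * δ)) ∂S.vol ≤
      lam * ∫ x in W, (hτL.toLp _ : M → ℝ) x * u x ∂S.vol := by
    have e1 : ∫ x in W, (hτL.toLp _ : M → ℝ) x * u x ∂S.vol = ∫ x in W, τ x * u x ∂S.vol := by
      refine integral_congr_ae ?_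
      filter_upwards [MemLp.coeFn_toLp hτL] with x hx
      rw [hx]
    rw [e1]
    refine mul_le_mul_of_nonneg_left (integral_mono_of_nonneg ?_ (hτL.integrable_mul huW) ?_)
      hlam.le
    · filter_upwards [ae_restrict_mem hWm] with x hx
      have := hu0 x hx
      exact mul_nonneg (sq_nonneg _) (div_nonneg this.le (by positivity))
    · filter_upwards [ae_restrict_mem hWm] with x hx
      have hux := hu0 x hx
      have h3 : (u x + 3 * δ)⁻¹ ≤ ι x := inv_anti₀ (hv0 x hx) (hv2 x hx)
      calc (N * Real.sin (φ x / N)) ^ 2 * (u x / (u x + 3 * δ))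
          = β x ^ 2 * u x * (u x + 3 * δ)⁻¹ := by simp only [hβ]; ring
        _ ≤ β x ^ 2 * u x * ι x := mul_le_mul_of_nonneg_left h3 (by positivity)
        _ = (τ * u) x := by simp only [hτ, Pi.mul_apply]; ring
  refine hL.trans ?_
  rw [← hmain, hK, Finset.mul_sum, Finset.mul_sum, ← Finset.sum_add_distrib]
  refine Finset.sum_le_sum fun i _ => ?_
  have nf : ‖q.2 i‖ ^ 2 = ∫ x in W, dirDeriv (S.X i) φ x ^ 2 ∂S.vol := by
    rw [norm_sq_L2]
    refine integral_congr_ae ?_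
    filter_upwards [h2 i] with x hx
    rw [hx, sq]
  have ng : ‖G i‖ ^ 2 = ∫ x in W, p.2 i x ^ 2 ∂S.vol := by
    rw [norm_sq_L2]
    refine integral_congr_ae ?_
    filter_upwards [coeFn_restr hWΩ (p.2 i)] with x hx
    rw [hx, sq]
  have i1 := (hfL i).integrable_sq
  have i2 := (hgL i).integrable_sq
  have i3 := (hrL i).integrable_sq
  have j1 : Integrable (fun x => dirDeriv (S.X i) φ x ^ 2 + p.2 i x ^ 2) (S.vol.restrict W) :=
    i1.add i2
  have j2 : Integrable (fun x => η * (dirDeriv (S.X i) φ x ^ 2 + p.2 i x ^ 2) +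
      (η⁻¹ + 1) * r i x ^ 2) (S.vol.restrict W) := (j1.const_mul η).add (i3.const_mul _)
  have e1 : inner ℝ ((hdτL i).toLp _) (G i) =
      ∫ x in W, dirDeriv (S.X i) τ x * p.2 i x ∂S.vol := by
    rw [inner_L2]
    refine integral_congr_ae ?_
    filter_upwards [MemLp.coeFn_toLp (hdτL i), coeFn_restr hWΩ (p.2 i)] with x hx1 hx2
    rw [hx1, hx2]
  have e2 : ∫ x in W, dirDeriv (S.X i) τ x * p.2 i x ∂S.vol ≤
      ∫ x in W, (dirDeriv (S.X i) φ x ^ 2 + A * (η * (dirDeriv (S.X i) φ x ^ 2 + p.2 i x ^ 2) +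
        (η⁻¹ + 1) * r i x ^ 2)) ∂S.vol := by
    refine integral_mono_ae ((hdτL i).integrable_mul (hgL i))
      (i1.add (j2.const_mul A)) ?_
    filter_upwards [ae_restrict_mem hWm] with x hx
    rw [hdτ i x hx]
    exact picone_inequality (Real.abs_cos_le_one _) (hbB x hx) hη
  have e3 : ∫ x in W, (dirDeriv (S.X i) φ x ^ 2 + A * (η * (dirDeriv (S.X i) φ x ^ 2 +
      p.2 i x ^ 2) + (η⁻¹ + 1) * r i x ^ 2)) ∂S.vol =
      ‖q.2 i‖ ^ 2 + A * (η * (‖q.2 i‖ ^ 2 + ‖G i‖ ^ 2) +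
        (η⁻¹ + 1) * ∫ x in W, r i x ^ 2 ∂S.vol) := by
    rw [integral_add i1 (j2.const_mul A), integral_const_mul,
      integral_add (j1.const_mul η) (i3.const_mul _),
      integral_const_mul, integral_const_mul, integral_add i1 i2, nf, ng]
  rw [e1]
  refine e2.trans (e3.le.trans ?_)
  -- The remainder has squared norm at most `η²`, which outweighs the factor `η⁻¹`; this is the
  -- origin of the `+ 2` in `K`.
  have h3 : (η⁻¹ + 1) * ∫ x in W, r i x ^ 2 ∂S.vol ≤ η * 2 := by
    calc (η⁻¹ + 1) * ∫ x in W, r i x ^ 2 ∂S.vol ≤ (η⁻¹ + 1) * η ^ 2 :=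
          mul_le_mul_of_nonneg_left (hr2 i) (by positivity)
      _ = η + η ^ 2 := by field_simp
      _ ≤ η * 2 := by nlinarith
  have h4 := mul_le_mul_of_nonneg_left h3 hA0
  have h5 : A * (η * (‖q.2 i‖ ^ 2 + ‖G i‖ ^ 2) + (η⁻¹ + 1) * ∫ x in W, r i x ^ 2 ∂S.vol) ≤
      η * (A * (‖q.2 i‖ ^ 2 + ‖G i‖ ^ 2 + 2)) := by
    rw [mul_add]
    linarith
  linarith

/-- The first eigenvalue of the mixed problem on a nodal domain is at least `lam`. -/
theorem nodal_poincare {Ω W Z : Set M} (hΩ : IsOpen Ω) (hΩb : IsCompact (closure Ω))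
    {u : M → ℝ} (huc : ContinuousOn u Ω) (hW : IsOpen W) (hWΩ : W ⊆ Ω) (hu0 : ∀ x ∈ W, 0 < u x)
    {p : S.L2 Ω × (Fin m → S.L2 Ω)} (hp : p ∈ S.sobolev Ω) (hpu : p.1 =ᵐ[S.vol.restrict Ω] u)
    {lam : ℝ} (hlam : 0 < lam)
    (heq : ∀ q ∈ S.mixedSmooth Ω W Z, ∑ i, inner ℝ (q.2 i) (S.restr hWΩ (p.2 i)) =
      lam * ∫ x in W, q.1 x * u x ∂S.vol)
    {q : S.L2 W × (Fin m → S.L2 W)} (hq : q ∈ S.mixedSmooth Ω W Z) :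
    lam * ‖q.1‖ ^ 2 ≤ ∑ i, ‖q.2 i‖ ^ 2 := by
  have hN : ∀ k : ℕ, (0 : ℝ) < k + 1 := fun k => by positivity
  have hinv : Tendsto (fun k : ℕ => ((k : ℝ) + 1)⁻¹) atTop (𝓝 0) := by
    simpa [one_div] using tendsto_one_div_add_atTop_nhds_zero_nat (𝕜 := ℝ)
  have hum : AEStronglyMeasurable u (S.vol.restrict W) :=
    (huc.mono hWΩ).aestronglyMeasurable hW.measurableSet
  have hlim : Tendsto (fun k : ℕ => ∫ x in W, (((k : ℝ) + 1) * Real.sin (q.1 x / ((k : ℝ) + 1))) ^ 2 *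
      (u x / (u x + 3 * ((k : ℝ) + 1)⁻¹)) ∂S.vol) atTop (𝓝 (∫ x in W, q.1 x * q.1 x ∂S.vol)) := by
    -- With `N = k + 1`, the first factor tends to `q.1 x` squared and the quotient to `1` because
    -- `u > 0`; both are dominated as `|N sin (t / N)| ≤ |t|` and the quotient is at most `1`.
    refine tendsto_integral_of_dominated_convergence (fun x => q.1 x ^ 2) (fun k => ?_)
      (Lp.memLp q.1).integrable_sq (fun k => ?_) ?_
    · have h1 : AEStronglyMeasurable (fun x => q.1 x / ((k : ℝ) + 1)) (S.vol.restrict W) := by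
        simpa [div_eq_mul_inv] using (Lp.aestronglyMeasurable q.1).mul_const (((k : ℝ) + 1)⁻¹)
      have h2 := ((Real.continuous_sin.comp_aestronglyMeasurable h1).const_mul ((k : ℝ) + 1)).pow 2
      have h3 : AEStronglyMeasurable (fun x => u x / (u x + 3 * ((k : ℝ) + 1)⁻¹))
          (S.vol.restrict W) :=
        (hum.aemeasurable.div (hum.aemeasurable.add_const _)).aestronglyMeasurable
      exact h2.mul h3
    · filter_upwards [ae_restrict_mem hW.measurableSet] with x hx
      have hux := hu0 x hx
      have hk := inv_pos.2 (hN k)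
      have h1 : |u x / (u x + 3 * ((k : ℝ) + 1)⁻¹)| ≤ 1 := by
        rw [abs_of_nonneg (by positivity)]
        exact div_le_one_of_le₀ (by linarith) (by positivity)
      rw [norm_mul, norm_pow, Real.norm_eq_abs, Real.norm_eq_abs, ← sq_abs (q.1 x)]
      exact (mul_le_of_le_one_right (by positivity) h1).trans
        (pow_le_pow_left₀ (abs_nonneg _) (abs_mul_sin_div_le (hN k).ne' _) 2)
    · filter_upwards [ae_restrict_mem hW.measurableSet] with x hx
      have hux := hu0 x hx
      have h1 : Tendsto (fun k : ℕ => ((k : ℝ) + 1) * Real.sin (q.1 x / ((k : ℝ) + 1))) atTop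
          (𝓝 (q.1 x)) := by
        have h2 : Tendsto (fun k : ℕ => q.1 x * Real.sinc (q.1 x * ((k : ℝ) + 1)⁻¹)) atTop
            (𝓝 (q.1 x * Real.sinc (q.1 x * 0))) :=
          ((Real.continuous_sinc.tendsto _).comp (hinv.const_mul _)).const_mul _
        rw [mul_zero, Real.sinc_zero, mul_one] at h2
        refine h2.congr fun k => ?_
        rw [mul_sin_div_eq (hN k).ne', div_eq_mul_inv]
      have h3 : Tendsto (fun k : ℕ => u x / (u x + 3 * ((k : ℝ) + 1)⁻¹)) atTop (𝓝 1) := by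
        have h4 : Tendsto (fun k : ℕ => u x / (u x + 3 * ((k : ℝ) + 1)⁻¹)) atTop
            (𝓝 (u x / (u x + 3 * 0))) :=
          tendsto_const_nhds.div (tendsto_const_nhds.add (hinv.const_mul 3)) (by simpa using hux.ne')
        simpa [hux.ne'] using h4
      have h5 := (h1.pow 2).mul h3
      rw [mul_one, sq] at h5
      exact h5
  rw [norm_sq_L2]
  exact le_of_tendsto' (hlim.const_mul lam) fun k =>
    nodal_poincare_aux hΩ hΩb huc hW hWΩ hu0 hp hpu hlam heq hq (hN k)

end CCStructure

/-! ### Assembly of the result for both choices of the ambient space. -/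

namespace CCStructure

variable {n m : ℕ} {M : Type*} [TopologicalSpace M] [ChartedSpace (EuclideanSpace ℝ (Fin n)) M]
  [IsManifold (𝓡 n) ∞ M] {S : CCStructure n m M} [MeasurableSpace M] [BorelSpace M] [T2Space M]
  [SecondCountableTopology M]

/-- A Neumann eigenfunction restricts to a first eigenfunction of the mixed problem on
`{u > 0}`. -/
theorem nodal_first_eigenvalue {Ω W Z A : Set M} (hΩ : IsOpen Ω) (hΩb : IsCompact (closure Ω))
    {u : M → ℝ} (huc : ContinuousOn u Ω) (hplus : W = {x ∈ Ω | 0 < u x})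
    (hZ : Z = {x ∈ Ω | u x = 0}) (hne : W.Nonempty) (hΩA : Ω ⊆ A)
    (hA : ∀ y ∈ closure Z ∩ A, Tendsto u (𝓝[Ω] y) (𝓝 0)) {lam : ℝ} (hlam : 0 < lam)
    (hu : IsEigenfunction (S.sobolev Ω) lam u) :
    IsEigenfunction (S.mixedSobolev A W Z) lam u ∧ IsKthEigenvalue (S.mixedSobolev A W Z) 1 lam ∧
      IsRayleighMin (S.mixedSobolev A W Z) lam := by
  obtain ⟨huL, -, g, hg, hgeq⟩ := hu
  have hW : IsOpen W := by
    rw [hplus]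
    exact huc.isOpen_inter_preimage hΩ isOpen_Ioi
  have hWΩ : W ⊆ Ω := by rw [hplus]; exact sep_subset _ _
  have hu0 : ∀ x ∈ W, 0 < u x := fun x hx => by rw [hplus] at hx; exact hx.2
  have hle : S.vol.restrict W ≤ S.vol.restrict Ω := Measure.restrict_mono hWΩ le_rfl
  have hpu : (huL.toLp u : M → ℝ) =ᵐ[S.vol.restrict Ω] u := huL.coeFn_toLp
  have huW : MemLp u 2 (S.vol.restrict W) := huL.mono_measure hle
  have hUW : huW.toLp u = S.restr hWΩ (huL.toLp u) := by
    refine Lp.ext ?_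
    filter_upwards [huW.coeFn_toLp, coeFn_restr hWΩ (huL.toLp u),
      hpu.filter_mono (ae_mono hle)] with x h1 h2 h3
    rw [h1, h2, h3]
  have hU0 : huW.toLp u ≠ 0 := by
    intro h0
    rw [Lp.eq_zero_iff_ae_eq_zero] at h0
    have h1 : ∀ᵐ x ∂S.vol.restrict W, False := by
      filter_upwards [h0, huW.coeFn_toLp, ae_restrict_mem hW.measurableSet] with x e1 e2 hx
      rw [e1] at e2
      exact (hu0 x hx).ne e2
    rw [ae_restrict_iff' hW.measurableSet, ae_iff] at h1
    refine hW.measure_ne_zero S.vol hne ?_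
    simpa using h1
  -- A larger ambient set admits fewer test functions, so the equation and the lower bound are
  -- inherited from the case `A = Ω`. Only the membership of `u` in the form domain depends on `A`.
  have hsub : S.mixedSmooth A W Z ⊆ S.mixedSmooth Ω W Z := by
    rintro q ⟨φ, h1, h2, h3⟩
    exact ⟨φ, h1, subset_empty_iff.1 (h2 ▸ inter_subset_inter_right _ hΩA), h3⟩
  have hsmul : S.restr hWΩ (lam • huL.toLp u) = lam • huW.toLp u := by
    refine Lp.ext ?_
    filter_upwards [coeFn_restr hWΩ (lam • huL.toLp u), Lp.coeFn_smul lam (huW.toLp u),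
      (Lp.coeFn_smul lam (huL.toLp u)).filter_mono (ae_mono hle), huW.coeFn_toLp,
      hpu.filter_mono (ae_mono hle)] with x h1 h2 h3 h4 h5
    rw [h1, h2, h3, Pi.smul_apply, Pi.smul_apply, h4, h5]
  have hsmooth : ∀ q ∈ S.mixedSmooth Ω W Z, ∑ i, inner ℝ (q.2 i) (S.restr hWΩ (g i)) =
      inner ℝ q.1 (lam • huW.toLp u) := fun q hq => by
    rw [← hsmul]
    exact nodal_equation hΩ huc hplus hZ hW hWΩ hgeq hq
  have hmem : (huW.toLp u, fun i => S.restr hWΩ (g i)) ∈ S.mixedSobolev A W Z := by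
    rw [hUW]
    exact restr_mem_mixedSobolev hΩ hΩb huc hplus hW hWΩ hA hg hpu
  have hE : IsEigenvector (S.mixedSobolev A W Z) lam (huW.toLp u) := by
    refine ⟨hU0, _, hmem, fun q hq => ?_⟩
    -- Both sides of the equation are continuous in the `S¹` topology, so it passes from smooth
    -- functions to the form domain.
    refine closure_minimal (fun q hq => hsmooth q (hsub hq)) (isClosed_eq ?_ ?_) hq
    · exact continuous_finsetSum _ fun i _ =>
        ((continuous_apply i).comp continuous_snd).inner continuous_const
    · exact continuous_fst.inner continuous_const
  have hint : ∀ q ∈ S.mixedSmooth Ω W Z, ∑ i, inner ℝ (q.2 i) (S.restr hWΩ (g i)) =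
      lam * ∫ x in W, q.1 x * u x ∂S.vol := fun q hq => by
    rw [hsmooth q hq, real_inner_smul_right, inner_L2]
    congr 1
    refine integral_congr_ae ?_
    filter_upwards [huW.coeFn_toLp] with x hx
    rw [hx]
  have hle' : ∀ q ∈ S.mixedSobolev A W Z, lam * ‖q.1‖ ^ 2 ≤ ∑ i, ‖q.2 i‖ ^ 2 := fun q hq => by
    have hcl : IsClosed {q : S.L2 W × (Fin m → S.L2 W) |
        lam * ‖q.1‖ ^ 2 ≤ ∑ i, ‖q.2 i‖ ^ 2} :=
      isClosed_le (continuous_const.mul (continuous_fst.norm.pow 2))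
        (continuous_finsetSum _ fun i _ =>
          (((continuous_apply i).comp continuous_snd).norm.pow 2))
    have hss : S.mixedSmooth A W Z ⊆ {q : S.L2 W × (Fin m → S.L2 W) |
        lam * ‖q.1‖ ^ 2 ≤ ∑ i, ‖q.2 i‖ ^ 2} := fun q hq =>
      nodal_poincare hΩ hΩb huc hW hWΩ hu0 hg hpu hlam hint (hsub hq)
    exact closure_minimal hss hcl hq
  exact ⟨⟨huW, hE⟩, first_eigenvalue_of_le hE hle'⟩

end CCStructure

end CC

theorem mainTheorem9 {n m : ℕ} {M : Type*} [TopologicalSpace M] [T2Space M]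
    [SecondCountableTopology M] [ChartedSpace (EuclideanSpace ℝ (Fin n)) M]
    [IsManifold (𝓡 n) ∞ M] [MeasurableSpace M] [BorelSpace M]
    (S : CC.CCStructure n m M)
    (Ω : Set M) (hΩo : IsOpen Ω) (hΩc : IsConnected Ω) (hΩb : IsCompact (closure Ω))
    (lam : ℝ) (hlam : CC.CCStructure.IsKthEigenvalue (S.sobolev Ω) 2 lam)
    (u : M → ℝ) (huc : ContinuousOn u Ω)
    (hu : CC.CCStructure.IsEigenfunction (S.sobolev Ω) lam u)
    (Ωplus Z : Set M) (hplus : Ωplus = {x ∈ Ω | 0 < u x}) (hZ : Z = {x ∈ Ω | u x = 0}) :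
    (CC.CCStructure.IsEigenfunction (S.mixedSobolev Ω Ωplus Z) lam u ∧
      CC.CCStructure.IsKthEigenvalue (S.mixedSobolev Ω Ωplus Z) 1 lam ∧
      CC.CCStructure.IsRayleighMin (S.mixedSobolev Ω Ωplus Z) lam) ∧
    ((∀ y ∈ closure Z, Tendsto u (𝓝[Ω] y) (𝓝 0)) →
      CC.CCStructure.IsEigenfunction (S.mixedSobolev univ Ωplus Z) lam u ∧
      CC.CCStructure.IsKthEigenvalue (S.mixedSobolev univ Ωplus Z) 1 lam ∧
      CC.CCStructure.IsRayleighMin (S.mixedSobolev univ Ωplus Z) lam) := by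
  have hpos := CC.CCStructure.second_eigenvalue_pos hΩo hΩc hΩb hlam
  have hne : Ωplus.Nonempty := by
    obtain ⟨huL, hu0, hneg⟩ := hu
    obtain ⟨x, hx, hux⟩ := CC.CCStructure.exists_pos_of_isNegLaplacian hΩo hΩb hpos.ne'
      huL.coeFn_toLp hu0 hneg
    exact ⟨x, hplus ▸ ⟨hx, hux⟩⟩
  refine ⟨CC.CCStructure.nodal_first_eigenvalue hΩo hΩb huc hplus hZ hne subset_rfl ?_ hpos hu,
    fun hA => CC.CCStructure.nodal_first_eigenvalue hΩo hΩb huc hplus hZ hne (subset_univ _)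
      (fun y hy => hA y hy.1) hpos hu⟩
  -- For closures taken in `Ω` the decay hypothesis is automatic: by continuity `u` vanishes at
  -- every point of `Ω` in the closure of its zero set.
  rintro y ⟨hyZ, hyΩ⟩
  have hc := huc.continuousAt (hΩo.mem_nhds hyΩ)
  have hy0 : u y = 0 := by
    by_contra h
    have hev : ∀ᶠ z in 𝓝 y, u z ≠ 0 := hc.eventually_ne h
    obtain ⟨z, hz, hz'⟩ := ((mem_closure_iff_frequently.1 hyZ).and_eventually hev).exists
    rw [hZ] at hz
    exact hz' hz.2
  rw [← hy0]
  exact huc y hyΩ
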